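/- Let $\mathbb R^4_1$ be $\mathbb R^4$ with the Lorentzian product $\langle v,w\rangle=-(v^1w^4+v^4w^1)+v^2w^2+v^3w^3$, standard basis $\epsilon_1,\dots,\epsilon_4$, and positive light cone $\mathcal L^3_+=\{v:\langle v,v\rangle=0,\ \langle v,\epsilon_1+\epsilon_4\rangle<0\}$. Let $\Lambda$ be the space of isotropic lines $[x,v]=x+\mathbb Rv$, $v\in\mathcal L^3_+$, identified with $\mathbb R^3\times S^2$ by letting $(p,n)$ correspond to the line $\big[\,{}^t(\tfrac{p^1}{\sqrt2},p^2,p^3,-\tfrac{p^1}{\sqrt2}),\ {}^t(\tfrac{1+n^1}{2},\tfrac{n^2}{\sqrt2},\tfrac{n^3}{\sqrt2},\tfrac{1-n^1}{2})\big]$. Let $M$ be a smooth surface and $F=(f,n):M\to\mathbb R^3\times S^2\cong\Lambda$ a smooth nondegenerate Legendre immersion: $df\cdot n=0$, $dn\cdot dn$ is positive definite, and the quadratic forms $df\cdot dn$ and $dn\cdot dn$ are linearly independent at every point of $M$. A *middle frame field* along $F$ on an open set $U\subset M$ consists of smooth maps $a_0,a_1,\dots,a_4:U\to\mathbb R^4_1$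 such that $(a_1,\dots,a_4)$ is an oriented basis with $\langle a_i,a_j\rangle=\langle\epsilon_i,\epsilon_j\rangle$ and $a_1,a_4\in\mathcal L^3_+$, such that $[a_0,a_1]=F$, and such that for some coframe $(\alpha^2,\alpha^3)$ on $U$ and smooth functions $p_1,p_2,p_3,q_1,q_2:U\to\mathbb R$ $$\begin{aligned} da_0&=\alpha^2a_2+\alpha^3a_3,\\ da_1&=(2q_2\alpha^2-2q_1\alpha^3)a_1+\alpha^2a_2-\alpha^3a_3,\\ da_2&=(p_1\alpha^2+p_2\alpha^3)a_1+(q_1\alpha^2+q_2\alpha^3)a_3+\alpha^2a_4,\\ da_3&=(p_2\alpha^2+p_3\alpha^3)a_1-(q_1\alpha^2+q_2\alpha^3)a_2-\alpha^3a_4,\\ da_4&=(p_1\alpha^2+p_2\alpha^3)a_2+(p_2\alpha^2+p_3\alpha^3)a_3-(2q_2\alpha^2-2q_1\alpha^3)a_4. \end{aligned}$$ Such frames exist near every point, and two of them on a connected open set differ at most by the simultaneous sign change of $a_2$ and $a_3$. Hence the vectors $a_0,a_1$, the functions $p_1,p_2,p_3$, and the form $\varphi=\alpha^2+i\alpha^3$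 up to sign, are well defined on $M$. The map $\sigma_F=a_0:M\to\mathbb R^4_1$, a spacelike immersion, is the *L-Gauss map* of $F$. Give $M$ the Riemann surface structure for which $\varphi$ is of type $(1,0)$ (in particular, the orientation $\alpha^2\wedge\alpha^3>0$), and put $$\mathcal Q_F=Q\varphi^4,\quad Q=\tfrac12(p_1-p_3)-ip_2,\qquad \mathcal P_F=P\varphi^2,\quad P=p_1+p_3.$$ $F$ is called *L-isothermic* if around every point of $M$ there are local coordinates that diagonalize both quadratic forms $\langle da_0,da_0\rangle$ and $\langle da_0,da_1\rangle$ and are isothermal for $\langle da_0,da_0\rangle$. Then: 1. $\mathcal Q_F$ is holomorphic if and only if the mean curvature vector $\mathbf H$ of $\sigma_F$ (half the trace of its second fundamental form) is parallel in the normal bundle, $\nabla^\perp\mathbf H=0$. 2. If $\mathcal Q_F$ is holomorphic, then $\mathcal P_F$ is holomorphic. 3. If $M$ is connected, $\mathcal Q_F$ is holomorphic and $\mathcal P_F$ is not identically zero, then $F$ is L-isothermic. 4. If $M$ is connected, $\mathcal Q_F$ is holomorphic and $\mathcal P_F$ is not identically zero, then there is a real constant $c$ with $Q=cP^2$ on $M$.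 -/

import Mathlib

open scoped Manifold ContDiff

namespace Laguerre

noncomputable section

/-! ## Minkowski 4-space and isotropic lines -/

/-- Euclidean 3-space. -/
abbrev E3 : Type := EuclideanSpace ℝ (Fin 3)

/-- The vector space underlying Minkowski 4-space (coordinates `v¹, …, v⁴` are `v 0, …, v 3`). -/
abbrev Mink : Type := Fin 4 → ℝ

/-- The Lorentzian scalar product `⟨v, w⟩ = -(v¹ w⁴ + v⁴ w¹) + v² w² + v³ w³`. -/
def mink (v w : Mink) : ℝ :=
  -(v 0 * w 3 + v 3 * w 0) + v 1 * w 1 + v 2 * w 2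

/-- The standard basis vectors `ε₁, …, ε₄` (indexed from `0`). -/
def stdVec (i : Fin 4) : Mink := Pi.single i 1

/-- The positive light cone. -/
def posLightcone : Set Mink :=
  {v | mink v v = 0 ∧ mink v (stdVec 0 + stdVec 3) < 0}

/-- The isotropic line `[x, v] = {x + t v}`; for `v` in the positive light cone the line is
time-oriented by `v`, so that the line as a set determines the element of Laguerre space. -/
def isotropicLine (x v : Mink) : Set Mink := {y | ∃ t : ℝ, y = x + t • v}

/-- The point of Minkowski space that represents the sphere of centre `p` and signed radius `r`. -/
def spherePoint (p : E3) (r : ℝ) : Mink :=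
  ![(r + p 0) / √2, p 1, p 2, (r - p 0) / √2]

/-- The isotropic normal vector of the oriented planes with unit normal `n`. -/
def planeVec (n : E3) : Mink :=
  ![(1 + n 0) / 2, n 1 / √2, n 2 / √2, (1 - n 0) / 2]

/-- The isotropic line that represents the contact element `(p, n) ∈ ℝ³ × S²`. -/
def contactLine (p n : E3) : Set Mink := isotropicLine (spherePoint p 0) (planeVec n)

/-- `(a₁, a₂, a₃, a₄)` is the linear part of a Laguerre frame: an oriented basis with
`⟨aᵢ, aⱼ⟩ = ⟨εᵢ, εⱼ⟩` and `a₁, a₄` in the positive light cone. -/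
def IsLaguerreFrame (a : Fin 4 → Mink) : Prop :=
  (∀ i j, mink (a i) (a j) = mink (stdVec i) (stdVec j)) ∧
    0 < (Matrix.of a).det ∧ a 0 ∈ posLightcone ∧ a 3 ∈ posLightcone

variable {M : Type*} [TopologicalSpace M] [ChartedSpace (EuclideanSpace ℝ (Fin 2)) M]

/-- The differential at `p` of a vector-valued function on the surface `M`. -/
def dAt {V : Type*} [NormedAddCommGroup V] [NormedSpace ℝ V] (g : M → V) (p : M) :
    TangentSpace (𝓡 2) p →L[ℝ] V :=
  mfderiv (𝓡 2) 𝓘(ℝ, V) g p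

/-! ## Legendre immersions and middle frames -/

/-- `F = (f, n) : M → ℝ³ × S² ≅ Λ` is a smooth nondegenerate Legendre immersion.
`F` is an immersion because `dn · dn > 0`. -/
structure IsNondegenerateLegendre (f n : M → E3) : Prop where
  smooth_f : ContMDiff (𝓡 2) 𝓘(ℝ, E3) ∞ f
  smooth_n : ContMDiff (𝓡 2) 𝓘(ℝ, E3) ∞ n
  norm_n : ∀ p, ‖n p‖ = 1
  legendre : ∀ (p : M) (X : TangentSpace (𝓡 2) p), inner ℝ (dAt f p X) (n p) = 0
  dn_pos : ∀ (p : M) (X : TangentSpace (𝓡 2) p), X ≠ 0 → 0 < inner ℝ (dAt n p X) (dAt n p X)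
  /-- `df · dn` and `dn · dn` are linearly independent quadratic forms at every point. -/
  indep : ∀ (p : M) (s t : ℝ),
    (∀ X : TangentSpace (𝓡 2) p,
      s * inner ℝ (dAt f p X) (dAt n p X) + t * inner ℝ (dAt n p X) (dAt n p X) = 0) →
    s = 0 ∧ t = 0

/-- A middle frame field `(a₀; a₁, a₂, a₃, a₄)` along `F = (f, n)` on `U`, with its middle coframe
`(α₀², α₀³)` (here `α₂, α₃`) and its invariants. The equations `da₀ = α₀ⁱ aᵢ`, `daⱼ = αⱼⁱ aᵢ` are
written out. The middle coframe is required to be a coframe; `M` carries the orientation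
in which it is positive. Nothing is required outside `U`. -/
structure MiddleFrame (f n : M → E3) (U : Set M) where
  (a₀ a₁ a₂ a₃ a₄ : M → Mink)
  (p₁ p₂ p₃ q₁ q₂ : M → ℝ)
  (α₂ α₃ : (p : M) → TangentSpace (𝓡 2) p →L[ℝ] ℝ)
  smooth_a₀ : ContMDiffOn (𝓡 2) 𝓘(ℝ, Mink) ∞ a₀ U
  smooth_a₁ : ContMDiffOn (𝓡 2) 𝓘(ℝ, Mink) ∞ a₁ U
  smooth_a₂ : ContMDiffOn (𝓡 2) 𝓘(ℝ, Mink) ∞ a₂ U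
  smooth_a₃ : ContMDiffOn (𝓡 2) 𝓘(ℝ, Mink) ∞ a₃ U
  smooth_a₄ : ContMDiffOn (𝓡 2) 𝓘(ℝ, Mink) ∞ a₄ U
  smooth_p₁ : ContMDiffOn (𝓡 2) 𝓘(ℝ, ℝ) ∞ p₁ U
  smooth_p₂ : ContMDiffOn (𝓡 2) 𝓘(ℝ, ℝ) ∞ p₂ U
  smooth_p₃ : ContMDiffOn (𝓡 2) 𝓘(ℝ, ℝ) ∞ p₃ U
  smooth_q₁ : ContMDiffOn (𝓡 2) 𝓘(ℝ, ℝ) ∞ q₁ U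
  smooth_q₂ : ContMDiffOn (𝓡 2) 𝓘(ℝ, ℝ) ∞ q₂ U
  frame : ∀ p ∈ U, IsLaguerreFrame ![a₁ p, a₂ p, a₃ p, a₄ p]
  along : ∀ p ∈ U, isotropicLine (a₀ p) (a₁ p) = contactLine (f p) (n p)
  coframe : ∀ p ∈ U, ∀ X, α₂ p X = 0 → α₃ p X = 0 → X = 0
  d_a₀ : ∀ p ∈ U, ∀ X, dAt a₀ p X = α₂ p X • a₂ p + α₃ p X • a₃ p
  d_a₁ : ∀ p ∈ U, ∀ X, dAt a₁ p X =
    (2 * q₂ p * α₂ p X - 2 * q₁ p * α₃ p X) • a₁ p + α₂ p X • a₂ p - α₃ p X • a₃ p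
  d_a₂ : ∀ p ∈ U, ∀ X, dAt a₂ p X =
    (p₁ p * α₂ p X + p₂ p * α₃ p X) • a₁ p + (q₁ p * α₂ p X + q₂ p * α₃ p X) • a₃ p
      + α₂ p X • a₄ p
  d_a₃ : ∀ p ∈ U, ∀ X, dAt a₃ p X =
    (p₂ p * α₂ p X + p₃ p * α₃ p X) • a₁ p + (-q₁ p * α₂ p X - q₂ p * α₃ p X) • a₂ p
      - α₃ p X • a₄ p
  d_a₄ : ∀ p ∈ U, ∀ X, dAt a₄ p X =
    (p₁ p * α₂ p X + p₂ p * α₃ p X) • a₂ p + (p₂ p * α₂ p X + p₃ p * α₃ p X) • a₃ p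
      + (-2 * q₂ p * α₂ p X + 2 * q₁ p * α₃ p X) • a₄ p

/-- There is a middle frame field on an open neighbourhood of `p`. -/
def HasMiddleFrameAt (f n : M → E3) (p : M) : Prop :=
  ∃ U : Set M, IsOpen U ∧ p ∈ U ∧ Nonempty (MiddleFrame f n U)

/-- A middle frame field on a neighbourhood of `p`. Any other one differs from it near `p` at most
by the signs of `a₂` and `a₃`, so what is defined through it below does not depend on the choice
(for `φ`: up to sign). -/
def HasMiddleFrameAt.middleFrame {f n : M → E3} {p : M} (h : HasMiddleFrameAt f n p) :
    MiddleFrame f n h.choose :=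
  Classical.choice h.choose_spec.2.2

open Classical in
/-- The Laguerre Gauss map `σ_F = a₀`. -/
def gaussMap (f n : M → E3) (p : M) : Mink :=
  if h : HasMiddleFrameAt f n p then h.middleFrame.a₀ p else 0

open Classical in
/-- The vector `a₁` of the middle frames, as a function on `M`. -/
def normalVec (f n : M → E3) (p : M) : Mink :=
  if h : HasMiddleFrameAt f n p then h.middleFrame.a₁ p else 0

open Classical in
/-- The `(1,0)`-form `φ = α₀² + i α₀³`, well defined up to sign. -/
def phi (f n : M → E3) (p : M) (X : TangentSpace (𝓡 2) p) : ℂ :=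
  if h : HasMiddleFrameAt f n p then
    (h.middleFrame.α₂ p X : ℂ) + Complex.I * (h.middleFrame.α₃ p X : ℂ)
  else 0

open Classical in
/-- The function `Q = (p₁ - p₃) / 2 - i p₂`. -/
def invQ (f n : M → E3) (p : M) : ℂ :=
  if h : HasMiddleFrameAt f n p then
    ((h.middleFrame.p₁ p - h.middleFrame.p₃ p : ℝ) : ℂ) / 2
      - Complex.I * (h.middleFrame.p₂ p : ℂ)
  else 0

open Classical in
/-- The function `P = p₁ + p₃`. -/
def invP (f n : M → E3) (p : M) : ℝ :=
  if h : HasMiddleFrameAt f n p then h.middleFrame.p₁ p + h.middleFrame.p₃ p else 0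

/-- The quartic differential `𝒬_F = Q φ⁴`, as a homogeneous function on tangent vectors. -/
def quarticDiff (f n : M → E3) (p : M) (X : TangentSpace (𝓡 2) p) : ℂ :=
  invQ f n p * phi f n p X ^ 4

/-- The quadratic differential `𝒫_F = P φ²`, as a homogeneous function on tangent vectors. -/
def quadraticDiff (f n : M → E3) (p : M) (X : TangentSpace (𝓡 2) p) : ℂ :=
  (invP f n p : ℂ) * phi f n p X ^ 2

/-! ## Coordinates, holomorphic differentials, L-isothermic immersions -/

/-- `z = x + i y` is a smooth chart of the surface `M`. -/
def IsSmoothCoord (z : OpenPartialHomeomorph M ℂ) : Prop :=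
  ContMDiffOn (𝓡 2) 𝓘(ℝ, ℂ) ∞ z z.source ∧ ContMDiffOn 𝓘(ℝ, ℂ) (𝓡 2) ∞ z.symm z.target

/-- `z` is a local complex coordinate of the Riemann surface structure that `F = (f, n)` induces
on `M`, that is, of the complex structure for which `φ` is of type `(1,0)`: `φ = λ dz`, `λ ≠ 0`. -/
def IsComplexCoord (f n : M → E3) (z : OpenPartialHomeomorph M ℂ) : Prop :=
  IsSmoothCoord z ∧
    ∀ p ∈ z.source, ∃ c : ℂ, c ≠ 0 ∧ ∀ X : TangentSpace (𝓡 2) p, phi f n p X = c * dAt z p X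

/-- The differential `η` of degree `k` on `M` is holomorphic for the Riemann surface structure
induced by `F = (f, n)`: around every point there is a complex coordinate `z` in which
`η = h(z) dz^k` with `h` holomorphic. (Transition maps between complex coordinates are holomorphic,
so the choice of `z` does not matter.) -/
def IsHolomorphicDiff (f n : M → E3) (k : ℕ)
    (η : (p : M) → TangentSpace (𝓡 2) p → ℂ) : Prop :=
  ∀ p : M, ∃ z : OpenPartialHomeomorph M ℂ, p ∈ z.source ∧ IsComplexCoord f n z ∧
    ∃ h : ℂ → ℂ, DifferentiableOn ℂ h z.target ∧
      ∀ q ∈ z.source, ∀ X : TangentSpace (𝓡 2) q, η q X = h (z q) * dAt z q X ^ k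

/-- `F = (f, n)` is L-isothermic: around every point there are coordinates `z = x + i y` which
diagonalize both `⟨da₀, da₀⟩` and `⟨da₀, da₁⟩` and are isothermal for `⟨da₀, da₀⟩`. -/
def IsLIsothermic (f n : M → E3) : Prop :=
  ∀ p : M, ∃ z : OpenPartialHomeomorph M ℂ, p ∈ z.source ∧ IsSmoothCoord z ∧
    ∃ E A B : M → ℝ, ∀ q ∈ z.source, 0 < E q ∧ ∀ X : TangentSpace (𝓡 2) q,
      mink (dAt (gaussMap f n) q X) (dAt (gaussMap f n) q X)
          = E q * ((dAt z q X).re ^ 2 + (dAt z q X).im ^ 2) ∧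
      mink (dAt (gaussMap f n) q X) (dAt (normalVec f n) q X)
          = A q * (dAt z q X).re ^ 2 + B q * (dAt z q X).im ^ 2

/-! ## Mean curvature vector of a spacelike surface in Minkowski space -/

/-- The map `σ` in the preferred chart at `p`. -/
def coordRep (σ : M → Mink) (p : M) : EuclideanSpace ℝ (Fin 2) → Mink :=
  fun y => σ ((chartAt (EuclideanSpace ℝ (Fin 2)) p).symm y)

/-- The partial derivative `∂ᵢ g`. -/
def partialDeriv (g : EuclideanSpace ℝ (Fin 2) → Mink) (i : Fin 2) :
    EuclideanSpace ℝ (Fin 2) → Mink :=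
  fun y => fderiv ℝ g y (EuclideanSpace.single i 1)

/-- The coordinate tangent vectors `∂ᵢσ` at `p`. -/
def tangentVec (σ : M → Mink) (p : M) (i : Fin 2) : Mink :=
  partialDeriv (coordRep σ p) i (chartAt (EuclideanSpace ℝ (Fin 2)) p p)

/-- The induced metric `gᵢⱼ = ⟨∂ᵢσ, ∂ⱼσ⟩` at `p`. -/
def inducedMetric (σ : M → Mink) (p : M) : Matrix (Fin 2) (Fin 2) ℝ :=
  Matrix.of fun i j => mink (tangentVec σ p i) (tangentVec σ p j)

/-- The component of `w` normal to `dσ(T_pM)`: `w - g^{ij} ⟨w, ∂ⱼσ⟩ ∂ᵢσ`. -/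
def normalPart (σ : M → Mink) (p : M) (w : Mink) : Mink :=
  w - ∑ i, ∑ j, ((inducedMetric σ p)⁻¹ i j * mink w (tangentVec σ p j)) • tangentVec σ p i

/-- The mean curvature vector `½ g^{ij} (∂ᵢ∂ⱼσ)^⊥`, half the trace of the second fundamental form,
of a spacelike immersion `σ`. -/
def meanCurvatureVec (σ : M → Mink) (p : M) : Mink :=
  (1 / 2 : ℝ) • ∑ i, ∑ j, (inducedMetric σ p)⁻¹ i j •
    normalPart σ p (partialDeriv (partialDeriv (coordRep σ p) j) i
      (chartAt (EuclideanSpace ℝ (Fin 2)) p p))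

/-- The spacelike immersion `σ` has parallel mean curvature vector `𝐇`: the normal connection
`∇^⊥_X 𝐇 = (d𝐇(X))^⊥` vanishes. -/
def HasParallelMeanCurvature (σ : M → Mink) : Prop :=
  ContMDiff (𝓡 2) 𝓘(ℝ, Mink) ∞ (meanCurvatureVec σ) ∧
    ∀ (p : M) (X : TangentSpace (𝓡 2) p), normalPart σ p (dAt (meanCurvatureVec σ) p X) = 0

end

end Laguerre

/-!
A middle frame along `F = (f, n)` satisfies the structure equations `d(daᵢ) = 0`. They give
`dφ = (q₁ + i q₂) α₂ ∧ α₃` (`dext_α`, `dext_dual`) and the Codazzi equations for `p₁, p₂, p₃`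
(`codazzi`). Write `τ = 2 (q₂ α₂ - q₁ α₃)` for the connection form of the isotropic line field
`ℝ a₁`. In a coordinate `w` with `φ = λ dw` these equations express the `(0,1)` parts of `d(Q λ⁴)`
and `d(P λ²)` through the real one-form `dP + P τ`: the first one vanishes if and only if
`dP + P τ = 0` (`differentiableAt_Q_mul_iff`), and then so does the second one
(`differentiableAt_P_mul`). On the other hand the second fundamental form of `a₀` shows that
`𝐇 = ½ P a₁` (`meanCurvatureVec_eq`), and the normal part of `d𝐇` is `½ (dP + P τ) a₁`. Hence both
the holomorphy of `𝒬_F` and `∇^⊥ 𝐇 = 0` are the equation `dP + P τ = 0`, and either one implies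
that `𝒫_F` is holomorphic.

Assume `dP + P τ = 0` on a connected surface. By Gronwall's inequality along segments the zero set
of `P` is open, so `P` vanishes identically or nowhere (`invP_ne_zero`). If it vanishes nowhere,
`τ = -d log |P|` is closed, and `dτ = 2 p₂ α₂ ∧ α₃` up to sign, so that `p₂ = 0`; the Codazzi
equations then say that `Q = ½ (p₁ - p₃)` satisfies `dQ = -2 Q τ`. This is the equation for `P²`,
so `Q / P²` is a real constant (`exists_invQ_eq`). Moreover the holomorphic differential `P φ²`
has a square root `dζ` locally, and because `⟨da₀, da₀⟩ = |φ|²` and `⟨da₀, da₁⟩ = Re φ²`, the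
coordinate `ζ` is L-isothermic (`isLIsothermic`).

The objects in the statement are defined through a middle frame chosen at each point. They are
computed by any middle frame because two of them agree up to the common sign of `a₂` and `a₃`
(`MiddleFrame.unique`): the line `[a₀, a₁]` determines `a₀` and `a₁` up to `a₀ + g a₁` and `ρ a₁`,
and the equality of the metrics `⟨da₀, da₀⟩` and `⟨da₁, da₁⟩` forces `g = 0` and `ρ = 1`.

That holomorphy follows from `∇^⊥ 𝐇 = 0` also needs the existence of complex coordinates and of
middle frames (`exists_middleFrame`). Since `⟨da₁, da₁⟩ = |φ|²` is conformal to `dn · dn`, a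
stereographic coordinate of `n` with the right orientation is a complex coordinate. In this
coordinate the isotropic direction is spanned by an explicit section of the cone with an explicit
adapted frame; translating along the lines, rotating, and applying a null rotation and a boost
turns it into a middle frame (`exists_shear`, `exists_localFrame`). The rotation angle exists
because `df · dn` is not a multiple of `dn · dn`.
-/

namespace Laguerre

noncomputable section

/-! ### Lorentzian linear algebra -/

theorem mink_comm (v w : Mink) : mink v w = mink w v := by simp only [mink]; ring

theorem mink_add_left (u v w : Mink) : mink (u + v) w = mink u w + mink v w := by
  simp only [mink, Pi.add_apply]; ring

theorem mink_sub_left (u v w : Mink) : mink (u - v) w = mink u w - mink v w := by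
  simp only [mink, Pi.sub_apply]; ring

theorem mink_neg_left (u v : Mink) : mink (-u) v = -mink u v := by
  simp only [mink, Pi.neg_apply]; ring

theorem mink_smul_left (c : ℝ) (v w : Mink) : mink (c • v) w = c * mink v w := by
  simp only [mink, Pi.smul_apply, smul_eq_mul]; ring

theorem mink_add_right (u v w : Mink) : mink u (v + w) = mink u v + mink u w := by
  simp only [mink, Pi.add_apply]; ring

theorem mink_sub_right (u v w : Mink) : mink u (v - w) = mink u v - mink u w := by
  simp only [mink, Pi.sub_apply]; ring

theorem mink_smul_right (c : ℝ) (v w : Mink) : mink v (c • w) = c * mink v w := by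
  simp only [mink, Pi.smul_apply, smul_eq_mul]; ring

theorem mink_zero_left (v : Mink) : mink 0 v = 0 := by simp [mink]

/-- The Lorentzian product as a continuous bilinear map. -/
def minkL : Mink →L[ℝ] Mink →L[ℝ] ℝ :=
  LinearMap.toContinuousBilinearMap
    (LinearMap.mk₂ ℝ mink mink_add_left mink_smul_left mink_add_right mink_smul_right)

@[simp] theorem minkL_apply (v w : Mink) : minkL v w = mink v w := rfl

/-- The scalar products of a Laguerre frame, written out. -/
structure FrameProducts (a₁ a₂ a₃ a₄ : Mink) : Prop where
  m11 : mink a₁ a₁ = 0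
  m12 : mink a₁ a₂ = 0
  m13 : mink a₁ a₃ = 0
  m14 : mink a₁ a₄ = -1
  m21 : mink a₂ a₁ = 0
  m22 : mink a₂ a₂ = 1
  m23 : mink a₂ a₃ = 0
  m24 : mink a₂ a₄ = 0
  m31 : mink a₃ a₁ = 0
  m32 : mink a₃ a₂ = 0
  m33 : mink a₃ a₃ = 1
  m34 : mink a₃ a₄ = 0
  m41 : mink a₄ a₁ = -1
  m42 : mink a₄ a₂ = 0
  m43 : mink a₄ a₃ = 0
  m44 : mink a₄ a₄ = 0

theorem IsLaguerreFrame.products {a₁ a₂ a₃ a₄ : Mink} (h : IsLaguerreFrame ![a₁, a₂, a₃, a₄]) :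
    FrameProducts a₁ a₂ a₃ a₄ where
  m11 := by simpa [mink, stdVec] using h.1 0 0
  m12 := by simpa [mink, stdVec] using h.1 0 1
  m13 := by simpa [mink, stdVec] using h.1 0 2
  m14 := by simpa [mink, stdVec] using h.1 0 3
  m21 := by simpa [mink, stdVec] using h.1 1 0
  m22 := by simpa [mink, stdVec] using h.1 1 1
  m23 := by simpa [mink, stdVec] using h.1 1 2
  m24 := by simpa [mink, stdVec] using h.1 1 3
  m31 := by simpa [mink, stdVec] using h.1 2 0
  m32 := by simpa [mink, stdVec] using h.1 2 1
  m33 := by simpa [mink, stdVec] using h.1 2 2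
  m34 := by simpa [mink, stdVec] using h.1 2 3
  m41 := by simpa [mink, stdVec] using h.1 3 0
  m42 := by simpa [mink, stdVec] using h.1 3 1
  m43 := by simpa [mink, stdVec] using h.1 3 2
  m44 := by simpa [mink, stdVec] using h.1 3 3

theorem FrameProducts.isLaguerreFrame {a₁ a₂ a₃ a₄ : Mink} (h : FrameProducts a₁ a₂ a₃ a₄)
    (hdet : 0 < (Matrix.of ![a₁, a₂, a₃, a₄]).det) (h₁ : a₁ ∈ posLightcone)
    (h₄ : a₄ ∈ posLightcone) : IsLaguerreFrame ![a₁, a₂, a₃, a₄] := by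
  refine ⟨fun i j => ?_, hdet, h₁, h₄⟩
  obtain ⟨h11, h12, h13, h14, h21, h22, h23, h24, h31, h32, h33, h34, h41, h42, h43, h44⟩ := h
  have hs : ∀ i j, mink (stdVec i) (stdVec j) = ![![0, 0, 0, -1], ![0, 1, 0, 0], ![0, 0, 1, 0],
      ![-1, 0, 0, 0]] i j := by
    intro i j
    fin_cases i <;> fin_cases j <;> simp [mink, stdVec]
  rw [hs]
  fin_cases i <;> fin_cases j <;> simpa

/-- Two vectors with the same scalar products with the vectors of a Laguerre frame agree. -/
theorem IsLaguerreFrame.ext {a₁ a₂ a₃ a₄ v w : Mink} (h : IsLaguerreFrame ![a₁, a₂, a₃, a₄])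
    (h1 : mink v a₁ = mink w a₁) (h2 : mink v a₂ = mink w a₂) (h3 : mink v a₃ = mink w a₃)
    (h4 : mink v a₄ = mink w a₄) : v = w := by
  have key : (Matrix.of ![a₁, a₂, a₃, a₄]).mulVec
      ![-(v 3 - w 3), v 1 - w 1, v 2 - w 2, -(v 0 - w 0)] = 0 := by
    simp only [mink] at h1 h2 h3 h4
    ext i
    fin_cases i <;> simp [Matrix.mulVec, dotProduct, Fin.sum_univ_four] <;> linarith
  have h0 := Matrix.eq_zero_of_mulVec_eq_zero h.2.1.ne' key
  have e0 := congrFun h0 0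
  have e1 := congrFun h0 1
  have e2 := congrFun h0 2
  have e3 := congrFun h0 3
  simp at e0 e1 e2 e3
  ext i
  fin_cases i <;> simp <;> linarith

theorem IsLaguerreFrame.expansion {a₁ a₂ a₃ a₄ : Mink} (h : IsLaguerreFrame ![a₁, a₂, a₃, a₄])
    (v : Mink) :
    v = (-mink v a₄) • a₁ + mink v a₂ • a₂ + mink v a₃ • a₃ + (-mink v a₁) • a₄ := by
  obtain ⟨h11, h12, h13, h14, h21, h22, h23, h24, h31, h32, h33, h34, h41, h42, h43, h44⟩ :=
    h.products
  apply h.ext <;> simp only [mink_add_left, mink_smul_left, *] <;> ring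

/-- The coefficients with respect to a Laguerre frame are unique. -/
theorem IsLaguerreFrame.coeff_eq {a₁ a₂ a₃ a₄ : Mink} (h : IsLaguerreFrame ![a₁, a₂, a₃, a₄])
    {c₁ c₂ c₃ c₄ d₁ d₂ d₃ d₄ : ℝ}
    (e : c₁ • a₁ + c₂ • a₂ + c₃ • a₃ + c₄ • a₄ = d₁ • a₁ + d₂ • a₂ + d₃ • a₃ + d₄ • a₄) :
    c₁ = d₁ ∧ c₂ = d₂ ∧ c₃ = d₃ ∧ c₄ = d₄ := by
  obtain ⟨h11, h12, h13, h14, h21, h22, h23, h24, h31, h32, h33, h34, h41, h42, h43, h44⟩ :=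
    h.products
  have e1 := congrArg (mink · a₁) e
  have e2 := congrArg (mink · a₂) e
  have e3 := congrArg (mink · a₃) e
  have e4 := congrArg (mink · a₄) e
  simp only [mink_add_left, mink_smul_left, h11, h12, h13, h14, h21, h22, h23, h24, h31, h32, h33,
    h34, h41, h42, h43, h44] at e1 e2 e3 e4
  exact ⟨by linarith, by linarith, by linarith, by linarith⟩

section Calculus

variable {E : Type*} [NormedAddCommGroup E] [NormedSpace ℝ E]

theorem _root_.DifferentiableAt.mink {g h : E → Mink} {x : E} (hg : DifferentiableAt ℝ g x)
    (hh : DifferentiableAt ℝ h x) : DifferentiableAt ℝ (fun x => mink (g x) (h x)) x :=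
  (minkL.hasFDerivAt_of_bilinear hg.hasFDerivAt hh.hasFDerivAt).differentiableAt

theorem fderiv_mink {g h : E → Mink} {x : E} (hg : DifferentiableAt ℝ g x)
    (hh : DifferentiableAt ℝ h x) (X : E) :
    fderiv ℝ (fun x => mink (g x) (h x)) x X =
      mink (fderiv ℝ g x X) (h x) + mink (g x) (fderiv ℝ h x X) := by
  have := (minkL.hasFDerivAt_of_bilinear hg.hasFDerivAt hh.hasFDerivAt).fderiv
  have h2 := congrArg (fun T : E →L[ℝ] ℝ => T X) this
  simp only [minkL_apply] at h2
  rw [h2]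
  simp [add_comm]

/-! ### The structure equations of a moving frame -/

variable {V : Type*} [NormedAddCommGroup V] [NormedSpace ℝ V]

/-- The exterior derivative `dθ(X, Y)` of a one-form `θ`, evaluated on constant vector fields. -/
def dext (θ : E → E →L[ℝ] V) (x X Y : E) : V :=
  fderiv ℝ θ x X Y - fderiv ℝ θ x Y X

theorem fderiv_fderiv_apply {θ : E → E →L[ℝ] V} {x : E} (h : DifferentiableAt ℝ θ x) (X Y : E) :
    fderiv ℝ θ x X Y = fderiv ℝ (fun y => θ y Y) x X := by
  rw [fderiv_clm_apply h (differentiableAt_const _)]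
  simp

theorem fderiv_fderiv_symm {g : E → V} {x : E} (h : ContDiffAt ℝ ∞ g x) (X Y : E) :
    fderiv ℝ (fderiv ℝ g) x X Y = fderiv ℝ (fderiv ℝ g) x Y X :=
  (h.isSymmSndFDerivAt (by simpa using ENat.LEInfty.out)).eq X Y

theorem differentiableAt_fderiv {g : E → V} {x : E} (h : ContDiffAt ℝ ∞ g x) :
    DifferentiableAt ℝ (fderiv ℝ g) x :=
  (h.fderiv_right (m := 1) (by rw [one_add_one_eq_two]; exact ENat.LEInfty.out)).differentiableAt one_ne_zero

/-- If `dg = ∑ᵢ θᵢ aᵢ` then `0 = d(dg) = ∑ᵢ (dθᵢ aᵢ - θᵢ ∧ daᵢ)`. -/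
theorem sum_dext_eq_zero {ι : Type*} [Fintype ι] {g : E → V} {θ : ι → E → E →L[ℝ] ℝ}
    {a : ι → E → V} {x : E} (hg : ContDiffAt ℝ ∞ g x)
    (hθ : ∀ i, DifferentiableAt ℝ (θ i) x) (ha : ∀ i, DifferentiableAt ℝ (a i) x)
    (h : ∀ᶠ y in nhds x, ∀ Y, fderiv ℝ g y Y = ∑ i, θ i y Y • a i y) (X Y : E) :
    ∑ i, (dext (θ i) x X Y • a i x + θ i x Y • fderiv ℝ (a i) x X
      - θ i x X • fderiv ℝ (a i) x Y) = 0 := by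
  have key : ∀ X Y, fderiv ℝ (fderiv ℝ g) x X Y =
      ∑ i, (fderiv ℝ (θ i) x X Y • a i x + θ i x Y • fderiv ℝ (a i) x X) := by
    intro X Y
    rw [fderiv_fderiv_apply (differentiableAt_fderiv hg)]
    have h1 : (fun y => fderiv ℝ g y Y) =ᶠ[nhds x] fun y => ∑ i, θ i y Y • a i y :=
      h.mono fun y hy => hy Y
    have hd : ∀ i, DifferentiableAt ℝ (fun y => θ i y Y) x := fun i =>
      (hθ i).clm_apply (differentiableAt_const _)
    rw [h1.fderiv_eq, fderiv_fun_sum fun i _ => (hd i).fun_smul (ha i), sum_apply]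
    refine Finset.sum_congr rfl fun i _ => ?_
    rw [fderiv_fun_smul (hd i) (ha i), fderiv_fderiv_apply (hθ i)]
    simp [add_comm]
  have := fderiv_fderiv_symm hg X Y
  rw [key, key, ← sub_eq_zero, ← Finset.sum_sub_distrib] at this
  rw [← this]
  refine Finset.sum_congr rfl fun i _ => ?_
  simp only [dext, sub_smul]
  abel

/-- The exterior derivative of a form `∑ᵢ cᵢ θᵢ`. -/
theorem dext_add_smul {c₁ c₂ : E → ℝ} {θ₁ θ₂ : E → E →L[ℝ] ℝ} {x : E}
    (hc₁ : DifferentiableAt ℝ c₁ x) (hc₂ : DifferentiableAt ℝ c₂ x)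
    (h₁ : DifferentiableAt ℝ θ₁ x) (h₂ : DifferentiableAt ℝ θ₂ x) (X Y : E) :
    dext (fun y => c₁ y • θ₁ y + c₂ y • θ₂ y) x X Y =
      c₁ x * dext θ₁ x X Y + c₂ x * dext θ₂ x X Y
        + (fderiv ℝ c₁ x X * θ₁ x Y - fderiv ℝ c₁ x Y * θ₁ x X)
        + (fderiv ℝ c₂ x X * θ₂ x Y - fderiv ℝ c₂ x Y * θ₂ x X) := by
  simp only [dext]
  rw [fderiv_fun_add (hc₁.fun_smul h₁) (hc₂.fun_smul h₂), fderiv_fun_smul hc₁ h₁,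
    fderiv_fun_smul hc₂ h₂]
  simp only [add_apply, smul_apply,
    ContinuousLinearMap.smulRight_apply, smul_eq_mul]
  ring

end Calculus

/-! ### Moving frames on open sets of a normed space -/

section MovingFrames

variable {E : Type*} [NormedAddCommGroup E] [NormedSpace ℝ E]

/-- A field of Laguerre frames on `D` with `da₀ = α₂ a₂ + α₃ a₃` and `da₁ ≡ α₂ a₂ - α₃ a₃` modulo
`a₁`. The connection forms are recorded as `τ = α₁¹`, `ψ = α₂³`, `β₁ = α₂¹`, `β₂ = α₃¹`. -/
structure MovingFrame (D : Set E) where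
  (a₀ a₁ a₂ a₃ a₄ : E → Mink)
  (α₂ α₃ τ ψ β₁ β₂ : E → E →L[ℝ] ℝ)
  smooth_a₀ : ContDiffOn ℝ ∞ a₀ D
  smooth_a₁ : ContDiffOn ℝ ∞ a₁ D
  smooth_a₂ : ContDiffOn ℝ ∞ a₂ D
  smooth_a₃ : ContDiffOn ℝ ∞ a₃ D
  smooth_a₄ : ContDiffOn ℝ ∞ a₄ D
  frame : ∀ x ∈ D, IsLaguerreFrame ![a₁ x, a₂ x, a₃ x, a₄ x]
  coframe : ∀ x ∈ D, ∀ X, α₂ x X = 0 → α₃ x X = 0 → X = 0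
  d_a₀ : ∀ x ∈ D, ∀ X, fderiv ℝ a₀ x X = α₂ x X • a₂ x + α₃ x X • a₃ x
  d_a₁ : ∀ x ∈ D, ∀ X, fderiv ℝ a₁ x X = τ x X • a₁ x + α₂ x X • a₂ x - α₃ x X • a₃ x
  d_a₂ : ∀ x ∈ D, ∀ X, fderiv ℝ a₂ x X = β₁ x X • a₁ x + ψ x X • a₃ x + α₂ x X • a₄ x
  d_a₃ : ∀ x ∈ D, ∀ X, fderiv ℝ a₃ x X = β₂ x X • a₁ x - ψ x X • a₂ x - α₃ x X • a₄ x
  d_a₄ : ∀ x ∈ D, ∀ X, fderiv ℝ a₄ x X = β₁ x X • a₂ x + β₂ x X • a₃ x - τ x X • a₄ x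

/-- A moving frame together with the invariants `pᵢ`, `qᵢ`, that is, a middle frame in local
coordinates. -/
structure LocalFrame (D : Set E) extends MovingFrame D where
  (p₁ p₂ p₃ q₁ q₂ : E → ℝ)
  smooth_p₁ : ContDiffOn ℝ ∞ p₁ D
  smooth_p₂ : ContDiffOn ℝ ∞ p₂ D
  smooth_p₃ : ContDiffOn ℝ ∞ p₃ D
  smooth_q₁ : ContDiffOn ℝ ∞ q₁ D
  smooth_q₂ : ContDiffOn ℝ ∞ q₂ D
  τ_eq : ∀ x ∈ D, τ x = (2 * q₂ x) • α₂ x + (-2 * q₁ x) • α₃ x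
  ψ_eq : ∀ x ∈ D, ψ x = q₁ x • α₂ x + q₂ x • α₃ x
  β₁_eq : ∀ x ∈ D, β₁ x = p₁ x • α₂ x + p₂ x • α₃ x
  β₂_eq : ∀ x ∈ D, β₂ x = p₂ x • α₂ x + p₃ x • α₃ x

/-- The wedge product of two covectors, evaluated on two vectors. -/
def wedge (α β : E →L[ℝ] ℝ) (X Y : E) : ℝ := α X * β Y - α Y * β X

/-- The form `⟨dg, a⟩`. -/
def pairingForm (g a : E → Mink) (x : E) : E →L[ℝ] ℝ := (minkL (a x)).comp (fderiv ℝ g x)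

theorem pairingForm_apply (g a : E → Mink) (x X : E) :
    pairingForm g a x X = mink (fderiv ℝ g x X) (a x) := by
  simp [pairingForm, mink_comm]

theorem _root_.ContDiffOn.pairingForm {g a : E → Mink} {D : Set E} (hD : IsOpen D)
    (hg : ContDiffOn ℝ ∞ g D) (ha : ContDiffOn ℝ ∞ a D) :
    ContDiffOn ℝ ∞ (pairingForm g a) D := by
  have h1 : ContDiffOn ℝ ∞ (fun x => minkL (a x)) D := minkL.contDiff.comp_contDiffOn ha
  exact h1.clm_comp (hg.fderiv_of_isOpen hD (by simp))

namespace MovingFrame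

variable {D : Set E} (F : MovingFrame D)

theorem products {x : E} (hx : x ∈ D) : FrameProducts (F.a₁ x) (F.a₂ x) (F.a₃ x) (F.a₄ x) :=
  (F.frame x hx).products

theorem α₂_eq {x : E} (hx : x ∈ D) : F.α₂ x = pairingForm F.a₀ F.a₂ x := by
  ext X
  rw [pairingForm_apply, F.d_a₀ x hx]
  simp [mink_add_left, mink_smul_left, (F.products hx).m22, (F.products hx).m32]

theorem α₃_eq {x : E} (hx : x ∈ D) : F.α₃ x = pairingForm F.a₀ F.a₃ x := by
  ext X
  rw [pairingForm_apply, F.d_a₀ x hx]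
  simp [mink_add_left, mink_smul_left, (F.products hx).m33, (F.products hx).m23]

theorem ψ_eq_pairing {x : E} (hx : x ∈ D) : F.ψ x = pairingForm F.a₂ F.a₃ x := by
  ext X
  rw [pairingForm_apply, F.d_a₂ x hx]
  simp [mink_add_left, mink_smul_left, (F.products hx).m13, (F.products hx).m33,
    (F.products hx).m43]

theorem τ_eq_pairing {x : E} (hx : x ∈ D) : F.τ x = -pairingForm F.a₁ F.a₄ x := by
  ext X
  rw [neg_apply, pairingForm_apply, F.d_a₁ x hx]
  simp [mink_add_left, mink_sub_left, mink_smul_left, (F.products hx).m14, (F.products hx).m24,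
    (F.products hx).m34]

theorem β₁_eq_pairing {x : E} (hx : x ∈ D) : F.β₁ x = pairingForm F.a₄ F.a₂ x := by
  ext X
  rw [pairingForm_apply, F.d_a₄ x hx]
  simp [mink_add_left, mink_sub_left, mink_smul_left, (F.products hx).m22, (F.products hx).m32,
    (F.products hx).m42]

theorem β₂_eq_pairing {x : E} (hx : x ∈ D) : F.β₂ x = pairingForm F.a₄ F.a₃ x := by
  ext X
  rw [pairingForm_apply, F.d_a₄ x hx]
  simp [mink_add_left, mink_sub_left, mink_smul_left, (F.products hx).m33, (F.products hx).m23,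
    (F.products hx).m43]

variable (hD : IsOpen D)
include hD

theorem smooth_α₂ : ContDiffOn ℝ ∞ F.α₂ D :=
  (ContDiffOn.pairingForm hD F.smooth_a₀ F.smooth_a₂).congr fun _ => F.α₂_eq

theorem smooth_α₃ : ContDiffOn ℝ ∞ F.α₃ D :=
  (ContDiffOn.pairingForm hD F.smooth_a₀ F.smooth_a₃).congr fun _ => F.α₃_eq

theorem smooth_ψ : ContDiffOn ℝ ∞ F.ψ D :=
  (ContDiffOn.pairingForm hD F.smooth_a₂ F.smooth_a₃).congr fun _ => F.ψ_eq_pairing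

theorem smooth_τ : ContDiffOn ℝ ∞ F.τ D :=
  (ContDiffOn.pairingForm hD F.smooth_a₁ F.smooth_a₄).neg.congr fun _ => F.τ_eq_pairing

theorem smooth_β₁ : ContDiffOn ℝ ∞ F.β₁ D :=
  (ContDiffOn.pairingForm hD F.smooth_a₄ F.smooth_a₂).congr fun _ => F.β₁_eq_pairing

theorem smooth_β₂ : ContDiffOn ℝ ∞ F.β₂ D :=
  (ContDiffOn.pairingForm hD F.smooth_a₄ F.smooth_a₃).congr fun _ => F.β₂_eq_pairing

theorem _root_.ContDiffOn.differentiableAt_of_mem_isOpen {V : Type*} [NormedAddCommGroup V]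
    [NormedSpace ℝ V] {g : E → V} (hg : ContDiffOn ℝ ∞ g D) {x : E} (hx : x ∈ D) :
    DifferentiableAt ℝ g x :=
  (hg.contDiffAt (hD.mem_nhds hx)).differentiableAt (by simp)

/-- If `dg = c₁ a₁ + c₂ a₂ + c₃ a₃ + c₄ a₄`, then `d(dg) = 0` expresses the exterior derivatives of
the `cᵢ` by the connection forms. -/
theorem structure_equations {g : E → Mink} {c₁ c₂ c₃ c₄ : E → E →L[ℝ] ℝ} {x : E} (hx : x ∈ D)
    (hg : ContDiffOn ℝ ∞ g D) (h₁ : ContDiffOn ℝ ∞ c₁ D) (h₂ : ContDiffOn ℝ ∞ c₂ D)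
    (h₃ : ContDiffOn ℝ ∞ c₃ D) (h₄ : ContDiffOn ℝ ∞ c₄ D)
    (h : ∀ y ∈ D, ∀ Y, fderiv ℝ g y Y =
      c₁ y Y • F.a₁ y + c₂ y Y • F.a₂ y + c₃ y Y • F.a₃ y + c₄ y Y • F.a₄ y) (X Y : E) :
    dext c₁ x X Y = wedge (c₁ x) (F.τ x) X Y + wedge (c₂ x) (F.β₁ x) X Y
        + wedge (c₃ x) (F.β₂ x) X Y ∧
    dext c₂ x X Y = wedge (c₁ x) (F.α₂ x) X Y - wedge (c₃ x) (F.ψ x) X Y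
        + wedge (c₄ x) (F.β₁ x) X Y ∧
    dext c₃ x X Y = -wedge (c₁ x) (F.α₃ x) X Y + wedge (c₂ x) (F.ψ x) X Y
        + wedge (c₄ x) (F.β₂ x) X Y ∧
    dext c₄ x X Y = wedge (c₂ x) (F.α₂ x) X Y - wedge (c₃ x) (F.α₃ x) X Y
        - wedge (c₄ x) (F.τ x) X Y := by
  have key := sum_dext_eq_zero (x := x) (θ := ![c₁, c₂, c₃, c₄]) (a := ![F.a₁, F.a₂, F.a₃, F.a₄])
    (hg.contDiffAt (hD.mem_nhds hx))
    (by
      intro i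
      fin_cases i
      exacts [h₁.differentiableAt_of_mem_isOpen hD hx, h₂.differentiableAt_of_mem_isOpen hD hx,
        h₃.differentiableAt_of_mem_isOpen hD hx, h₄.differentiableAt_of_mem_isOpen hD hx])
    (by
      intro i
      fin_cases i
      exacts [F.smooth_a₁.differentiableAt_of_mem_isOpen hD hx,
        F.smooth_a₂.differentiableAt_of_mem_isOpen hD hx,
        F.smooth_a₃.differentiableAt_of_mem_isOpen hD hx,
        F.smooth_a₄.differentiableAt_of_mem_isOpen hD hx])
    (by
      filter_upwards [hD.mem_nhds hx] with y hy Y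
      rw [h y hy Y, Fin.sum_univ_four]
      rfl) X Y
  rw [Fin.sum_univ_four] at key
  simp only [Matrix.cons_val_zero, Matrix.cons_val_one, Matrix.cons_val, F.d_a₁ x hx,
    F.d_a₂ x hx, F.d_a₃ x hx, F.d_a₄ x hx] at key
  have key' : dext c₁ x X Y • F.a₁ x + dext c₂ x X Y • F.a₂ x + dext c₃ x X Y • F.a₃ x
      + dext c₄ x X Y • F.a₄ x =
      (wedge (c₁ x) (F.τ x) X Y + wedge (c₂ x) (F.β₁ x) X Y
        + wedge (c₃ x) (F.β₂ x) X Y) • F.a₁ x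
      + (wedge (c₁ x) (F.α₂ x) X Y - wedge (c₃ x) (F.ψ x) X Y
        + wedge (c₄ x) (F.β₁ x) X Y) • F.a₂ x
      + (-wedge (c₁ x) (F.α₃ x) X Y + wedge (c₂ x) (F.ψ x) X Y
        + wedge (c₄ x) (F.β₂ x) X Y) • F.a₃ x
      + (wedge (c₂ x) (F.α₂ x) X Y - wedge (c₃ x) (F.α₃ x) X Y
        - wedge (c₄ x) (F.τ x) X Y) • F.a₄ x := by
    rw [← sub_eq_zero, ← key]
    simp only [wedge]
    module
  exact (F.frame x hx).coeff_eq key'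

/-- The structure equations obtained from `d(da₀) = 0`. -/
theorem dext_α {x : E} (hx : x ∈ D) (X Y : E) :
    dext F.α₂ x X Y = -wedge (F.α₃ x) (F.ψ x) X Y ∧ dext F.α₃ x X Y = wedge (F.α₂ x) (F.ψ x) X Y ∧
      wedge (F.α₂ x) (F.β₁ x) X Y + wedge (F.α₃ x) (F.β₂ x) X Y = 0 := by
  obtain ⟨h1, h2, h3, -⟩ := F.structure_equations hD hx (c₁ := 0) (c₄ := 0) F.smooth_a₀
    contDiffOn_const (F.smooth_α₂ hD) (F.smooth_α₃ hD) contDiffOn_const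
    (fun y hy Y => by simpa using F.d_a₀ y hy Y) X Y
  simp [dext, wedge] at h1 h2 h3 ⊢
  exact ⟨by linarith, by linarith, by linarith⟩

/-- The structure equations obtained from `d(da₁) = 0`. -/
theorem dext_τ {x : E} (hx : x ∈ D) (X Y : E) :
    dext F.τ x X Y = wedge (F.α₂ x) (F.β₁ x) X Y - wedge (F.α₃ x) (F.β₂ x) X Y ∧
      wedge (F.τ x) (F.α₂ x) X Y = -2 * wedge (F.α₃ x) (F.ψ x) X Y ∧
      wedge (F.τ x) (F.α₃ x) X Y = 2 * wedge (F.α₂ x) (F.ψ x) X Y := by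
  obtain ⟨h1, h2, h3, -⟩ := F.structure_equations hD hx (c₃ := -F.α₃) (c₄ := 0) F.smooth_a₁
    (F.smooth_τ hD) (F.smooth_α₂ hD) (F.smooth_α₃ hD).neg contDiffOn_const
    (fun y hy Y => by
      rw [F.d_a₁ y hy Y]
      simp [sub_eq_add_neg]) X Y
  obtain ⟨h4, h5, -⟩ := F.dext_α hD hx X Y
  have hneg : dext (-F.α₃) x X Y = -dext F.α₃ x X Y := by
    simp only [dext]
    rw [fderiv_neg]
    simp only [neg_apply]
    ring
  rw [hneg] at h3
  simp [wedge] at h1 h2 h3 h4 h5 ⊢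
  exact ⟨by linarith, by linarith, by linarith⟩

/-- The structure equations obtained from `d(da₄) = 0`. -/
theorem dext_β {x : E} (hx : x ∈ D) (X Y : E) :
    dext F.β₁ x X Y = wedge (F.ψ x) (F.β₂ x) X Y + wedge (F.β₁ x) (F.τ x) X Y ∧
      dext F.β₂ x X Y = -wedge (F.ψ x) (F.β₁ x) X Y + wedge (F.β₂ x) (F.τ x) X Y := by
  obtain ⟨-, h2, h3, -⟩ := F.structure_equations hD hx (c₁ := 0) (c₄ := -F.τ) F.smooth_a₄
    contDiffOn_const (F.smooth_β₁ hD) (F.smooth_β₂ hD) (F.smooth_τ hD).neg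
    (fun y hy Y => by
      rw [F.d_a₄ y hy Y]
      simp [sub_eq_add_neg]) X Y
  simp [wedge] at h2 h3 ⊢
  exact ⟨by linarith, by linarith⟩

end MovingFrame

namespace LocalFrame

variable {D : Set E} (F : LocalFrame D) (hD : IsOpen D)
include hD

/-- `X₂`, `X₃` is the dual frame of the middle coframe at `x`. -/
structure _root_.Laguerre.MovingFrame.IsDualFrame {D : Set E} (F : MovingFrame D) (x X₂ X₃ : E) :
    Prop where
  h22 : F.α₂ x X₂ = 1
  h23 : F.α₂ x X₃ = 0
  h32 : F.α₃ x X₂ = 0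
  h33 : F.α₃ x X₃ = 1

theorem dext_dual {x : E} (hx : x ∈ D) {X₂ X₃ : E} (h : F.IsDualFrame x X₂ X₃) :
    dext F.α₂ x X₂ X₃ = F.q₁ x ∧ dext F.α₃ x X₂ X₃ = F.q₂ x ∧
    dext F.τ x X₂ X₃ = 2 * F.p₂ x := by
  obtain ⟨h22, h23, h32, h33⟩ := h
  obtain ⟨h1, h2, -⟩ := F.dext_α hD hx X₂ X₃
  obtain ⟨h3, -⟩ := F.dext_τ hD hx X₂ X₃
  rw [h1, h2, h3]
  simp only [wedge, F.ψ_eq x hx, F.β₁_eq x hx, F.β₂_eq x hx, add_apply, smul_apply, smul_eq_mul,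
    h22, h23, h32, h33]
  refine ⟨by ring, by ring, by ring⟩

/-- The Codazzi type equations for the invariants `pᵢ`. -/
theorem codazzi {x : E} (hx : x ∈ D) {X₂ X₃ : E} (h : F.IsDualFrame x X₂ X₃) :
    fderiv ℝ F.p₂ x X₂ - fderiv ℝ F.p₁ x X₃ =
      -3 * F.q₁ x * F.p₁ x - 4 * F.q₂ x * F.p₂ x + F.q₁ x * F.p₃ x ∧
    fderiv ℝ F.p₃ x X₂ - fderiv ℝ F.p₂ x X₃ =
      -4 * F.q₁ x * F.p₂ x - 3 * F.q₂ x * F.p₃ x + F.q₂ x * F.p₁ x := by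
  obtain ⟨h4, h5, -⟩ := F.dext_dual hD hx h
  obtain ⟨h22, h23, h32, h33⟩ := h
  obtain ⟨h1, h2⟩ := F.dext_β hD hx X₂ X₃
  have hd₂ := (F.smooth_α₂ hD).differentiableAt_of_mem_isOpen hD hx
  have hd₃ := (F.smooth_α₃ hD).differentiableAt_of_mem_isOpen hD hx
  have hp₁ := F.smooth_p₁.differentiableAt_of_mem_isOpen hD hx
  have hp₂ := F.smooth_p₂.differentiableAt_of_mem_isOpen hD hx
  have hp₃ := F.smooth_p₃.differentiableAt_of_mem_isOpen hD hx
  have e1 : dext F.β₁ x X₂ X₃ = dext (fun y => F.p₁ y • F.α₂ y + F.p₂ y • F.α₃ y) x X₂ X₃ := by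
    have : F.β₁ =ᶠ[nhds x] fun y => F.p₁ y • F.α₂ y + F.p₂ y • F.α₃ y :=
      Filter.eventually_of_mem (hD.mem_nhds hx) F.β₁_eq
    simp only [dext, this.fderiv_eq]
  have e2 : dext F.β₂ x X₂ X₃ = dext (fun y => F.p₂ y • F.α₂ y + F.p₃ y • F.α₃ y) x X₂ X₃ := by
    have : F.β₂ =ᶠ[nhds x] fun y => F.p₂ y • F.α₂ y + F.p₃ y • F.α₃ y :=
      Filter.eventually_of_mem (hD.mem_nhds hx) F.β₂_eq
    simp only [dext, this.fderiv_eq]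
  rw [e1, dext_add_smul hp₁ hp₂ hd₂ hd₃] at h1
  rw [e2, dext_add_smul hp₂ hp₃ hd₂ hd₃] at h2
  simp only [wedge, F.ψ_eq x hx, F.τ_eq x hx, F.β₁_eq x hx, F.β₂_eq x hx, add_apply, smul_apply,
    smul_eq_mul, h22, h23, h32, h33, h4, h5] at h1 h2
  exact ⟨by linarith, by linarith⟩

end LocalFrame

end MovingFrames

/-! ### Holomorphy of the differentials in a complex coordinate -/

/-- The function `P = p₁ + p₃`. -/
def LocalFrame.P {E : Type*} [NormedAddCommGroup E] [NormedSpace ℝ E] {D : Set E}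
    (F : LocalFrame D) (x : E) : ℝ := F.p₁ x + F.p₃ x

/-- The equation `dP + P τ = 0` at `x`, which expresses that the vector `½ P a₁` is parallel in the
normal bundle of `a₀`. -/
def LocalFrame.IsParallelAt {E : Type*} [NormedAddCommGroup E] [NormedSpace ℝ E] {D : Set E}
    (F : LocalFrame D) (x : E) : Prop := ∀ X, fderiv ℝ F.P x X + F.P x * F.τ x X = 0

theorem LocalFrame.smooth_P {E : Type*} [NormedAddCommGroup E] [NormedSpace ℝ E] {D : Set E}
    (F : LocalFrame D) : ContDiffOn ℝ ∞ F.P D := F.smooth_p₁.add F.smooth_p₃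

theorem MovingFrame.eq_of_isDualFrame {E : Type*} [NormedAddCommGroup E] [NormedSpace ℝ E]
    {D : Set E} {F : MovingFrame D} {x : E} (hx : x ∈ D) {X₂ X₃ : E}
    (h : F.IsDualFrame x X₂ X₃) (X : E) : X = F.α₂ x X • X₂ + F.α₃ x X • X₃ := by
  rw [← sub_eq_zero]
  obtain ⟨h22, h23, h32, h33⟩ := h
  apply F.coframe x hx <;> simp [h22, h23, h32, h33]

theorem LocalFrame.isParallelAt_iff {E : Type*} [NormedAddCommGroup E] [NormedSpace ℝ E]
    {D : Set E} (F : LocalFrame D) {x : E} (hx : x ∈ D) {X₂ X₃ : E}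
    (h : F.IsDualFrame x X₂ X₃) :
    F.IsParallelAt x ↔ fderiv ℝ F.P x X₂ + 2 * F.q₂ x * F.P x = 0 ∧
      fderiv ℝ F.P x X₃ - 2 * F.q₁ x * F.P x = 0 := by
  have hτ : ∀ X, F.τ x X = 2 * F.q₂ x * F.α₂ x X - 2 * F.q₁ x * F.α₃ x X := by
    intro X
    rw [F.τ_eq x hx]
    simp only [add_apply, smul_apply, smul_eq_mul]
    ring
  constructor
  · intro hp
    have h2 := hp X₂
    have h3 := hp X₃
    rw [hτ, h.h22, h.h32] at h2
    rw [hτ, h.h23, h.h33] at h3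
    exact ⟨by linarith, by linarith⟩
  · rintro ⟨h2, h3⟩ X
    conv_lhs => rw [MovingFrame.eq_of_isDualFrame hx h X]
    rw [map_add, map_add, map_smul, map_smul, map_smul, map_smul, hτ X₂, hτ X₃, h.h22, h.h32,
      h.h23, h.h33]
    simp only [smul_eq_mul]
    linear_combination F.α₂ x X * h2 + F.α₃ x X * h3

section ComplexCoordinates

open Complex

variable {D : Set ℂ} (F : LocalFrame D)

/-- The function `Q = (p₁ - p₃) / 2 - i p₂`. -/
def LocalFrame.Q (x : ℂ) : ℂ := ((F.p₁ x - F.p₃ x : ℝ) : ℂ) / 2 - I * (F.p₂ x : ℂ)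

/-- The coefficient `λ` in `φ = λ dz`. -/
def MovingFrame.lam (F : MovingFrame D) (x : ℂ) : ℂ := (F.α₂ x 1 : ℂ) + I * (F.α₃ x 1 : ℂ)

/-- `z` is a complex coordinate for the frame: `φ = λ dz`. -/
def MovingFrame.IsConformal (F : MovingFrame D) : Prop :=
  ∀ x ∈ D, ∀ X : ℂ, (F.α₂ x X : ℂ) + I * (F.α₃ x X : ℂ) = F.lam x * X

theorem hasFDerivAt_ofReal {g : ℂ → ℝ} {x : ℂ} (h : DifferentiableAt ℝ g x) :
    HasFDerivAt (fun y => (g y : ℂ)) (ofRealCLM.comp (fderiv ℝ g x)) x :=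
  ofRealCLM.hasFDerivAt.comp x h.hasFDerivAt

/-- The Cauchy-Riemann equation, tested on an arbitrary nonzero vector. -/
theorem differentiableAt_complex_iff_of_ne_zero {h : ℂ → ℂ} {x v w : ℂ} (hv : v ≠ 0)
    (hw : w = I * v) :
    DifferentiableAt ℂ h x ↔
      DifferentiableAt ℝ h x ∧ I * fderiv ℝ h x v - fderiv ℝ h x w = 0 := by
  rw [differentiableAt_complex_iff_differentiableAt_real]
  refine and_congr_right fun _ => ?_
  have hlin : ∀ u : ℂ, fderiv ℝ h x u = u.re * fderiv ℝ h x 1 + u.im * fderiv ℝ h x I := by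
    intro u
    conv_lhs => rw [show u = u.re • (1 : ℂ) + u.im • I by
      apply Complex.ext <;> simp, map_add, map_smul, map_smul]
    simp
  have hbar : (starRingEnd ℂ) v ≠ 0 := by simpa using hv
  have hid : I * fderiv ℝ h x v - fderiv ℝ h x w =
      (starRingEnd ℂ v) * (I * fderiv ℝ h x 1 - fderiv ℝ h x I) := by
    have hb : (starRingEnd ℂ) v = v.re - v.im * I := by
      apply Complex.ext <;> simp
    rw [hlin v, hlin w, hw, hb]
    simp
    linear_combination (v.im : ℂ) * fderiv ℝ h x 1 * I_sq
  rw [hid, mul_eq_zero, or_iff_right hbar, sub_eq_zero, smul_eq_mul]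
  exact eq_comm

namespace MovingFrame

theorem lam_ne_zero {x : ℂ} (F : MovingFrame D) (hx : x ∈ D) (hc : F.IsConformal) :
    F.lam x ≠ 0 := by
  intro h0
  have h := hc x hx 1
  rw [h0, zero_mul] at h
  have hre := congrArg re h
  have him := congrArg im h
  simp at hre him
  exact one_ne_zero (F.coframe x hx 1 hre him)

theorem isDualFrame {x : ℂ} (F : MovingFrame D) (hx : x ∈ D) (hc : F.IsConformal) :
    F.IsDualFrame x (F.lam x)⁻¹ (I * (F.lam x)⁻¹) := by
  have h0 := F.lam_ne_zero hx hc
  have h2 := hc x hx (F.lam x)⁻¹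
  have h3 := hc x hx (I * (F.lam x)⁻¹)
  rw [mul_inv_cancel₀ h0] at h2
  rw [mul_left_comm, mul_inv_cancel₀ h0] at h3
  constructor
  · simpa using congrArg re h2
  · simpa using congrArg re h3
  · simpa using congrArg im h2
  · simpa using congrArg im h3

variable (hD : IsOpen D)
include hD

theorem contDiffOn_lam (F : MovingFrame D) : ContDiffOn ℝ ∞ F.lam D :=
  (ofRealCLM.contDiff.comp_contDiffOn ((F.smooth_α₂ hD).clm_apply contDiffOn_const)).add
    (contDiffOn_const.mul
      (ofRealCLM.contDiff.comp_contDiffOn ((F.smooth_α₃ hD).clm_apply contDiffOn_const)))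

theorem differentiableAt_lam (F : MovingFrame D) {x : ℂ} (hx : x ∈ D) :
    DifferentiableAt ℝ F.lam x :=
  (F.contDiffOn_lam hD).differentiableAt_of_mem_isOpen hD hx

end MovingFrame

namespace LocalFrame

variable (hD : IsOpen D)
include hD

/-- The equation `dφ = (q₁ + i q₂) α₂ ∧ α₃`, expressed by `λ`. -/
theorem fderiv_lam {x : ℂ} (hx : x ∈ D) (hc : F.IsConformal) :
    I * fderiv ℝ F.lam x (F.lam x)⁻¹ - fderiv ℝ F.lam x (I * (F.lam x)⁻¹) =
      F.lam x * (F.q₁ x + I * F.q₂ x) := by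
  have h0 := F.lam_ne_zero hx hc
  have hd2 := (F.smooth_α₂ hD).differentiableAt_of_mem_isOpen hD hx
  have hd3 := (F.smooth_α₃ hD).differentiableAt_of_mem_isOpen hD hx
  have key : ∀ X Y : ℂ, fderiv ℝ F.lam x X * Y =
      (fderiv ℝ F.α₂ x X Y : ℂ) + I * (fderiv ℝ F.α₃ x X Y : ℂ) := by
    intro X Y
    have h2 : DifferentiableAt ℝ (fun y => F.α₂ y Y) x := hd2.clm_apply (differentiableAt_const _)
    have h3 : DifferentiableAt ℝ (fun y => F.α₃ y Y) x := hd3.clm_apply (differentiableAt_const _)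
    have e : (fun y => F.lam y * Y) =ᶠ[nhds x]
        fun y => (F.α₂ y Y : ℂ) + I * (F.α₃ y Y : ℂ) :=
      Filter.eventually_of_mem (hD.mem_nhds hx) fun y hy => (hc y hy Y).symm
    have e1 : fderiv ℝ (fun y => F.lam y * Y) x = _ :=
      ((F.differentiableAt_lam hD hx).hasFDerivAt.mul_const Y).fderiv
    have e2 : fderiv ℝ (fun y => (F.α₂ y Y : ℂ) + I * (F.α₃ y Y : ℂ)) x = _ :=
      ((hasFDerivAt_ofReal h2).add ((hasFDerivAt_ofReal h3).const_mul I)).fderiv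
    have e3 := e.fderiv_eq (𝕜 := ℝ)
    rw [e1] at e3
    have e4 := congrArg (fun T : ℂ →L[ℝ] ℂ => T X) (e3.trans e2)
    rw [fderiv_fderiv_apply hd2, fderiv_fderiv_apply hd3]
    simpa [mul_comm] using e4
  obtain ⟨e2, e3, -⟩ := F.dext_dual hD hx (F.isDualFrame hx hc)
  have k1 := key (F.lam x)⁻¹ (I * (F.lam x)⁻¹)
  have k2 := key (I * (F.lam x)⁻¹) (F.lam x)⁻¹
  rw [← e2, ← e3]
  simp only [dext, ofReal_sub]
  have hm := mul_inv_cancel₀ h0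
  generalize (F.lam x)⁻¹ = m at *
  linear_combination F.lam x * k1 - F.lam x * k2
    - (I * fderiv ℝ F.lam x m - fderiv ℝ F.lam x (I * m)) * hm

/-- The `(0,1)` part of `d(P λ²)`. The two real numbers on the right-hand side are the components
of `dP + P τ` in the middle coframe. -/
theorem fderiv_P_mul {x : ℂ} (hx : x ∈ D) (hc : F.IsConformal) :
    DifferentiableAt ℝ (fun y => (F.P y : ℂ) * F.lam y ^ 2) x ∧
    I * fderiv ℝ (fun y => (F.P y : ℂ) * F.lam y ^ 2) x (F.lam x)⁻¹
      - fderiv ℝ (fun y => (F.P y : ℂ) * F.lam y ^ 2) x (I * (F.lam x)⁻¹) =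
    F.lam x ^ 2 * (I * (fderiv ℝ F.P x (F.lam x)⁻¹ + 2 * F.q₂ x * F.P x : ℝ)
      - (fderiv ℝ F.P x (I * (F.lam x)⁻¹) - 2 * F.q₁ x * F.P x : ℝ)) := by
  have hP : DifferentiableAt ℝ F.P x := (F.smooth_p₁.differentiableAt_of_mem_isOpen hD hx).add
    (F.smooth_p₃.differentiableAt_of_mem_isOpen hD hx)
  have hl := F.differentiableAt_lam hD hx
  have e := (hasFDerivAt_ofReal hP).mul (hl.hasFDerivAt.pow 2)
  refine ⟨e.differentiableAt, ?_⟩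
  have e' : fderiv ℝ (fun y => (F.P y : ℂ) * F.lam y ^ 2) x = _ := e.fderiv
  rw [e']
  have h1 := F.fderiv_lam hD hx hc
  simp
  linear_combination (2 * (F.P x : ℂ) * F.lam x) * h1

/-- The `(0,1)` part of `d(Q λ⁴)`. The derivatives of `Q` are expressed by those of `P` with the
Codazzi equations; what remains is the complex conjugate of the combination in `fderiv_P_mul`, up
to a factor. -/
theorem fderiv_Q_mul {x : ℂ} (hx : x ∈ D) (hc : F.IsConformal) :
    DifferentiableAt ℝ (fun y => F.Q y * F.lam y ^ 4) x ∧
    I * fderiv ℝ (fun y => F.Q y * F.lam y ^ 4) x (F.lam x)⁻¹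
      - fderiv ℝ (fun y => F.Q y * F.lam y ^ 4) x (I * (F.lam x)⁻¹) =
    F.lam x ^ 4 / 2 * (I * (fderiv ℝ F.P x (F.lam x)⁻¹ + 2 * F.q₂ x * F.P x : ℝ)
      + (fderiv ℝ F.P x (I * (F.lam x)⁻¹) - 2 * F.q₁ x * F.P x : ℝ)) := by
  have hp₁ := F.smooth_p₁.differentiableAt_of_mem_isOpen hD hx
  have hp₂ := F.smooth_p₂.differentiableAt_of_mem_isOpen hD hx
  have hp₃ := F.smooth_p₃.differentiableAt_of_mem_isOpen hD hx
  have hl := F.differentiableAt_lam hD hx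
  have hQ : HasFDerivAt F.Q _ x := ((hasFDerivAt_ofReal (hp₁.sub hp₃)).mul_const (2⁻¹ : ℂ)).sub
    ((hasFDerivAt_ofReal hp₂).const_mul I)
  have hP : fderiv ℝ F.P x = fderiv ℝ F.p₁ x + fderiv ℝ F.p₃ x :=
    (hp₁.hasFDerivAt.add hp₃.hasFDerivAt).fderiv
  have e := hQ.mul (hl.hasFDerivAt.pow 4)
  refine ⟨e.differentiableAt, ?_⟩
  have e' : fderiv ℝ (fun y => F.Q y * F.lam y ^ 4) x = _ := e.fderiv
  rw [e', hP, fderiv_sub hp₁ hp₃]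
  have h1 := F.fderiv_lam hD hx hc
  obtain ⟨c1, c2⟩ := F.codazzi hD hx (F.isDualFrame hx hc)
  have c1' := congrArg (fun r : ℝ => (r : ℂ)) c1
  have c2' := congrArg (fun r : ℝ => (r : ℂ)) c2
  simp at c1' c2'
  simp [LocalFrame.Q, LocalFrame.P]
  linear_combination (4 * ((F.p₁ x - F.p₃ x) / 2 - I * F.p₂ x) * F.lam x ^ 3) * h1
    + F.lam x ^ 4 * c1' - F.lam x ^ 4 * I * c2'
    - F.lam x ^ 4 * (4 * F.p₂ x * F.q₂ x + fderiv ℝ F.p₂ x (F.lam x)⁻¹) * I_sq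

/-- `Q φ⁴` is holomorphic exactly where `dP + P τ = 0`. -/
theorem differentiableAt_Q_mul_iff {x : ℂ} (hx : x ∈ D) (hc : F.IsConformal) :
    DifferentiableAt ℂ (fun y => F.Q y * F.lam y ^ 4) x ↔ F.IsParallelAt x := by
  have h0 := F.lam_ne_zero hx hc
  obtain ⟨hd, he⟩ := F.fderiv_Q_mul hD hx hc
  rw [differentiableAt_complex_iff_of_ne_zero (inv_ne_zero h0) rfl, he,
    F.isParallelAt_iff hx (F.isDualFrame hx hc), and_iff_right hd, mul_eq_zero,
    or_iff_right (div_ne_zero (pow_ne_zero _ h0) two_ne_zero), Complex.ext_iff, and_comm]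
  simp

/-- If `dP + P τ = 0`, then `P φ²` is holomorphic. -/
theorem differentiableAt_P_mul {x : ℂ} (hx : x ∈ D) (hc : F.IsConformal) (h : F.IsParallelAt x) :
    DifferentiableAt ℂ (fun y => (F.P y : ℂ) * F.lam y ^ 2) x := by
  have h0 := F.lam_ne_zero hx hc
  obtain ⟨hd, he⟩ := F.fderiv_P_mul hD hx hc
  obtain ⟨h2, h3⟩ := (F.isParallelAt_iff hx (F.isDualFrame hx hc)).1 h
  rw [differentiableAt_complex_iff_of_ne_zero (inv_ne_zero h0) rfl, he, h2, h3]
  exact ⟨hd, by simp⟩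

end LocalFrame

end ComplexCoordinates

/-! ### Uniqueness of middle frames -/

section Uniqueness

variable {E : Type*} [NormedAddCommGroup E] [NormedSpace ℝ E]

theorem eq_of_isotropicLine_eq {x v x' v' : Mink} (h : isotropicLine x v = isotropicLine x' v') :
    ∃ g ρ : ℝ, x' = x + g • v ∧ v' = ρ • v := by
  obtain ⟨g, hg⟩ : x' ∈ isotropicLine x v := by rw [h]; exact ⟨0, by simp⟩
  obtain ⟨g₂, hg₂⟩ : x' + v' ∈ isotropicLine x v := by rw [h]; exact ⟨1, by simp⟩
  refine ⟨g, g₂ - g, hg, ?_⟩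
  have : v' = (x' + v') - x' := by abel
  rw [this, hg₂, hg]
  module

theorem smul_mem_posLightcone {v : Mink} {ρ : ℝ} (hv : v ∈ posLightcone) (hρ : 0 < ρ) :
    ρ • v ∈ posLightcone := by
  obtain ⟨h1, h2⟩ := hv
  refine ⟨by rw [mink_smul_left, mink_smul_right, h1]; ring, ?_⟩
  rw [mink_smul_left]
  exact mul_neg_of_pos_of_neg hρ h2

theorem pos_of_smul_mem_posLightcone {v : Mink} {ρ : ℝ} (hv : v ∈ posLightcone)
    (h : ρ • v ∈ posLightcone) : 0 < ρ := by
  obtain ⟨-, h2⟩ := hv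
  obtain ⟨-, h3⟩ := h
  rw [mink_smul_left] at h3
  exact pos_of_mul_neg_left h3 h2.le

/-- The sign of the orientation is multiplicative in the second and third vectors. -/
theorem det_frame_smul (a₁ a₂ a₃ a₄ : Mink) (u v : ℝ) :
    (Matrix.of ![a₁, u • a₂, v • a₃, a₄]).det = u * v * (Matrix.of ![a₁, a₂, a₃, a₄]).det := by
  simp [Matrix.det_succ_row_zero, Fin.sum_univ_succ, Fin.succAbove]
  ring

theorem fderiv_eq_of_eqOn {V : Type*} [NormedAddCommGroup V] [NormedSpace ℝ V] {D : Set E}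
    (hD : IsOpen D) {g h : E → V} (hgh : ∀ y ∈ D, g y = h y) {x : E} (hx : x ∈ D) :
    fderiv ℝ g x = fderiv ℝ h x :=
  Filter.EventuallyEq.fderiv_eq (Filter.eventually_of_mem (hD.mem_nhds hx) hgh)

namespace MovingFrame

variable {D : Set E}

theorem exists_isDualFrame (hE : Module.finrank ℝ E = 2) (F : MovingFrame D) {x : E} (hx : x ∈ D) :
    ∃ X₂ X₃, F.IsDualFrame x X₂ X₃ := by
  have : FiniteDimensional ℝ E := Module.finite_of_finrank_pos (by omega)
  let T : E →ₗ[ℝ] ℝ × ℝ := (F.α₂ x).toLinearMap.prod (F.α₃ x).toLinearMap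
  have hinj : Function.Injective T := by
    rw [injective_iff_map_eq_zero]
    intro X hX
    have h2 := congrArg Prod.fst hX
    have h3 := congrArg Prod.snd hX
    exact F.coframe x hx X h2 h3
  have hsurj : Function.Surjective T :=
    (LinearMap.injective_iff_surjective_of_finrank_eq_finrank (by simp [hE])).1 hinj
  obtain ⟨X₂, h₂⟩ := hsurj (1, 0)
  obtain ⟨X₃, h₃⟩ := hsurj (0, 1)
  exact ⟨X₂, X₃, congrArg Prod.fst h₂, congrArg Prod.fst h₃, congrArg Prod.snd h₂,
    congrArg Prod.snd h₃⟩

/-- The vectors `a₀` and `a₁` of two middle frames along the same family of lines agree. In general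
`G.a₀ = F.a₀ + g F.a₁` and `G.a₁ = ρ F.a₁`, and comparing the metrics induced by `G.a₀` and `G.a₁`
gives `(1 + g)² = ρ² = (1 - g)²`. -/
theorem a₀_a₁_unique (hE : Module.finrank ℝ E = 2) (hD : IsOpen D) (F G : MovingFrame D)
    (h : ∀ x ∈ D, isotropicLine (F.a₀ x) (F.a₁ x) = isotropicLine (G.a₀ x) (G.a₁ x))
    {x : E} (hx : x ∈ D) : G.a₀ x = F.a₀ x ∧ G.a₁ x = F.a₁ x := by
  set g : E → ℝ := fun y => mink (F.a₀ y - G.a₀ y) (F.a₄ y) with hg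
  set ρ : E → ℝ := fun y => -mink (G.a₁ y) (F.a₄ y) with hρ
  have h₀ : ∀ y ∈ D, G.a₀ y = F.a₀ y + g y • F.a₁ y := by
    intro y hy
    obtain ⟨g', ρ', e, -⟩ := eq_of_isotropicLine_eq (h y hy)
    have : g y = g' := by
      simp only [hg]
      rw [e]
      simp [mink_neg_left, mink_smul_left, (F.products hy).m14]
    rw [this, e]
  have h₁ : ∀ y ∈ D, G.a₁ y = ρ y • F.a₁ y := by
    intro y hy
    obtain ⟨g', ρ', -, e⟩ := eq_of_isotropicLine_eq (h y hy)
    have : ρ y = ρ' := by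
      simp only [hρ]
      rw [e]
      simp [mink_smul_left, (F.products hy).m14]
    rw [this, e]
  have dF₀ := F.smooth_a₀.differentiableAt_of_mem_isOpen hD hx
  have dG₀ := G.smooth_a₀.differentiableAt_of_mem_isOpen hD hx
  have dF₁ := F.smooth_a₁.differentiableAt_of_mem_isOpen hD hx
  have dG₁ := G.smooth_a₁.differentiableAt_of_mem_isOpen hD hx
  have dF₄ := F.smooth_a₄.differentiableAt_of_mem_isOpen hD hx
  have dg : DifferentiableAt ℝ g x := (dF₀.sub dG₀).mink dF₄
  have dρ : DifferentiableAt ℝ ρ x := (dG₁.mink dF₄).neg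
  have e₀ : fderiv ℝ G.a₀ x = fderiv ℝ (fun y => F.a₀ y + g y • F.a₁ y) x :=
    fderiv_eq_of_eqOn hD h₀ hx
  have e₁ : fderiv ℝ G.a₁ x = fderiv ℝ (fun y => ρ y • F.a₁ y) x :=
    fderiv_eq_of_eqOn hD h₁ hx
  rw [fderiv_fun_add dF₀ (dg.fun_smul dF₁), fderiv_fun_smul dg dF₁] at e₀
  rw [fderiv_fun_smul dρ dF₁] at e₁
  obtain ⟨f11, f12, f13, f14, f21, f22, f23, f24, f31, f32, f33, f34, f41, f42, f43, f44⟩ :=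
    F.products hx
  obtain ⟨g11, g12, g13, g14, g21, g22, g23, g24, g31, g32, g33, g34, g41, g42, g43, g44⟩ :=
    G.products hx
  have l11 : mink (G.a₁ x) (G.a₁ x) = 0 := g11
  -- The induced metrics of `a₀` and of `a₁` coincide for a middle frame.
  have q : ∀ X, (1 + g x) ^ 2 * F.α₂ x X ^ 2 + (1 - g x) ^ 2 * F.α₃ x X ^ 2 =
      ρ x ^ 2 * (F.α₂ x X ^ 2 + F.α₃ x X ^ 2) := by
    intro X
    have k₀ := congrArg (fun T : E →L[ℝ] Mink => mink (T X) (T X)) e₀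
    have k₁ := congrArg (fun T : E →L[ℝ] Mink => mink (T X) (T X)) e₁
    simp only [add_apply, smul_apply, ContinuousLinearMap.smulRight_apply, F.d_a₀ x hx,
      F.d_a₁ x hx, G.d_a₀ x hx, G.d_a₁ x hx, mink_add_left, mink_add_right, mink_sub_left,
      mink_sub_right, mink_smul_left, mink_smul_right, f11, f12, f13, f21, f22, f23, f31, f32, f33,
      g11, g12, g13, g21, g22, g23, g31, g32, g33] at k₀ k₁
    linarith
  obtain ⟨X₂, X₃, h22, h23, h32, h33⟩ := F.exists_isDualFrame hE hx
  have q2 := q X₂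
  have q3 := q X₃
  rw [h22, h32] at q2
  rw [h23, h33] at q3
  have hg0 : g x = 0 := by linarith
  have hρpos : 0 < ρ x := by
    have hG := (G.frame x hx).2.2.1
    have hF := (F.frame x hx).2.2.1
    simp only [Matrix.cons_val_zero] at hG hF
    rw [h₁ x hx] at hG
    exact pos_of_smul_mem_posLightcone hF hG
  have hρ1 : ρ x = 1 := by
    rw [hg0] at q2
    have hsq : ρ x ^ 2 = 1 ^ 2 := by linarith
    exact (pow_left_inj₀ hρpos.le zero_le_one two_ne_zero).1 hsq
  exact ⟨by rw [h₀ x hx, hg0]; simp, by rw [h₁ x hx, hρ1]; simp⟩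

/-- Two middle frames with the same `a₀` and `a₁` differ at every point at most by a common sign of
`a₂` and `a₃`. -/
theorem sign_unique (hE : Module.finrank ℝ E = 2) (hD : IsOpen D) (F G : MovingFrame D)
    (h₀ : ∀ x ∈ D, G.a₀ x = F.a₀ x) (h₁ : ∀ x ∈ D, G.a₁ x = F.a₁ x) {x : E} (hx : x ∈ D) :
    ∃ ε : ℝ, ε * ε = 1 ∧ G.a₂ x = ε • F.a₂ x ∧ G.a₃ x = ε • F.a₃ x ∧ G.a₄ x = F.a₄ x ∧
      G.α₂ x = ε • F.α₂ x ∧ G.α₃ x = ε • F.α₃ x := by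
  have e₀ : fderiv ℝ G.a₀ x = fderiv ℝ F.a₀ x :=
    fderiv_eq_of_eqOn hD h₀ hx
  have e₁ : fderiv ℝ G.a₁ x = fderiv ℝ F.a₁ x :=
    fderiv_eq_of_eqOn hD h₁ hx
  have k₀ : ∀ X, G.α₂ x X • G.a₂ x + G.α₃ x X • G.a₃ x = F.α₂ x X • F.a₂ x + F.α₃ x X • F.a₃ x := by
    intro X
    rw [← F.d_a₀ x hx, ← G.d_a₀ x hx, e₀]
  have k₁ : ∀ X, G.τ x X • F.a₁ x + G.α₂ x X • G.a₂ x - G.α₃ x X • G.a₃ x =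
      F.τ x X • F.a₁ x + F.α₂ x X • F.a₂ x - F.α₃ x X • F.a₃ x := by
    intro X
    rw [← F.d_a₁ x hx, ← h₁ x hx, ← G.d_a₁ x hx, e₁]
  obtain ⟨f11, f12, f13, f14, f21, f22, f23, f24, f31, f32, f33, f34, f41, f42, f43, f44⟩ :=
    F.products hx
  obtain ⟨g11, g12, g13, g14, g21, g22, g23, g24, g31, g32, g33, g34, g41, g42, g43, g44⟩ :=
    G.products hx
  obtain ⟨X₂, X₃, h22, h23, h32, h33⟩ := F.exists_isDualFrame hE hx
  have k02 := k₀ X₂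
  have k12 := k₁ X₂
  have k03 := k₀ X₃
  have k13 := k₁ X₃
  rw [h22, h32] at k02 k12
  rw [h23, h33] at k03 k13
  -- On `X₂` the difference of both relations equates a multiple of the unit vector `G.a₃` with a
  -- multiple of the null vector `F.a₁`, and likewise on `X₃` for the sum and `G.a₂`.
  have n2 : (2 * G.α₃ x X₂) • G.a₃ x = (G.τ x X₂ - F.τ x X₂) • F.a₁ x := by
    linear_combination (norm := module) k02 - k12
  have z2 : G.α₃ x X₂ = 0 := by
    have := congrArg (fun w => mink w w) n2
    simp only [mink_smul_left, mink_smul_right, g33, f11] at this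
    have hsq : G.α₃ x X₂ ^ 2 = 0 := by linarith
    exact pow_eq_zero_iff two_ne_zero |>.1 hsq
  have n3 : (2 * G.α₂ x X₃) • G.a₂ x = (F.τ x X₃ - G.τ x X₃) • F.a₁ x := by
    linear_combination (norm := module) k03 + k13
  have z3 : G.α₂ x X₃ = 0 := by
    have := congrArg (fun w => mink w w) n3
    simp only [mink_smul_left, mink_smul_right, g22, f11] at this
    have hsq : G.α₂ x X₃ ^ 2 = 0 := by linarith
    exact pow_eq_zero_iff two_ne_zero |>.1 hsq
  rw [z2] at k02
  rw [z3] at k03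
  simp only [zero_smul, one_smul, add_zero, zero_add] at k02 k03
  have u1 : G.α₂ x X₂ * G.α₂ x X₂ = 1 := by
    rw [← f22, ← k02, mink_smul_left, mink_smul_right, g22]; ring
  have v1 : G.α₃ x X₃ * G.α₃ x X₃ = 1 := by
    rw [← f33, ← k03, mink_smul_left, mink_smul_right, g33]; ring
  have a2 : G.a₂ x = G.α₂ x X₂ • F.a₂ x := by rw [← k02, smul_smul, u1, one_smul]
  have a3 : G.a₃ x = G.α₃ x X₃ • F.a₃ x := by rw [← k03, smul_smul, v1, one_smul]
  have a4 : G.a₄ x = F.a₄ x := by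
    have ex := (F.frame x hx).expansion (G.a₄ x)
    have m1 : mink (G.a₄ x) (F.a₁ x) = -1 := by rw [← h₁ x hx, g41]
    have m2 : mink (G.a₄ x) (F.a₂ x) = 0 := by rw [← k02, mink_smul_right, g42, mul_zero]
    have m3 : mink (G.a₄ x) (F.a₃ x) = 0 := by rw [← k03, mink_smul_right, g43, mul_zero]
    rw [m1, m2, m3] at ex
    have sq := congrArg (fun w => mink w w) ex
    simp only [mink_add_left, mink_add_right, mink_smul_left, mink_smul_right, g44, f11, f14, f41,
      f44, f12, f13, f21, f22, f23, f24, f31, f32, f33, f34, f42, f43] at sq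
    have m4 : mink (G.a₄ x) (F.a₄ x) = 0 := by linarith
    rw [ex, m4]
    simp
  have hdet := (G.frame x hx).2.1
  rw [h₁ x hx, a2, a3, a4, det_frame_smul] at hdet
  have huv : 0 < G.α₂ x X₂ * G.α₃ x X₃ := pos_of_mul_pos_left hdet (F.frame x hx).2.1.le
  -- Both signs agree because both frames are positively oriented.
  have heq : G.α₃ x X₃ = G.α₂ x X₂ := by
    have : (G.α₃ x X₃ - G.α₂ x X₂) * (G.α₃ x X₃ + G.α₂ x X₂) = 0 := by linarith
    rcases mul_eq_zero.1 this with h | h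
    · linarith
    · exfalso
      have : G.α₃ x X₃ = -G.α₂ x X₂ := by linarith
      rw [this] at huv
      linarith
  rw [heq] at a3
  generalize G.α₂ x X₂ = ε at u1 a2 a3
  refine ⟨ε, u1, a2, a3, a4, ?_, ?_⟩
  · ext X
    rw [G.α₂_eq hx, F.α₂_eq hx, smul_apply, pairingForm_apply, pairingForm_apply, e₀, a2,
      mink_smul_right, smul_eq_mul]
  · ext X
    rw [G.α₃_eq hx, F.α₃_eq hx, smul_apply, pairingForm_apply, pairingForm_apply, e₀, a3,
      mink_smul_right, smul_eq_mul]

end MovingFrame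

/-- The invariants `pᵢ` of two middle frames along the same family of lines agree, and the middle
coframes agree up to a common sign. -/
theorem LocalFrame.invariants_unique {D : Set E} (hE : Module.finrank ℝ E = 2) (hD : IsOpen D)
    (F G : LocalFrame D)
    (h : ∀ x ∈ D, isotropicLine (F.a₀ x) (F.a₁ x) = isotropicLine (G.a₀ x) (G.a₁ x))
    {x : E} (hx : x ∈ D) :
    G.p₁ x = F.p₁ x ∧ G.p₂ x = F.p₂ x ∧ G.p₃ x = F.p₃ x ∧
      ∃ ε : ℝ, ε * ε = 1 ∧ G.α₂ x = ε • F.α₂ x ∧ G.α₃ x = ε • F.α₃ x := by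
  have h₀ : ∀ x ∈ D, G.a₀ x = F.a₀ x := fun y hy =>
    (F.toMovingFrame.a₀_a₁_unique hE hD G.toMovingFrame h hy).1
  have h₁ : ∀ x ∈ D, G.a₁ x = F.a₁ x := fun y hy =>
    (F.toMovingFrame.a₀_a₁_unique hE hD G.toMovingFrame h hy).2
  have h₄ : ∀ x ∈ D, G.a₄ x = F.a₄ x := fun y hy =>
    let ⟨_, _, _, _, h4, _⟩ := F.toMovingFrame.sign_unique hE hD G.toMovingFrame h₀ h₁ hy
    h4
  have e₄ : fderiv ℝ G.a₄ x = fderiv ℝ F.a₄ x :=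
    fderiv_eq_of_eqOn hD h₄ hx
  obtain ⟨ε, hε, a2, a3, -, al2, al3⟩ :=
    F.toMovingFrame.sign_unique hE hD G.toMovingFrame h₀ h₁ hx
  have b1 : ∀ X, G.β₁ x X = ε * F.β₁ x X := by
    intro X
    rw [G.β₁_eq_pairing hx, F.β₁_eq_pairing hx, pairingForm_apply, pairingForm_apply, e₄, a2,
      mink_smul_right]
  have b2 : ∀ X, G.β₂ x X = ε * F.β₂ x X := by
    intro X
    rw [G.β₂_eq_pairing hx, F.β₂_eq_pairing hx, pairingForm_apply, pairingForm_apply, e₄, a3,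
      mink_smul_right]
  have hε0 : ε ≠ 0 := by
    rintro rfl
    norm_num at hε
  obtain ⟨X₂, X₃, h22, h23, h32, h33⟩ := F.exists_isDualFrame hE hx
  have b12 := b1 X₂
  have b13 := b1 X₃
  have b23 := b2 X₃
  simp only [F.β₁_eq x hx, G.β₁_eq x hx, F.β₂_eq x hx, G.β₂_eq x hx, al2, al3, add_apply,
    smul_apply, smul_eq_mul, h22, h23, h32, h33] at b12 b13 b23
  refine ⟨?_, ?_, ?_, ε, hε, al2, al3⟩ <;> apply mul_left_cancel₀ hε0 <;> linarith

end Uniqueness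

/-! ### Middle frames in coordinates -/

section Transport

variable {M : Type*} [TopologicalSpace M] [ChartedSpace (EuclideanSpace ℝ (Fin 2)) M]
variable {E : Type*} [NormedAddCommGroup E] [NormedSpace ℝ E]

/-- `e` is a smooth chart of the surface `M` with values in the normed space `E`. -/
def IsSmoothChart (e : OpenPartialHomeomorph M E) : Prop :=
  ContMDiffOn (𝓡 2) 𝓘(ℝ, E) ∞ e e.source ∧ ContMDiffOn 𝓘(ℝ, E) (𝓡 2) ∞ e.symm e.target

theorem isSmoothChart_chartAt [IsManifold (𝓡 2) ∞ M] (p : M) :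
    IsSmoothChart (chartAt (EuclideanSpace ℝ (Fin 2)) p) :=
  ⟨contMDiffOn_chart, contMDiffOn_chart_symm⟩

/-- The differential of the inverse of a chart. -/
def dSymm (e : OpenPartialHomeomorph M E) (y : E) : E →L[ℝ] TangentSpace (𝓡 2) (e.symm y) :=
  mfderiv 𝓘(ℝ, E) (𝓡 2) e.symm y

theorem _root_.ContMDiffOn.mdifferentiableAt_of_mem_isOpen {V : Type*} [NormedAddCommGroup V]
    [NormedSpace ℝ V] {g : M → V} {U : Set M} (hU : IsOpen U)
    (hg : ContMDiffOn (𝓡 2) 𝓘(ℝ, V) ∞ g U) {p : M} (hp : p ∈ U) :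
    MDifferentiableAt (𝓡 2) 𝓘(ℝ, V) g p :=
  (hg.contMDiffAt (hU.mem_nhds hp)).mdifferentiableAt (by simp)

namespace IsSmoothChart

variable {e : OpenPartialHomeomorph M E} (he : IsSmoothChart e)
include he

theorem restr {U : Set M} (hU : IsOpen U) : IsSmoothChart (e.restrOpen U hU) := by
  refine ⟨he.1.mono ?_, he.2.mono ?_⟩
  · rw [e.restrOpen_source]
    exact Set.inter_subset_left
  · intro y hy
    have := (e.restrOpen U hU).map_target hy
    exact hy.1

theorem mdifferentiableAt {p : M} (hp : p ∈ e.source) :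
    MDifferentiableAt (𝓡 2) 𝓘(ℝ, E) e p :=
  (he.1.contMDiffAt (e.open_source.mem_nhds hp)).mdifferentiableAt (by simp)

theorem mdifferentiableAt_symm {y : E} (hy : y ∈ e.target) :
    MDifferentiableAt 𝓘(ℝ, E) (𝓡 2) e.symm y :=
  (he.2.contMDiffAt (e.open_target.mem_nhds hy)).mdifferentiableAt (by simp)

theorem fderiv_comp_symm {V : Type*} [NormedAddCommGroup V] [NormedSpace ℝ V] {g : M → V} {y : E}
    (hy : y ∈ e.target) (hg : MDifferentiableAt (𝓡 2) 𝓘(ℝ, V) g (e.symm y)) (X : E) :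
    fderiv ℝ (g ∘ e.symm) y X = dAt g (e.symm y) (dSymm e y X) := by
  rw [← mfderiv_eq_fderiv, mfderiv_comp y hg (he.mdifferentiableAt_symm hy)]
  rfl

theorem dAt_dSymm {y : E} (hy : y ∈ e.target) (X : E) : dAt e (e.symm y) (dSymm e y X) = X := by
  rw [← he.fderiv_comp_symm hy (he.mdifferentiableAt (e.map_target hy))]
  have : (e ∘ e.symm) =ᶠ[nhds y] id :=
    Filter.eventually_of_mem (e.open_target.mem_nhds hy) fun z hz => e.right_inv hz
  rw [this.fderiv_eq, fderiv_id]
  rfl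

theorem dSymm_injective {y : E} (hy : y ∈ e.target) {X : E} (h : dSymm e y X = 0) : X = 0 := by
  rw [← he.dAt_dSymm hy X, h, map_zero]

theorem dSymm_surjective {y : E} (hy : y ∈ e.target) (X : TangentSpace (𝓡 2) (e.symm y)) :
    ∃ Y : E, dSymm e y Y = X := by
  have hp := e.map_target hy
  have h1 : (e.symm ∘ e) =ᶠ[nhds (e.symm y)] id :=
    Filter.eventually_of_mem (e.open_source.mem_nhds hp) fun z hz => e.left_inv hz
  have h2 : mfderiv (𝓡 2) (𝓡 2) (e.symm ∘ e) (e.symm y) = mfderiv (𝓡 2) (𝓡 2) id (e.symm y) :=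
    h1.mfderiv_eq
  have hey : e (e.symm y) = y := e.right_inv hy
  rw [mfderiv_id, mfderiv_comp_of_eq (y := y) (I' := 𝓘(ℝ, E)) (he.mdifferentiableAt_symm hy)
    (he.mdifferentiableAt hp) hey] at h2
  have h3 : (fun z => (mfderiv 𝓘(ℝ, E) (𝓡 2) e.symm z : E →L[ℝ] EuclideanSpace ℝ (Fin 2)))
      (e (e.symm y)) (dAt e (e.symm y) X) = X :=
    congrArg (fun T : EuclideanSpace ℝ (Fin 2) →L[ℝ] EuclideanSpace ℝ (Fin 2) => T X) h2
  rw [hey] at h3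
  exact ⟨_, h3⟩

theorem contDiffOn_comp_symm {V : Type*} [NormedAddCommGroup V] [NormedSpace ℝ V] {g : M → V}
    {U : Set M} (hg : ContMDiffOn (𝓡 2) 𝓘(ℝ, V) ∞ g U) :
    ContDiffOn ℝ ∞ (g ∘ e.symm) (e.target ∩ e.symm ⁻¹' U) := by
  rw [← contMDiffOn_iff_contDiffOn]
  exact hg.comp (he.2.mono Set.inter_subset_left) fun y hy => hy.2

variable {f n : M → E3} {U : Set M}

/-- A middle frame field in the chart `e`. -/
def pullback (hU : IsOpen U) (F : MiddleFrame f n U) : LocalFrame (e.target ∩ e.symm ⁻¹' U) where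
  a₀ := F.a₀ ∘ e.symm
  a₁ := F.a₁ ∘ e.symm
  a₂ := F.a₂ ∘ e.symm
  a₃ := F.a₃ ∘ e.symm
  a₄ := F.a₄ ∘ e.symm
  α₂ y := (F.α₂ (e.symm y)).comp (dSymm e y)
  α₃ y := (F.α₃ (e.symm y)).comp (dSymm e y)
  τ y := (2 * F.q₂ (e.symm y)) • (F.α₂ (e.symm y)).comp (dSymm e y)
    + (-2 * F.q₁ (e.symm y)) • (F.α₃ (e.symm y)).comp (dSymm e y)
  ψ y := F.q₁ (e.symm y) • (F.α₂ (e.symm y)).comp (dSymm e y)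
    + F.q₂ (e.symm y) • (F.α₃ (e.symm y)).comp (dSymm e y)
  β₁ y := F.p₁ (e.symm y) • (F.α₂ (e.symm y)).comp (dSymm e y)
    + F.p₂ (e.symm y) • (F.α₃ (e.symm y)).comp (dSymm e y)
  β₂ y := F.p₂ (e.symm y) • (F.α₂ (e.symm y)).comp (dSymm e y)
    + F.p₃ (e.symm y) • (F.α₃ (e.symm y)).comp (dSymm e y)
  p₁ := F.p₁ ∘ e.symm
  p₂ := F.p₂ ∘ e.symm
  p₃ := F.p₃ ∘ e.symm
  q₁ := F.q₁ ∘ e.symm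
  q₂ := F.q₂ ∘ e.symm
  smooth_a₀ := he.contDiffOn_comp_symm F.smooth_a₀
  smooth_a₁ := he.contDiffOn_comp_symm F.smooth_a₁
  smooth_a₂ := he.contDiffOn_comp_symm F.smooth_a₂
  smooth_a₃ := he.contDiffOn_comp_symm F.smooth_a₃
  smooth_a₄ := he.contDiffOn_comp_symm F.smooth_a₄
  smooth_p₁ := he.contDiffOn_comp_symm F.smooth_p₁
  smooth_p₂ := he.contDiffOn_comp_symm F.smooth_p₂
  smooth_p₃ := he.contDiffOn_comp_symm F.smooth_p₃
  smooth_q₁ := he.contDiffOn_comp_symm F.smooth_q₁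
  smooth_q₂ := he.contDiffOn_comp_symm F.smooth_q₂
  frame y hy := F.frame _ hy.2
  coframe y hy X h2 h3 := he.dSymm_injective hy.1 (F.coframe _ hy.2 _ h2 h3)
  d_a₀ y hy X := by
    rw [he.fderiv_comp_symm hy.1 (F.smooth_a₀.mdifferentiableAt_of_mem_isOpen hU hy.2),
      F.d_a₀ _ hy.2]
    rfl
  d_a₁ y hy X := by
    rw [he.fderiv_comp_symm hy.1 (F.smooth_a₁.mdifferentiableAt_of_mem_isOpen hU hy.2),
      F.d_a₁ _ hy.2]
    simp only [add_apply, smul_apply, smul_eq_mul, Function.comp_apply]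
    simp only [ContinuousLinearMap.comp_apply]
    module
  d_a₂ y hy X := by
    rw [he.fderiv_comp_symm hy.1 (F.smooth_a₂.mdifferentiableAt_of_mem_isOpen hU hy.2),
      F.d_a₂ _ hy.2]
    simp only [add_apply, smul_apply, smul_eq_mul, Function.comp_apply]
    simp only [ContinuousLinearMap.comp_apply]
  d_a₃ y hy X := by
    rw [he.fderiv_comp_symm hy.1 (F.smooth_a₃.mdifferentiableAt_of_mem_isOpen hU hy.2),
      F.d_a₃ _ hy.2]
    simp only [add_apply, smul_apply, smul_eq_mul, Function.comp_apply]
    simp only [ContinuousLinearMap.comp_apply]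
    module
  d_a₄ y hy X := by
    rw [he.fderiv_comp_symm hy.1 (F.smooth_a₄.mdifferentiableAt_of_mem_isOpen hU hy.2),
      F.d_a₄ _ hy.2]
    simp only [add_apply, smul_apply, smul_eq_mul, Function.comp_apply]
    simp only [ContinuousLinearMap.comp_apply]
    module
  τ_eq _ _ := rfl
  ψ_eq _ _ := rfl
  β₁_eq _ _ := rfl
  β₂_eq _ _ := rfl

end IsSmoothChart

end Transport

/-- The restriction of a moving frame to a smaller set. -/
def MovingFrame.mono {E : Type*} [NormedAddCommGroup E] [NormedSpace ℝ E] {D D' : Set E}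
    (F : MovingFrame D) (h : D' ⊆ D) : MovingFrame D' :=
  { F with
    smooth_a₀ := F.smooth_a₀.mono h
    smooth_a₁ := F.smooth_a₁.mono h
    smooth_a₂ := F.smooth_a₂.mono h
    smooth_a₃ := F.smooth_a₃.mono h
    smooth_a₄ := F.smooth_a₄.mono h
    frame := fun x hx => F.frame x (h hx)
    coframe := fun x hx => F.coframe x (h hx)
    d_a₀ := fun x hx => F.d_a₀ x (h hx)
    d_a₁ := fun x hx => F.d_a₁ x (h hx)
    d_a₂ := fun x hx => F.d_a₂ x (h hx)
    d_a₃ := fun x hx => F.d_a₃ x (h hx)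
    d_a₄ := fun x hx => F.d_a₄ x (h hx) }

/-- The restriction of a local frame to a smaller set. -/
def LocalFrame.mono {E : Type*} [NormedAddCommGroup E] [NormedSpace ℝ E] {D D' : Set E}
    (F : LocalFrame D) (h : D' ⊆ D) : LocalFrame D' :=
  { F with
    toMovingFrame := F.toMovingFrame.mono h
    smooth_p₁ := F.smooth_p₁.mono h
    smooth_p₂ := F.smooth_p₂.mono h
    smooth_p₃ := F.smooth_p₃.mono h
    smooth_q₁ := F.smooth_q₁.mono h
    smooth_q₂ := F.smooth_q₂.mono h
    τ_eq := fun x hx => F.τ_eq x (h hx)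
    ψ_eq := fun x hx => F.ψ_eq x (h hx)
    β₁_eq := fun x hx => F.β₁_eq x (h hx)
    β₂_eq := fun x hx => F.β₂_eq x (h hx) }

/-! ### The invariants of a Legendre immersion in terms of a middle frame -/

section Invariants

variable {M : Type*} [TopologicalSpace M] [ChartedSpace (EuclideanSpace ℝ (Fin 2)) M]
  [IsManifold (𝓡 2) ∞ M] {f n : M → E3} {U V : Set M}

/-- Two middle frame fields along `F` have the same invariants. -/
theorem MiddleFrame.unique (hU : IsOpen U) (hV : IsOpen V) (F : MiddleFrame f n U)
    (G : MiddleFrame f n V) {p : M} (hp : p ∈ U) (hp' : p ∈ V) :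
    G.a₀ p = F.a₀ p ∧ G.a₁ p = F.a₁ p ∧ G.p₁ p = F.p₁ p ∧ G.p₂ p = F.p₂ p ∧ G.p₃ p = F.p₃ p ∧
      ∃ ε : ℝ, ε * ε = 1 ∧ ∀ X, G.α₂ p X = ε * F.α₂ p X ∧ G.α₃ p X = ε * F.α₃ p X := by
  obtain ⟨e, he, hpe⟩ : ∃ e : OpenPartialHomeomorph M (EuclideanSpace ℝ (Fin 2)),
      IsSmoothChart e ∧ p ∈ e.source := ⟨_, isSmoothChart_chartAt p, mem_chart_source _ p⟩
  obtain ⟨y, hy, rfl⟩ : ∃ y ∈ e.target, e.symm y = p := ⟨e p, e.map_source hpe, e.left_inv hpe⟩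
  set D := e.target ∩ e.symm ⁻¹' (U ∩ V) with hD_def
  have hD : IsOpen D := e.isOpen_inter_preimage_symm (hU.inter hV)
  have hDU : D ⊆ e.target ∩ e.symm ⁻¹' U := fun z hz => ⟨hz.1, hz.2.1⟩
  have hDV : D ⊆ e.target ∩ e.symm ⁻¹' V := fun z hz => ⟨hz.1, hz.2.2⟩
  have hE : Module.finrank ℝ (EuclideanSpace ℝ (Fin 2)) = 2 := by simp
  let F' := (he.pullback hU F).mono hDU
  let G' := (he.pullback hV G).mono hDV
  have hline : ∀ z ∈ D,
      isotropicLine (F'.a₀ z) (F'.a₁ z) = isotropicLine (G'.a₀ z) (G'.a₁ z) := fun z hz =>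
    (F.along _ hz.2.1).trans (G.along _ hz.2.2).symm
  have hyD : y ∈ D := ⟨hy, hp, hp'⟩
  obtain ⟨h0, h1⟩ := F'.toMovingFrame.a₀_a₁_unique hE hD G'.toMovingFrame hline hyD
  obtain ⟨h2, h3, h4, ε, hε, h5, h6⟩ := F'.invariants_unique hE hD G' hline hyD
  refine ⟨h0, h1, h2, h3, h4, ε, hε, fun X => ?_⟩
  obtain ⟨Y, rfl⟩ := he.dSymm_surjective hy X
  exact ⟨congrArg (fun T : EuclideanSpace ℝ (Fin 2) →L[ℝ] ℝ => T Y) h5,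
    congrArg (fun T : EuclideanSpace ℝ (Fin 2) →L[ℝ] ℝ => T Y) h6⟩

omit [IsManifold (𝓡 2) ∞ M] in
theorem MiddleFrame.hasMiddleFrameAt (hU : IsOpen U) (F : MiddleFrame f n U) {p : M} (hp : p ∈ U) :
    HasMiddleFrameAt f n p := ⟨U, hU, hp, ⟨F⟩⟩

theorem MiddleFrame.gaussMap_eq (hU : IsOpen U) (F : MiddleFrame f n U) {p : M} (hp : p ∈ U) :
    gaussMap f n p = F.a₀ p := by
  have h := F.hasMiddleFrameAt hU hp
  rw [gaussMap, dif_pos h]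
  exact (F.unique hU h.choose_spec.1 h.middleFrame hp h.choose_spec.2.1).1

theorem MiddleFrame.normalVec_eq (hU : IsOpen U) (F : MiddleFrame f n U) {p : M} (hp : p ∈ U) :
    normalVec f n p = F.a₁ p := by
  have h := F.hasMiddleFrameAt hU hp
  rw [normalVec, dif_pos h]
  exact (F.unique hU h.choose_spec.1 h.middleFrame hp h.choose_spec.2.1).2.1

theorem MiddleFrame.invP_eq (hU : IsOpen U) (F : MiddleFrame f n U) {p : M} (hp : p ∈ U) :
    invP f n p = F.p₁ p + F.p₃ p := by
  have h := F.hasMiddleFrameAt hU hp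
  obtain ⟨-, -, h1, -, h3, -⟩ := F.unique hU h.choose_spec.1 h.middleFrame hp h.choose_spec.2.1
  rw [invP, dif_pos h, h1, h3]

theorem MiddleFrame.invQ_eq (hU : IsOpen U) (F : MiddleFrame f n U) {p : M} (hp : p ∈ U) :
    invQ f n p = ((F.p₁ p - F.p₃ p : ℝ) : ℂ) / 2 - Complex.I * (F.p₂ p : ℂ) := by
  have h := F.hasMiddleFrameAt hU hp
  obtain ⟨-, -, h1, h2, h3, -⟩ := F.unique hU h.choose_spec.1 h.middleFrame hp h.choose_spec.2.1
  rw [invQ, dif_pos h, h1, h2, h3]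

theorem MiddleFrame.phi_eq (hU : IsOpen U) (F : MiddleFrame f n U) {p : M} (hp : p ∈ U) :
    ∃ ε : ℂ, ε ^ 2 = 1 ∧
      ∀ X, phi f n p X = ε * ((F.α₂ p X : ℂ) + Complex.I * (F.α₃ p X : ℂ)) := by
  have h := F.hasMiddleFrameAt hU hp
  obtain ⟨-, -, -, -, -, ε, hε, hα⟩ :=
    F.unique hU h.choose_spec.1 h.middleFrame hp h.choose_spec.2.1
  refine ⟨ε, by rw [pow_two]; exact_mod_cast hε, fun X => ?_⟩
  rw [phi, dif_pos h, (hα X).1, (hα X).2]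
  push_cast
  ring

theorem MiddleFrame.phi_sq (hU : IsOpen U) (F : MiddleFrame f n U) {p : M} (hp : p ∈ U)
    (X : TangentSpace (𝓡 2) p) :
    phi f n p X ^ 2 = ((F.α₂ p X : ℂ) + Complex.I * (F.α₃ p X : ℂ)) ^ 2 := by
  obtain ⟨ε, hε, h⟩ := F.phi_eq hU hp
  rw [h, mul_pow, hε, one_mul]

omit [IsManifold (𝓡 2) ∞ M] in
/-- A complex coordinate exists only where there are middle frames: elsewhere `phi` vanishes. -/
theorem IsComplexCoord.hasMiddleFrameAt {z : OpenPartialHomeomorph M ℂ}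
    (hz : IsComplexCoord f n z) {p : M} (hp : p ∈ z.source) : HasMiddleFrameAt f n p := by
  by_contra h
  obtain ⟨c, hc, hX⟩ := hz.2 p hp
  obtain ⟨y, hy, rfl⟩ : ∃ y ∈ z.target, z.symm y = p := ⟨z p, z.map_source hp, z.left_inv hp⟩
  have h1 := hX (dSymm z y 1)
  have hz' : IsSmoothChart z := hz.1
  rw [hz'.dAt_dSymm hy, phi, dif_neg h, mul_one] at h1
  exact hc h1.symm

variable {z : OpenPartialHomeomorph M ℂ}

/-- A middle frame field in a complex coordinate is conformal, `φ = λ dz`. -/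
theorem IsComplexCoord.isConformal (hz : IsComplexCoord f n z) (hU : IsOpen U)
    (F : MiddleFrame f n U) : (IsSmoothChart.pullback hz.1 hU F).IsConformal := by
  have hz' : IsSmoothChart z := hz.1
  intro y hy X
  obtain ⟨c, -, hc⟩ := hz.2 (z.symm y) (z.map_target hy.1)
  obtain ⟨ε, hε, h⟩ := F.phi_eq hU hy.2
  have hε0 : ε ≠ 0 := by
    rintro rfl
    norm_num at hε
  have key : ∀ X : ℂ, (F.α₂ _ (dSymm z y X) : ℂ) + Complex.I * (F.α₃ _ (dSymm z y X) : ℂ) =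
      ε⁻¹ * c * X := by
    intro X
    have := hc (dSymm z y X)
    rw [h, hz'.dAt_dSymm hy.1] at this
    rw [mul_assoc, ← this, inv_mul_cancel_left₀ hε0]
  have h1 : (IsSmoothChart.pullback hz.1 hU F).lam y = ε⁻¹ * c * 1 := key 1
  rw [h1, mul_one]
  exact key X

/-- Conversely, a smooth chart in which a middle frame field is conformal is a complex
coordinate. -/
theorem IsSmoothChart.isComplexCoord (hz : IsSmoothChart z) (hU : IsOpen U)
    (F : MiddleFrame f n U) (hc : (hz.pullback hU F).IsConformal) (hzU : z.source ⊆ U) :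
    IsComplexCoord f n z := by
  refine ⟨hz, fun p hp => ?_⟩
  obtain ⟨y, hy, rfl⟩ : ∃ y ∈ z.target, z.symm y = p := ⟨z p, z.map_source hp, z.left_inv hp⟩
  have hyD : y ∈ z.target ∩ z.symm ⁻¹' U := ⟨hy, hzU hp⟩
  obtain ⟨ε, hε, h⟩ := F.phi_eq hU (hzU hp)
  have hε0 : ε ≠ 0 := by
    rintro rfl
    norm_num at hε
  refine ⟨ε * (hz.pullback hU F).lam y,
    mul_ne_zero hε0 (MovingFrame.lam_ne_zero _ hyD hc), fun X => ?_⟩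
  obtain ⟨Y, rfl⟩ := hz.dSymm_surjective hy X
  rw [h, hz.dAt_dSymm hy, mul_assoc]
  exact congrArg _ (hc y hyD Y)

theorem quarticDiff_dSymm (hz : IsSmoothChart z) (hU : IsOpen U) (F : MiddleFrame f n U)
    (hc : (hz.pullback hU F).IsConformal) {y : ℂ} (hy : y ∈ z.target ∩ z.symm ⁻¹' U) (X : ℂ) :
    quarticDiff f n (z.symm y) (dSymm z y X) =
      (hz.pullback hU F).Q y * (hz.pullback hU F).lam y ^ 4 * X ^ 4 := by
  rw [quarticDiff, show (4 : ℕ) = 2 * 2 from rfl, pow_mul, F.phi_sq hU hy.2, ← pow_mul,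
    F.invQ_eq hU hy.2, mul_assoc, ← mul_pow]
  exact congrArg (fun w : ℂ => _ * w ^ (2 * 2)) (hc y hy X)

theorem quadraticDiff_dSymm (hz : IsSmoothChart z) (hU : IsOpen U) (F : MiddleFrame f n U)
    (hc : (hz.pullback hU F).IsConformal) {y : ℂ} (hy : y ∈ z.target ∩ z.symm ⁻¹' U) (X : ℂ) :
    quadraticDiff f n (z.symm y) (dSymm z y X) =
      ((hz.pullback hU F).P y : ℂ) * (hz.pullback hU F).lam y ^ 2 * X ^ 2 := by
  rw [quadraticDiff, F.phi_sq hU hy.2, F.invP_eq hU hy.2, mul_assoc, ← mul_pow]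
  exact congrArg (fun w : ℂ => _ * w ^ 2) (hc y hy X)

end Invariants

/-! ### The mean curvature vector of the Gauss map -/

/-- If the rows of `A` are the components of a basis in an orthonormal frame, then the inverse of
its Gram matrix `A Aᵀ` contracts two copies of `A` to the identity. -/
theorem sum_gram_inv_mul {A : Matrix (Fin 2) (Fin 2) ℝ} (hA : A.det ≠ 0) (k l : Fin 2) :
    ∑ i, ∑ j, (A * A.transpose)⁻¹ i j * (A i k * A j l) = (1 : Matrix (Fin 2) (Fin 2) ℝ) k l := by
  have hu : IsUnit A.det := isUnit_iff_ne_zero.2 hA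
  have hut : IsUnit A.transpose.det := by rwa [Matrix.det_transpose]
  have h : A.transpose * (A * A.transpose)⁻¹ * A = 1 := by
    rw [Matrix.mul_inv_rev, ← mul_assoc, Matrix.mul_nonsing_inv _ hut, one_mul,
      Matrix.nonsing_inv_mul _ hu]
  rw [← h]
  simp only [Matrix.mul_apply, Matrix.transpose_apply, Fin.sum_univ_two]
  ring

section MeanCurvature

variable {M : Type*} [TopologicalSpace M] [ChartedSpace (EuclideanSpace ℝ (Fin 2)) M]
  [IsManifold (𝓡 2) ∞ M] {f n : M → E3} {U : Set M}

/-- The components of the standard basis of `ℝ²` in the coframe of a moving frame. -/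
def MovingFrame.coframeMatrix {D : Set (EuclideanSpace ℝ (Fin 2))} (F : MovingFrame D)
    (y : EuclideanSpace ℝ (Fin 2)) : Matrix (Fin 2) (Fin 2) ℝ :=
  Matrix.of fun i => ![F.α₂ y (EuclideanSpace.single i 1), F.α₃ y (EuclideanSpace.single i 1)]

theorem MovingFrame.det_coframeMatrix_ne_zero {D : Set (EuclideanSpace ℝ (Fin 2))}
    (F : MovingFrame D) {y : EuclideanSpace ℝ (Fin 2)} (hy : y ∈ D) :
    (F.coframeMatrix y).det ≠ 0 := by
  intro h0
  obtain ⟨v, hv, hv0⟩ := Matrix.exists_vecMul_eq_zero_iff.2 h0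
  apply hv
  have h2 := congrFun hv0 0
  have h3 := congrFun hv0 1
  simp [Matrix.vecMul, dotProduct, coframeMatrix] at h2 h3
  have hX := F.coframe y hy
    (v 0 • EuclideanSpace.single 0 (1 : ℝ) + v 1 • EuclideanSpace.single 1 (1 : ℝ))
    (by simpa using h2) (by simpa using h3)
  ext i
  have := congrArg (fun w : EuclideanSpace ℝ (Fin 2) => w i) hX
  fin_cases i <;> simpa using this

/-- A middle frame in the preferred chart at a point, with the point itself in the chart. -/
theorem MiddleFrame.chart_facts (hU : IsOpen U) (F : MiddleFrame f n U) {p : M} (hp : p ∈ U) :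
    ∃ (D : Set (EuclideanSpace ℝ (Fin 2))) (G : LocalFrame D),
      IsOpen D ∧ chartAt (EuclideanSpace ℝ (Fin 2)) p p ∈ D ∧
      (∀ y ∈ D, coordRep (gaussMap f n) p y = G.a₀ y) ∧
      G.a₁ (chartAt (EuclideanSpace ℝ (Fin 2)) p p) = F.a₁ p ∧
      G.a₂ (chartAt (EuclideanSpace ℝ (Fin 2)) p p) = F.a₂ p ∧
      G.a₃ (chartAt (EuclideanSpace ℝ (Fin 2)) p p) = F.a₃ p ∧
      G.p₁ (chartAt (EuclideanSpace ℝ (Fin 2)) p p) = F.p₁ p ∧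
      G.p₃ (chartAt (EuclideanSpace ℝ (Fin 2)) p p) = F.p₃ p := by
  have hl := (chartAt (EuclideanSpace ℝ (Fin 2)) p).left_inv (mem_chart_source _ p)
  have he : IsSmoothChart (chartAt (EuclideanSpace ℝ (Fin 2)) p) := isSmoothChart_chartAt p
  refine ⟨_, he.pullback hU F,
    (chartAt (EuclideanSpace ℝ (Fin 2)) p).isOpen_inter_preimage_symm hU,
    ⟨(chartAt (EuclideanSpace ℝ (Fin 2)) p).map_source (mem_chart_source _ p), ?_⟩,
    fun y hy => F.gaussMap_eq hU hy.2, congrArg F.a₁ hl, congrArg F.a₂ hl, congrArg F.a₃ hl,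
    congrArg F.p₁ hl, congrArg F.p₃ hl⟩
  rw [Set.mem_preimage, hl]
  exact hp

omit [IsManifold (𝓡 2) ∞ M] in
theorem MovingFrame.tangentVec_eq {D : Set (EuclideanSpace ℝ (Fin 2))} (G : MovingFrame D)
    (hD : IsOpen D) {σ : M → Mink} {p : M} (hy : chartAt (EuclideanSpace ℝ (Fin 2)) p p ∈ D)
    (h : ∀ y ∈ D, coordRep σ p y = G.a₀ y) (i : Fin 2) :
    tangentVec σ p i =
      G.coframeMatrix (chartAt (EuclideanSpace ℝ (Fin 2)) p p) i 0 •
        G.a₂ (chartAt (EuclideanSpace ℝ (Fin 2)) p p) +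
      G.coframeMatrix (chartAt (EuclideanSpace ℝ (Fin 2)) p p) i 1 •
        G.a₃ (chartAt (EuclideanSpace ℝ (Fin 2)) p p) := by
  rw [tangentVec, partialDeriv, fderiv_eq_of_eqOn hD h hy, G.d_a₀ _ hy]
  rfl

omit [IsManifold (𝓡 2) ∞ M] in
theorem MovingFrame.inducedMetric_eq {D : Set (EuclideanSpace ℝ (Fin 2))} (G : MovingFrame D)
    (hD : IsOpen D) {σ : M → Mink} {p : M} (hy : chartAt (EuclideanSpace ℝ (Fin 2)) p p ∈ D)
    (h : ∀ y ∈ D, coordRep σ p y = G.a₀ y) :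
    inducedMetric σ p = G.coframeMatrix (chartAt (EuclideanSpace ℝ (Fin 2)) p p) *
      (G.coframeMatrix (chartAt (EuclideanSpace ℝ (Fin 2)) p p)).transpose := by
  ext i j
  have hpr := G.products hy
  rw [inducedMetric, Matrix.of_apply, G.tangentVec_eq hD hy h, G.tangentVec_eq hD hy h]
  simp only [mink_add_left, mink_add_right, mink_smul_left, mink_smul_right, hpr.m22, hpr.m23,
    hpr.m32, hpr.m33, Matrix.mul_apply, Matrix.transpose_apply, Fin.sum_univ_two]
  ring

omit [IsManifold (𝓡 2) ∞ M] in
theorem MovingFrame.normalPart_eq {D : Set (EuclideanSpace ℝ (Fin 2))} (G : MovingFrame D)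
    (hD : IsOpen D) {σ : M → Mink} {p : M} (hy : chartAt (EuclideanSpace ℝ (Fin 2)) p p ∈ D)
    (h : ∀ y ∈ D, coordRep σ p y = G.a₀ y) (w : Mink) :
    normalPart σ p w =
      w - mink w (G.a₂ (chartAt (EuclideanSpace ℝ (Fin 2)) p p)) •
          G.a₂ (chartAt (EuclideanSpace ℝ (Fin 2)) p p)
        - mink w (G.a₃ (chartAt (EuclideanSpace ℝ (Fin 2)) p p)) •
          G.a₃ (chartAt (EuclideanSpace ℝ (Fin 2)) p p) := by
  have hs := sum_gram_inv_mul (G.det_coframeMatrix_ne_zero hy)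
  rw [normalPart, G.inducedMetric_eq hD hy h]
  simp only [G.tangentVec_eq hD hy h]
  have h00 := hs 0 0
  have h01 := hs 0 1
  have h10 := hs 1 0
  have h11 := hs 1 1
  generalize (G.coframeMatrix _ * (G.coframeMatrix _).transpose)⁻¹ = g at *
  generalize G.coframeMatrix _ = A at *
  generalize G.a₂ _ = a₂
  generalize G.a₃ _ = a₃
  simp only [Fin.sum_univ_two, Matrix.one_apply, if_true] at h00 h01 h10 h11
  simp only [zero_ne_one, one_ne_zero, if_false] at h00 h01 h10 h11
  simp only [Fin.sum_univ_two, mink_add_right, mink_smul_right]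
  generalize mink w a₂ = w₂
  generalize mink w a₃ = w₃
  linear_combination (norm := module) -(w₂ * h00 + w₃ * h01) • a₂ - (w₂ * h10 + w₃ * h11) • a₃

omit [IsManifold (𝓡 2) ∞ M] in
/-- The second derivatives of `a₀`, up to the tangential components. -/
theorem LocalFrame.normalPart_partialDeriv {D : Set (EuclideanSpace ℝ (Fin 2))} (G : LocalFrame D)
    (hD : IsOpen D) {σ : M → Mink} {p : M} (hy : chartAt (EuclideanSpace ℝ (Fin 2)) p p ∈ D)
    (h : ∀ y ∈ D, coordRep σ p y = G.a₀ y) (i j : Fin 2) :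
    normalPart σ p (partialDeriv (partialDeriv (coordRep σ p) j) i
      (chartAt (EuclideanSpace ℝ (Fin 2)) p p)) =
      (G.p₁ (chartAt (EuclideanSpace ℝ (Fin 2)) p p) *
          (G.coframeMatrix (chartAt (EuclideanSpace ℝ (Fin 2)) p p) i 0 *
            G.coframeMatrix (chartAt (EuclideanSpace ℝ (Fin 2)) p p) j 0)
        + G.p₂ (chartAt (EuclideanSpace ℝ (Fin 2)) p p) *
          (G.coframeMatrix (chartAt (EuclideanSpace ℝ (Fin 2)) p p) i 1 *
            G.coframeMatrix (chartAt (EuclideanSpace ℝ (Fin 2)) p p) j 0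
          + G.coframeMatrix (chartAt (EuclideanSpace ℝ (Fin 2)) p p) i 0 *
            G.coframeMatrix (chartAt (EuclideanSpace ℝ (Fin 2)) p p) j 1)
        + G.p₃ (chartAt (EuclideanSpace ℝ (Fin 2)) p p) *
          (G.coframeMatrix (chartAt (EuclideanSpace ℝ (Fin 2)) p p) i 1 *
            G.coframeMatrix (chartAt (EuclideanSpace ℝ (Fin 2)) p p) j 1)) •
          G.a₁ (chartAt (EuclideanSpace ℝ (Fin 2)) p p)
      + (G.coframeMatrix (chartAt (EuclideanSpace ℝ (Fin 2)) p p) i 0 *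
            G.coframeMatrix (chartAt (EuclideanSpace ℝ (Fin 2)) p p) j 0
          - G.coframeMatrix (chartAt (EuclideanSpace ℝ (Fin 2)) p p) i 1 *
            G.coframeMatrix (chartAt (EuclideanSpace ℝ (Fin 2)) p p) j 1) •
          G.a₄ (chartAt (EuclideanSpace ℝ (Fin 2)) p p) := by
  rw [G.normalPart_eq hD hy h]
  generalize chartAt (EuclideanSpace ℝ (Fin 2)) p p = y at *
  have hpr := G.products hy
  have e1 : ∀ z ∈ D, partialDeriv (coordRep σ p) j z =
      G.α₂ z (EuclideanSpace.single j 1) • G.a₂ z + G.α₃ z (EuclideanSpace.single j 1) • G.a₃ z := by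
    intro z hz
    rw [partialDeriv, fderiv_eq_of_eqOn hD h hz, G.d_a₀ z hz]
  have d2 : DifferentiableAt ℝ (fun z => G.α₂ z (EuclideanSpace.single j 1)) y :=
    ((G.smooth_α₂ hD).differentiableAt_of_mem_isOpen hD hy).clm_apply (differentiableAt_const _)
  have d3 : DifferentiableAt ℝ (fun z => G.α₃ z (EuclideanSpace.single j 1)) y :=
    ((G.smooth_α₃ hD).differentiableAt_of_mem_isOpen hD hy).clm_apply (differentiableAt_const _)
  have da2 := G.smooth_a₂.differentiableAt_of_mem_isOpen hD hy
  have da3 := G.smooth_a₃.differentiableAt_of_mem_isOpen hD hy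
  rw [partialDeriv, fderiv_eq_of_eqOn hD e1 hy, fderiv_fun_add (d2.fun_smul da2) (d3.fun_smul da3),
    fderiv_fun_smul d2 da2, fderiv_fun_smul d3 da3]
  simp only [add_apply, smul_apply, ContinuousLinearMap.smulRight_apply, G.d_a₂ y hy, G.d_a₃ y hy,
    G.β₁_eq y hy, G.β₂_eq y hy, mink_add_left, mink_sub_left, mink_smul_left, hpr.m12, hpr.m13,
    hpr.m22, hpr.m23, hpr.m32, hpr.m33, hpr.m42, hpr.m43, smul_eq_mul, MovingFrame.coframeMatrix,
    Matrix.of_apply, Matrix.cons_val_zero, Matrix.cons_val_one]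
  module

/-- The mean curvature vector of the Gauss map is `½ P a₁`. -/
theorem MiddleFrame.meanCurvatureVec_eq (hU : IsOpen U) (F : MiddleFrame f n U) {p : M}
    (hp : p ∈ U) :
    meanCurvatureVec (gaussMap f n) p = ((F.p₁ p + F.p₃ p) / 2) • F.a₁ p := by
  obtain ⟨D, G, hD, hy, h, h1, -, -, h2, h3⟩ := F.chart_facts hU hp
  have hs := sum_gram_inv_mul (G.det_coframeMatrix_ne_zero hy)
  rw [meanCurvatureVec, G.inducedMetric_eq hD hy h]
  simp only [G.normalPart_partialDeriv hD hy h]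
  rw [h1, h2, h3]
  have h00 := hs 0 0
  have h01 := hs 0 1
  have h10 := hs 1 0
  have h11 := hs 1 1
  generalize (G.coframeMatrix _ * (G.coframeMatrix _).transpose)⁻¹ = g at *
  generalize G.coframeMatrix _ = A at *
  simp only [Fin.sum_univ_two, Matrix.one_apply, if_true] at h00 h01 h10 h11
  simp only [zero_ne_one, one_ne_zero, if_false] at h00 h01 h10 h11
  simp only [Fin.sum_univ_two]
  linear_combination (norm := module)
    ((F.p₁ p / 2) * h00 + (G.p₂ (chartAt (EuclideanSpace ℝ (Fin 2)) p p) / 2) * (h01 + h10)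
      + (F.p₃ p / 2) * h11) • F.a₁ p
      + (h00 / 2 - h11 / 2) • G.a₄ (chartAt (EuclideanSpace ℝ (Fin 2)) p p)

theorem MiddleFrame.normalPart_gaussMap (hU : IsOpen U) (F : MiddleFrame f n U) {p : M}
    (hp : p ∈ U) (w : Mink) :
    normalPart (gaussMap f n) p w =
      w - mink w (F.a₂ p) • F.a₂ p - mink w (F.a₃ p) • F.a₃ p := by
  obtain ⟨D, G, hD, hy, h, -, h2, h3, -⟩ := F.chart_facts hU hp
  rw [G.normalPart_eq hD hy h, h2, h3]

variable {E : Type*} [NormedAddCommGroup E] [NormedSpace ℝ E] {e : OpenPartialHomeomorph M E}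

theorem contMDiffOn_meanCurvatureVec (hU : IsOpen U) (F : MiddleFrame f n U) :
    ContMDiffOn (𝓡 2) 𝓘(ℝ, Mink) ∞ (meanCurvatureVec (gaussMap f n)) U := by
  have h : ContMDiffOn (𝓡 2) 𝓘(ℝ, ℝ) ∞ (fun p => (F.p₁ p + F.p₃ p) / 2) U :=
    (F.smooth_p₁.add F.smooth_p₃).div_const 2
  exact (h.smul F.smooth_a₁).congr fun p hp => F.meanCurvatureVec_eq hU hp

/-- The normal derivative of the mean curvature vector is `½ (dP + P τ) a₁`. -/
theorem normalPart_dAt_meanCurvatureVec (he : IsSmoothChart e) (hU : IsOpen U)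
    (F : MiddleFrame f n U) {y : E} (hy : y ∈ e.target ∩ e.symm ⁻¹' U) (Y : E) :
    normalPart (gaussMap f n) (e.symm y)
        (dAt (meanCurvatureVec (gaussMap f n)) (e.symm y) (dSymm e y Y)) =
      ((fderiv ℝ (he.pullback hU F).P y Y
        + (he.pullback hU F).P y * (he.pullback hU F).τ y Y) / 2) • F.a₁ (e.symm y) := by
  have hD := e.isOpen_inter_preimage_symm hU
  have hg : ∀ z ∈ e.target ∩ e.symm ⁻¹' U, (meanCurvatureVec (gaussMap f n) ∘ e.symm) z =
      ((he.pullback hU F).P z / 2) • (he.pullback hU F).a₁ z := fun z hz =>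
    F.meanCurvatureVec_eq hU hz.2
  rw [F.normalPart_gaussMap hU hy.2, ← he.fderiv_comp_symm hy.1
    ((contMDiffOn_meanCurvatureVec hU F).mdifferentiableAt_of_mem_isOpen hU hy.2),
    fderiv_eq_of_eqOn hD hg hy]
  change _ - mink _ ((he.pullback hU F).a₂ y) • (he.pullback hU F).a₂ y
    - mink _ ((he.pullback hU F).a₃ y) • (he.pullback hU F).a₃ y = _ • (he.pullback hU F).a₁ y
  generalize he.pullback hU F = G at *
  have hP := G.smooth_P.differentiableAt_of_mem_isOpen hD hy
  have hP2 : HasFDerivAt (fun z => G.P z / 2) ((2⁻¹ : ℝ) • fderiv ℝ G.P y) y := by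
    simpa [div_eq_mul_inv] using hP.hasFDerivAt.mul_const (2⁻¹ : ℝ)
  rw [fderiv_fun_smul hP2.differentiableAt (G.smooth_a₁.differentiableAt_of_mem_isOpen hD hy),
    hP2.fderiv]
  have hpr := G.products hy
  simp only [add_apply, smul_apply, ContinuousLinearMap.smulRight_apply, G.d_a₁ y hy,
    mink_add_left, mink_sub_left, mink_smul_left, hpr.m12, hpr.m13, hpr.m22, hpr.m23, hpr.m32,
    hpr.m33, smul_eq_mul]
  module

/-- If the mean curvature vector is parallel, then `dP + P τ = 0` for every middle frame. -/
theorem HasParallelMeanCurvature.isParallelAt (h : HasParallelMeanCurvature (gaussMap f n))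
    (he : IsSmoothChart e) (hU : IsOpen U) (F : MiddleFrame f n U) {y : E}
    (hy : y ∈ e.target ∩ e.symm ⁻¹' U) : (he.pullback hU F).IsParallelAt y := by
  intro Y
  have h1 := h.2 (e.symm y) (dSymm e y Y)
  rw [normalPart_dAt_meanCurvatureVec he hU F hy] at h1
  have hne : F.a₁ (e.symm y) ≠ 0 := by
    intro h0
    have := (F.frame _ hy.2).products.m14
    rw [h0, mink_zero_left] at this
    norm_num at this
  have := (smul_eq_zero.1 h1).resolve_right hne
  linarith

/-- The mean curvature vector is parallel if `dP + P τ = 0` near every point for some middle frame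
in some chart. -/
theorem hasParallelMeanCurvature_of_isParallelAt
    (h : ∀ p : M, ∃ (U : Set M) (hU : IsOpen U) (F : MiddleFrame f n U)
      (e : OpenPartialHomeomorph M E) (he : IsSmoothChart e),
      ∃ y ∈ e.target ∩ e.symm ⁻¹' U, e.symm y = p ∧ (he.pullback hU F).IsParallelAt y) :
    HasParallelMeanCurvature (gaussMap f n) := by
  constructor
  · intro p
    obtain ⟨U, hU, F, e, he, y, hy, rfl, -⟩ := h p
    exact (contMDiffOn_meanCurvatureVec hU F).contMDiffAt (hU.mem_nhds hy.2)
  · intro p X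
    obtain ⟨U, hU, F, e, he, y, hy, rfl, hp⟩ := h p
    obtain ⟨Y, rfl⟩ := he.dSymm_surjective hy.1 X
    rw [normalPart_dAt_meanCurvatureVec he hU F hy, hp Y]
    simp

end MeanCurvature

/-! ### Parallel mean curvature: consequences for the invariants -/

section ParallelFrames

variable {E : Type*} [NormedAddCommGroup E] [NormedSpace ℝ E] {D : Set E} (F : LocalFrame D)
  (hD : IsOpen D) (hpar : ∀ y ∈ D, F.IsParallelAt y)

include hD hpar

namespace LocalFrame

/-- By Gronwall's inequality the solution `P` of the linear equation `dP = -P τ` vanishes near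
each of its zeros. -/
theorem eventually_P_eq_zero {x : E} (hx : x ∈ D) (h0 : F.P x = 0) : ∀ᶠ y in nhds x, F.P y = 0 := by
  obtain ⟨r, hr, hball⟩ := Metric.isOpen_iff.1 hD x hx
  filter_upwards [Metric.ball_mem_nhds x hr] with y hy
  set γ : ℝ → E := fun t => x + t • (y - x) with hγ
  have hγD : ∀ t ∈ Set.Icc (0 : ℝ) 1, γ t ∈ D := fun t ht =>
    hball ((convex_ball x r).add_smul_sub_mem (Metric.mem_ball_self hr) hy ht)
  have hγd : ∀ t, HasDerivAt γ (y - x) t := fun t => by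
    have h1 := ((hasDerivAt_id t).smul_const (y - x)).const_add x
    rwa [one_smul] at h1
  have hγc : Continuous γ := by fun_prop
  have hder : ∀ t ∈ Set.Icc (0 : ℝ) 1,
      HasDerivAt (fun t => F.P (γ t)) (-(F.P (γ t) * F.τ (γ t) (y - x))) t := by
    intro t ht
    have h1 := (F.smooth_P.differentiableAt_of_mem_isOpen hD (hγD t ht)).hasFDerivAt.comp_hasDerivAt
      t (hγd t)
    rwa [eq_neg_of_add_eq_zero_left (hpar _ (hγD t ht) (y - x))] at h1
  have hτc : ContinuousOn (fun t => F.τ (γ t) (y - x)) (Set.Icc 0 1) :=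
    ((F.smooth_τ hD).continuousOn.comp hγc.continuousOn hγD).clm_apply continuousOn_const
  obtain ⟨K, hK⟩ := isCompact_Icc.exists_bound_of_continuousOn hτc
  have key := norm_le_gronwallBound_of_norm_deriv_right_le (f := fun t => F.P (γ t))
    (f' := fun t => -(F.P (γ t) * F.τ (γ t) (y - x))) (δ := 0) (K := K) (ε := 0) (a := 0) (b := 1)
    (fun t ht => (hder t ht).continuousAt.continuousWithinAt)
    (fun t ht => (hder t (Set.Ico_subset_Icc_self ht)).hasDerivWithinAt)
    (by simp [hγ, h0])
    (fun t ht => by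
      rw [norm_neg, norm_mul, mul_comm, add_zero]
      exact mul_le_mul_of_nonneg_right (hK t (Set.Ico_subset_Icc_self ht)) (norm_nonneg _))
    1 (by simp)
  rw [gronwallBound_ε0_δ0] at key
  simpa [hγ] using key

/-- If `P` does not vanish, then `τ = -d log |P|` is closed, which means `p₂ = 0`. -/
theorem p₂_eq_zero (hE : Module.finrank ℝ E = 2) {x : E} (hx : x ∈ D) (h0 : F.P x ≠ 0) :
    F.p₂ x = 0 := by
  obtain ⟨X₂, X₃, h⟩ := F.exists_isDualFrame hE hx
  have hτd := (F.smooth_τ hD).differentiableAt_of_mem_isOpen hD hx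
  have hPd := F.smooth_P.differentiableAt_of_mem_isOpen hD hx
  have e : ∀ y ∈ D, fderiv ℝ F.P y = -(F.P y • F.τ y) := by
    intro y hy
    ext Y
    exact eq_neg_of_add_eq_zero_left (hpar y hy Y)
  have h1 := fderiv_fderiv_symm (F.smooth_P.contDiffAt (hD.mem_nhds hx)) X₂ X₃
  rw [fderiv_eq_of_eqOn hD e hx, fderiv_fun_neg, fderiv_fun_smul hPd hτd, e x hx] at h1
  have h2 := (F.dext_dual hD hx h).2.2
  simp only [dext] at h2
  simp only [neg_apply, add_apply, smul_apply, ContinuousLinearMap.smulRight_apply,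
    smul_eq_mul] at h1
  have h3 : F.P x * F.p₂ x = 0 := by linear_combination -h1 / 2 - F.P x * h2 / 2
  exact (mul_eq_zero.1 h3).resolve_left h0

/-- If `P` does not vanish, then `½ (p₁ - p₃) / P²` has vanishing differential. -/
theorem hasFDerivAt_ratio (hE : Module.finrank ℝ E = 2) (hne : ∀ y ∈ D, F.P y ≠ 0) {x : E}
    (hx : x ∈ D) :
    HasFDerivAt (fun y => (F.p₁ y - F.p₃ y) / 2 / F.P y ^ 2) (0 : E →L[ℝ] ℝ) x := by
  obtain ⟨X₂, X₃, h⟩ := F.exists_isDualFrame hE hx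
  have hPd := F.smooth_P.differentiableAt_of_mem_isOpen hD hx
  have hp₁ := F.smooth_p₁.differentiableAt_of_mem_isOpen hD hx
  have hp₃ := F.smooth_p₃.differentiableAt_of_mem_isOpen hD hx
  have hp₂ : ∀ y ∈ D, F.p₂ y = (fun _ => (0 : ℝ)) y := fun y hy =>
    F.p₂_eq_zero hD hpar hE hy (hne y hy)
  obtain ⟨c1, c2⟩ := F.codazzi hD hx h
  rw [fderiv_eq_of_eqOn hD hp₂ hx, hp₂ x hx] at c1 c2
  obtain ⟨P2, P3⟩ := (F.isParallelAt_iff hx h).1 (hpar x hx)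
  have hPsum : fderiv ℝ F.P x = fderiv ℝ F.p₁ x + fderiv ℝ F.p₃ x :=
    (hp₁.hasFDerivAt.add hp₃.hasFDerivAt).fderiv
  rw [hPsum] at P2 P3
  simp only [add_apply, fderiv_fun_const, zero_apply, Pi.zero_apply] at c1 c2 P2 P3
  have hP : F.P x = F.p₁ x + F.p₃ x := rfl
  have hd : DifferentiableAt ℝ (fun y => (F.p₁ y - F.p₃ y) / 2 / F.P y ^ 2) x := by
    simp only [div_eq_mul_inv]
    have d1 : DifferentiableAt ℝ (fun y => (F.p₁ y - F.p₃ y) * 2⁻¹) x :=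
      (hp₁.fun_sub hp₃).mul_const (2⁻¹ : ℝ)
    have d2 : DifferentiableAt ℝ (fun y => F.P y ^ 2) x := hPd.fun_pow 2
    exact d1.fun_mul (d2.fun_inv (pow_ne_zero _ (hne x hx)))
  -- `u = (p₁ - p₃) / 2` solves `du = -2 u τ`, and `P²` solves the same equation.
  have hu : ∀ Y, fderiv ℝ F.p₁ x Y - fderiv ℝ F.p₃ x Y =
      -2 * (F.p₁ x - F.p₃ x) * F.τ x Y := by
    intro Y
    have hτ : F.τ x Y = 2 * F.q₂ x * F.α₂ x Y - 2 * F.q₁ x * F.α₃ x Y := by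
      rw [F.τ_eq x hx]
      simp only [add_apply, smul_apply, smul_eq_mul]
      ring
    rw [hτ]
    conv_lhs => rw [MovingFrame.eq_of_isDualFrame hx h Y]
    rw [map_add, map_add, map_smul, map_smul, map_smul, map_smul]
    simp only [smul_eq_mul]
    rw [hP] at P2 P3
    linear_combination F.α₂ x Y * (P2 - 2 * c2) + F.α₃ x Y * (-P3 - 2 * c1)
  have hz : fderiv ℝ (fun y => (F.p₁ y - F.p₃ y) / 2 / F.P y ^ 2) x = 0 := by
    have e1 : HasFDerivAt (fun y => (F.p₁ y - F.p₃ y) / 2)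
        ((2⁻¹ : ℝ) • (fderiv ℝ F.p₁ x - fderiv ℝ F.p₃ x)) x := by
      simpa [div_eq_mul_inv] using (hp₁.hasFDerivAt.sub hp₃.hasFDerivAt).mul_const (2⁻¹ : ℝ)
    have e2 : HasFDerivAt (fun y => F.P y ^ 2) ((2 * F.P x) • fderiv ℝ F.P x) x := by
      simpa using hPd.hasFDerivAt.pow 2
    have e3 : (fun y => (F.p₁ y - F.p₃ y) / 2) =ᶠ[nhds x]
        fun y => (F.p₁ y - F.p₃ y) / 2 / F.P y ^ 2 * F.P y ^ 2 :=
      Filter.eventually_of_mem (hD.mem_nhds hx) fun y hy =>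
        (div_mul_cancel₀ _ (pow_ne_zero _ (hne y hy))).symm
    have e4 := e3.fderiv_eq (𝕜 := ℝ)
    rw [e1.fderiv, (hd.hasFDerivAt.fun_mul e2).fderiv] at e4
    ext Y
    have e5 := congrArg (fun T : E →L[ℝ] ℝ => T Y) e4
    simp only [add_apply, smul_apply, sub_apply, smul_eq_mul, hu Y,
      eq_neg_of_add_eq_zero_left (hpar x hx Y)] at e5
    have hne' := pow_ne_zero 2 (hne x hx)
    have e6 : (F.p₁ x - F.p₃ x) / 2 / F.P x ^ 2 * F.P x ^ 2 = (F.p₁ x - F.p₃ x) / 2 :=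
      div_mul_cancel₀ _ hne'
    rw [zero_apply]
    apply (mul_eq_zero.1 _).resolve_left hne'
    linear_combination -e5 + 2 * F.τ x Y * e6
  rw [← hz]
  exact hd.hasFDerivAt

end LocalFrame

end ParallelFrames

/-! ### Charts composed with local diffeomorphisms -/

section Charts

variable {M : Type*} [TopologicalSpace M] [ChartedSpace (EuclideanSpace ℝ (Fin 2)) M]
variable {E : Type*} [NormedAddCommGroup E] [NormedSpace ℝ E] [CompleteSpace E]
variable {E' : Type*} [NormedAddCommGroup E'] [NormedSpace ℝ E']

omit [CompleteSpace E] in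
theorem exists_continuousLinearEquiv [FiniteDimensional ℝ E]
    (hE : Module.finrank ℝ E = Module.finrank ℝ E') [FiniteDimensional ℝ E'] (L : E →L[ℝ] E')
    (hL : ∀ X, L X = 0 → X = 0) : ∃ T : E ≃L[ℝ] E', (T : E →L[ℝ] E') = L := by
  refine ⟨(LinearEquiv.ofInjectiveOfFinrankEq L.toLinearMap
    ((injective_iff_map_eq_zero _).2 hL) hE).toContinuousLinearEquiv, ?_⟩
  ext X
  rfl

/-- A chart followed by a smooth map with invertible differential is a chart on a neighbourhood of
any given point, by the inverse function theorem. -/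
theorem IsSmoothChart.exists_comp {z : OpenPartialHomeomorph M E} (hz : IsSmoothChart z)
    {g : E → E'} {D : Set E} (hD : IsOpen D) (hDz : D ⊆ z.target) (hg : ContDiffOn ℝ ∞ g D)
    (hinv : ∀ y ∈ D, ∃ T : E ≃L[ℝ] E', (T : E →L[ℝ] E') = fderiv ℝ g y) {y₀ : E} (hy₀ : y₀ ∈ D) :
    ∃ z' : OpenPartialHomeomorph M E', IsSmoothChart z' ∧ z.symm y₀ ∈ z'.source ∧
      z'.source ⊆ z.source ∧ (∀ q ∈ z'.source, z q ∈ D) ∧ ∀ q, z' q = g (z q) := by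
  have hgA : ∀ y ∈ D, ContDiffAt ℝ ∞ g y := fun y hy => hg.contDiffAt (hD.mem_nhds hy)
  have hgd : ∀ y ∈ D, ∀ T : E ≃L[ℝ] E', (T : E →L[ℝ] E') = fderiv ℝ g y →
      HasFDerivAt g (T : E →L[ℝ] E') y := by
    intro y hy T hT
    rw [hT]
    exact ((hgA y hy).differentiableAt (by simp)).hasFDerivAt
  obtain ⟨T₀, hT₀⟩ := hinv y₀ hy₀
  let Φ := ((hgA y₀ hy₀).toOpenPartialHomeomorph g (hgd y₀ hy₀ T₀ hT₀) (by simp)).restrOpen D hD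
  have hΦ : ∀ y, Φ y = g y := fun y => rfl
  have hΦy₀ : y₀ ∈ Φ.source :=
    ⟨(hgA y₀ hy₀).mem_toOpenPartialHomeomorph_source (hgd y₀ hy₀ T₀ hT₀) (by simp), hy₀⟩
  have hΦD : Φ.source ⊆ D := fun y hy => hy.2
  have hΦs : ContDiffOn ℝ ∞ Φ.symm Φ.target := by
    intro w hw
    have hy := hΦD (Φ.map_target hw)
    obtain ⟨T, hT⟩ := hinv _ hy
    exact (Φ.contDiffAt_symm hw (hgd _ hy T hT) (hgA _ hy)).contDiffWithinAt
  refine ⟨z.trans Φ, ⟨?_, ?_⟩, ?_, ?_, ?_, fun q => rfl⟩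
  · rw [OpenPartialHomeomorph.trans_source]
    exact (contMDiffOn_iff_contDiffOn.2 (hg.mono hΦD) : ContMDiffOn 𝓘(ℝ, E) 𝓘(ℝ, E') ∞ g
      Φ.source).comp (hz.1.mono Set.inter_subset_left) fun q hq => hq.2
  · rw [OpenPartialHomeomorph.trans_target]
    exact hz.2.comp (contMDiffOn_iff_contDiffOn.2 (hΦs.mono Set.inter_subset_left))
      fun q hq => hq.2
  · rw [OpenPartialHomeomorph.trans_source]
    refine ⟨z.map_target (hDz hy₀), ?_⟩
    rw [Set.mem_preimage, z.right_inv (hDz hy₀)]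
    exact hΦy₀
  · rw [OpenPartialHomeomorph.trans_source]
    exact Set.inter_subset_left
  · intro q hq
    rw [OpenPartialHomeomorph.trans_source] at hq
    exact hΦD hq.2

end Charts

/-! ### Holomorphic quartic differentials -/

section Holomorphic

variable {M : Type*} [TopologicalSpace M] [ChartedSpace (EuclideanSpace ℝ (Fin 2)) M]
  {f n : M → E3} {U V : Set M}

/-- The restriction of a middle frame field to a smaller set. -/
def MiddleFrame.mono (F : MiddleFrame f n U) (h : V ⊆ U) : MiddleFrame f n V :=
  { F with
    smooth_a₀ := F.smooth_a₀.mono h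
    smooth_a₁ := F.smooth_a₁.mono h
    smooth_a₂ := F.smooth_a₂.mono h
    smooth_a₃ := F.smooth_a₃.mono h
    smooth_a₄ := F.smooth_a₄.mono h
    smooth_p₁ := F.smooth_p₁.mono h
    smooth_p₂ := F.smooth_p₂.mono h
    smooth_p₃ := F.smooth_p₃.mono h
    smooth_q₁ := F.smooth_q₁.mono h
    smooth_q₂ := F.smooth_q₂.mono h
    frame := fun x hx => F.frame x (h hx)
    along := fun x hx => F.along x (h hx)
    coframe := fun x hx => F.coframe x (h hx)
    d_a₀ := fun x hx => F.d_a₀ x (h hx)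
    d_a₁ := fun x hx => F.d_a₁ x (h hx)
    d_a₂ := fun x hx => F.d_a₂ x (h hx)
    d_a₃ := fun x hx => F.d_a₃ x (h hx)
    d_a₄ := fun x hx => F.d_a₄ x (h hx) }

theorem IsComplexCoord.restr {z : OpenPartialHomeomorph M ℂ} (hz : IsComplexCoord f n z)
    (hU : IsOpen U) : IsComplexCoord f n (z.restrOpen U hU) :=
  ⟨IsSmoothChart.restr hz.1 hU, fun p hp => hz.2 p hp.1⟩

omit [ChartedSpace (EuclideanSpace ℝ (Fin 2)) M] in
theorem mem_pullback_domain {E : Type*} [TopologicalSpace E] {z : OpenPartialHomeomorph M E} {y : E}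
    (hy : y ∈ z.target) : y ∈ z.target ∩ z.symm ⁻¹' z.source := ⟨hy, z.map_target hy⟩

/-- A middle frame field on the domain of a chart, in this chart. -/
def MiddleFrame.inChart {E : Type*} [NormedAddCommGroup E] [NormedSpace ℝ E]
    {z : OpenPartialHomeomorph M E} (F : MiddleFrame f n z.source) (hz : IsSmoothChart z) :
    LocalFrame z.target :=
  (hz.pullback z.open_source F).mono fun _ hy => mem_pullback_domain hy

variable [IsManifold (𝓡 2) ∞ M]

theorem IsComplexCoord.inChart_isConformal {z : OpenPartialHomeomorph M ℂ}
    (hz : IsComplexCoord f n z) (F : MiddleFrame f n z.source) :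
    (F.inChart hz.1).IsConformal := fun y hy X =>
  hz.isConformal z.open_source F y (mem_pullback_domain hy) X

theorem quarticDiff_inChart {z : OpenPartialHomeomorph M ℂ} (hz : IsComplexCoord f n z)
    (F : MiddleFrame f n z.source) {y : ℂ} (hy : y ∈ z.target) (X : ℂ) :
    quarticDiff f n (z.symm y) (dSymm z y X) =
      (F.inChart hz.1).Q y * (F.inChart hz.1).lam y ^ 4 * X ^ 4 :=
  quarticDiff_dSymm hz.1 z.open_source F (hz.isConformal z.open_source F) (mem_pullback_domain hy) X

theorem quadraticDiff_inChart {z : OpenPartialHomeomorph M ℂ} (hz : IsComplexCoord f n z)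
    (F : MiddleFrame f n z.source) {y : ℂ} (hy : y ∈ z.target) (X : ℂ) :
    quadraticDiff f n (z.symm y) (dSymm z y X) =
      ((F.inChart hz.1).P y : ℂ) * (F.inChart hz.1).lam y ^ 2 * X ^ 2 :=
  quadraticDiff_dSymm hz.1 z.open_source F (hz.isConformal z.open_source F)
    (mem_pullback_domain hy) X

omit [IsManifold (𝓡 2) ∞ M] in
/-- A coefficient function in one complex coordinate around every point, described through the
inverse of the coordinate, makes a differential holomorphic. -/
theorem isHolomorphicDiff_of_dSymm {k : ℕ} {η : (p : M) → TangentSpace (𝓡 2) p → ℂ}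
    (h : ∀ p : M, ∃ (z : OpenPartialHomeomorph M ℂ) (_ : IsComplexCoord f n z) (g : ℂ → ℂ),
      p ∈ z.source ∧ DifferentiableOn ℂ g z.target ∧
        ∀ y ∈ z.target, ∀ X : ℂ, η (z.symm y) (dSymm z y X) = g y * X ^ k) :
    IsHolomorphicDiff f n k η := by
  intro p
  obtain ⟨z, hz, g, hp, hg, he⟩ := h p
  refine ⟨z, hp, hz, g, hg, fun q hq X => ?_⟩
  obtain ⟨y, hy, rfl⟩ : ∃ y ∈ z.target, z.symm y = q := ⟨z q, z.map_source hq, z.left_inv hq⟩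
  have hz' : IsSmoothChart z := hz.1
  obtain ⟨Y, rfl⟩ := hz'.dSymm_surjective hy X
  rw [he y hy, hz'.dAt_dSymm hy, z.right_inv hy]

/-- If `𝒬_F` is holomorphic, then every point has a complex coordinate with a middle frame field on
its domain that satisfies `dP + P τ = 0`. -/
theorem IsHolomorphicDiff.exists_parallel_frame
    (h : IsHolomorphicDiff f n 4 (quarticDiff f n)) (p : M) :
    ∃ (z : OpenPartialHomeomorph M ℂ) (hz : IsComplexCoord f n z) (F : MiddleFrame f n z.source),
      p ∈ z.source ∧ ∀ y ∈ z.target, (F.inChart hz.1).IsParallelAt y := by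
  obtain ⟨z₀, hp, hz₀, g, hg, he⟩ := h p
  obtain ⟨U, hU, hpU, ⟨F₀⟩⟩ := hz₀.hasMiddleFrameAt hp
  obtain ⟨z, hz, hpz, hzU, hsub, hval⟩ : ∃ z : OpenPartialHomeomorph M ℂ, IsComplexCoord f n z ∧
      p ∈ z.source ∧ z.source ⊆ U ∧ z.target ⊆ z₀.target ∧
      ∀ y ∈ z.target, ∀ X : TangentSpace (𝓡 2) (z.symm y),
        quarticDiff f n (z.symm y) X = g y * dAt z (z.symm y) X ^ 4 := by
    refine ⟨z₀.restrOpen U hU, hz₀.restr hU, ⟨hp, hpU⟩, fun q hq => hq.2, fun y hy => hy.1,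
      fun y hy X => ?_⟩
    have h1 := he _ ((z₀.restrOpen U hU).map_target hy).1 X
    rwa [show z₀ ((z₀.restrOpen U hU).symm y) = y from z₀.right_inv hy.1] at h1
  refine ⟨z, hz, F₀.mono hzU, hpz, ?_⟩
  have hz' : IsSmoothChart z := hz.1
  have hopen := z.open_target
  intro y hy
  rw [← (LocalFrame.differentiableAt_Q_mul_iff _ hopen hy (hz.inChart_isConformal (F₀.mono hzU)))]
  have hgy : DifferentiableAt ℂ g y :=
    (hg.mono hsub).differentiableAt (hopen.mem_nhds hy)
  refine hgy.congr_of_eventuallyEq (Filter.eventually_of_mem (hopen.mem_nhds hy) fun w hw => ?_)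
  have h1 := hval w hw (dSymm z w 1)
  rw [hz'.dAt_dSymm hw, quarticDiff_inChart hz (F₀.mono hzU) hw] at h1
  simpa using h1

/-- If complex coordinates with middle frame fields exist and the mean curvature vector of the
Gauss map is parallel, then `𝒬_F` is holomorphic. -/
theorem isHolomorphicDiff_quarticDiff
    (hex : ∀ p : M, ∃ (z : OpenPartialHomeomorph M ℂ) (_ : IsComplexCoord f n z)
      (_ : MiddleFrame f n z.source), p ∈ z.source)
    (h : HasParallelMeanCurvature (gaussMap f n)) :
    IsHolomorphicDiff f n 4 (quarticDiff f n) := by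
  refine isHolomorphicDiff_of_dSymm fun p => ?_
  obtain ⟨z, hz, F, hp⟩ := hex p
  refine ⟨z, hz, _, hp, fun y hy => ?_, fun y hy X => quarticDiff_inChart hz F hy X⟩
  exact ((LocalFrame.differentiableAt_Q_mul_iff _ z.open_target hy
    (hz.inChart_isConformal F)).2
    (h.isParallelAt hz.1 z.open_source F (mem_pullback_domain hy))).differentiableWithinAt

theorem IsHolomorphicDiff.hasParallelMeanCurvature
    (h : IsHolomorphicDiff f n 4 (quarticDiff f n)) : HasParallelMeanCurvature (gaussMap f n) := by
  refine hasParallelMeanCurvature_of_isParallelAt (E := ℂ) fun p => ?_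
  obtain ⟨z, hz, F, hp, hpar⟩ := h.exists_parallel_frame p
  exact ⟨z.source, z.open_source, F, z, hz.1, z p, mem_pullback_domain (z.map_source hp),
    z.left_inv hp, hpar _ (z.map_source hp)⟩

theorem IsHolomorphicDiff.quadraticDiff
    (h : IsHolomorphicDiff f n 4 (quarticDiff f n)) :
    IsHolomorphicDiff f n 2 (quadraticDiff f n) := by
  refine isHolomorphicDiff_of_dSymm fun p => ?_
  obtain ⟨z, hz, F, hp, hpar⟩ := h.exists_parallel_frame p
  refine ⟨z, hz, _, hp, fun y hy => ?_, fun y hy X => quadraticDiff_inChart hz F hy X⟩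
  exact (LocalFrame.differentiableAt_P_mul _ z.open_target hy (hz.inChart_isConformal F)
    (hpar y hy)).differentiableWithinAt

theorem MiddleFrame.invP_symm {z : OpenPartialHomeomorph M ℂ} (hz : IsSmoothChart z)
    (F : MiddleFrame f n z.source) {y : ℂ} (hy : y ∈ z.target) :
    invP f n (z.symm y) = (F.inChart hz).P y :=
  F.invP_eq z.open_source (z.map_target hy)

/-- On a connected surface `P` vanishes nowhere or identically, because its zero set is open and
closed. -/
theorem IsHolomorphicDiff.invP_ne_zero [ConnectedSpace M]
    (h : IsHolomorphicDiff f n 4 (quarticDiff f n))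
    (hne : ∃ (p : M) (X : TangentSpace (𝓡 2) p), Laguerre.quadraticDiff f n p X ≠ 0) (p : M) :
    invP f n p ≠ 0 := by
  have hclopen : IsClopen {p : M | invP f n p = 0} := by
    constructor
    · refine isClosed_singleton.preimage (continuous_iff_continuousAt.2 fun p => ?_)
      obtain ⟨z, hz, F, hp, -⟩ := h.exists_parallel_frame p
      have hc : ContinuousAt (fun q => F.p₁ q + F.p₃ q) p :=
        (F.smooth_p₁.continuousOn.add F.smooth_p₃.continuousOn).continuousAt
          (z.open_source.mem_nhds hp)
      exact hc.congr (Filter.eventually_of_mem (z.open_source.mem_nhds hp) fun q hq =>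
        (F.invP_eq z.open_source hq).symm)
    · rw [isOpen_iff_mem_nhds]
      intro p hp0
      obtain ⟨z, hz, F, hp, hpar⟩ := h.exists_parallel_frame p
      have hy := z.map_source hp
      have h0 : (F.inChart hz.1).P (z p) = 0 := by
        rw [← F.invP_symm hz.1 hy, z.left_inv hp]
        exact hp0
      have hev := (F.inChart hz.1).eventually_P_eq_zero z.open_target hpar hy h0
      filter_upwards [(z.continuousAt hp).eventually hev, z.open_source.mem_nhds hp] with q hq hqs
      rw [← z.left_inv hqs, F.invP_symm hz.1 (z.map_source hqs), hq]
  rcases isClopen_iff.1 hclopen with h0 | h1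
  · intro hp
    have : p ∈ {p : M | invP f n p = 0} := hp
    rw [h0] at this
    exact this
  · exfalso
    obtain ⟨q, X, hX⟩ := hne
    have hq : q ∈ {p : M | invP f n p = 0} := by rw [h1]; trivial
    apply hX
    rw [Laguerre.quadraticDiff, show invP f n q = 0 from hq]
    simp

/-- If `P` has no zeros, then `Q` is a constant real multiple of `P²`: the quotient is real because
`p₂ = 0`, and locally constant by `hasFDerivAt_ratio`. -/
theorem IsHolomorphicDiff.exists_invQ_eq [ConnectedSpace M]
    (h : IsHolomorphicDiff f n 4 (quarticDiff f n)) (hP : ∀ p, invP f n p ≠ 0) :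
    ∃ c : ℝ, ∀ p : M, invQ f n p = (c : ℂ) * (invP f n p : ℂ) ^ 2 := by
  have hE : Module.finrank ℝ ℂ = 2 := Complex.finrank_real_complex
  have hlc : IsLocallyConstant fun p => (invQ f n p).re / invP f n p ^ 2 := by
    rw [IsLocallyConstant.iff_eventually_eq]
    intro p
    obtain ⟨z, hz, F, hp, hpar⟩ := h.exists_parallel_frame p
    have hy := z.map_source hp
    have hne : ∀ y ∈ z.target, (F.inChart hz.1).P y ≠ 0 := fun y hy => by
      rw [← F.invP_symm hz.1 hy]
      exact hP _
    have hval : ∀ q ∈ z.source, (invQ f n q).re / invP f n q ^ 2 =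
        ((F.inChart hz.1).p₁ (z q) - (F.inChart hz.1).p₃ (z q)) / 2 /
          (F.inChart hz.1).P (z q) ^ 2 := by
      intro q hq
      rw [← F.invP_symm hz.1 (z.map_source hq), z.left_inv hq, F.invQ_eq z.open_source hq]
      have e1 : (F.inChart hz.1).p₁ (z q) = F.p₁ q := congrArg F.p₁ (z.left_inv hq)
      have e3 : (F.inChart hz.1).p₃ (z q) = F.p₃ q := congrArg F.p₃ (z.left_inv hq)
      rw [e1, e3]
      congr 1
      simp
    obtain ⟨r, hr, hball⟩ := Metric.isOpen_iff.1 z.open_target _ hy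
    filter_upwards [(z.continuousAt hp).preimage_mem_nhds (Metric.ball_mem_nhds _ hr),
      z.open_source.mem_nhds hp] with q hq hqs
    rw [hval q hqs, hval p hp]
    have hd := fun y (hy : y ∈ Metric.ball (z p) r) =>
      (F.inChart hz.1).hasFDerivAt_ratio z.open_target hpar hE hne (hball hy)
    exact (convex_ball (z p) r).is_const_of_fderivWithin_eq_zero (𝕜 := ℝ)
      (fun y hy => (hd y hy).differentiableAt.differentiableWithinAt)
      (fun y hy => by
        rw [fderivWithin_of_isOpen Metric.isOpen_ball hy, (hd y hy).fderiv])
      hq (Metric.mem_ball_self hr)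
  obtain ⟨p₀⟩ : Nonempty M := inferInstance
  refine ⟨(invQ f n p₀).re / invP f n p₀ ^ 2, fun p => ?_⟩
  have hc := hlc.apply_eq_of_preconnectedSpace p₀ p
  rw [hc]
  obtain ⟨z, hz, F, hp, hpar⟩ := h.exists_parallel_frame p
  have hy := z.map_source hp
  have h2 : F.p₂ p = 0 := by
    have h3 := (F.inChart hz.1).p₂_eq_zero z.open_target hpar hE hy (by
      rw [← F.invP_symm hz.1 hy]
      exact hP _)
    rwa [show (F.inChart hz.1).p₂ (z p) = F.p₂ p from congrArg F.p₂ (z.left_inv hp)] at h3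
  have him : invQ f n p = ((invQ f n p).re : ℂ) := by
    apply Complex.ext
    · simp
    · rw [F.invQ_eq z.open_source hp, h2]
      simp
  have hPc : (invP f n p : ℂ) ≠ 0 := by exact_mod_cast hP p
  rw [him]
  simp only [Complex.ofReal_re]
  push_cast
  field_simp

end Holomorphic

/-! ### L-isothermic coordinates -/

section LIsothermic

open Complex

/-- A holomorphic function without zeros has, near every point, a square root that is itself the
derivative of a holomorphic function. -/
theorem exists_primitive_sqrt {h : ℂ → ℂ} {D : Set ℂ} (hD : IsOpen D) (hh : DifferentiableOn ℂ h D)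
    {y₀ : ℂ} (hy₀ : y₀ ∈ D) (h0 : h y₀ ≠ 0) :
    ∃ (r : ℝ) (s ζ : ℂ → ℂ), 0 < r ∧ Metric.ball y₀ r ⊆ D ∧
      ∀ y ∈ Metric.ball y₀ r, s y ^ 2 = h y ∧ s y ≠ 0 ∧ HasDerivAt ζ (s y) y := by
  have hc : ContinuousAt (fun y => h y / h y₀) y₀ :=
    (hh.continuousOn.continuousAt (hD.mem_nhds hy₀)).div_const _
  have hev : ∀ᶠ y in nhds y₀, h y / h y₀ ∈ slitPlane :=
    hc.eventually (isOpen_slitPlane.mem_nhds (by simp [div_self h0]))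
  obtain ⟨r, hr, hball⟩ := Metric.eventually_nhds_iff_ball.1 (hev.and (hD.mem_nhds hy₀))
  obtain ⟨w, hw⟩ : ∃ w : ℂ, w ^ 2 = h y₀ := IsAlgClosed.exists_pow_nat_eq _ two_pos
  have hw0 : w ≠ 0 := by
    rintro rfl
    exact h0 (by simpa using hw.symm)
  have hsd : DifferentiableOn ℂ (fun y => exp (log (h y / h y₀) / 2) * w) (Metric.ball y₀ r) :=
    (((((hh.mono fun y hy => (hball y hy).2).div_const _).clog fun y hy =>
      (hball y hy).1).div_const 2).cexp).mul_const w
  obtain ⟨ζ, hζ⟩ := hsd.isExactOn_ball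
  refine ⟨r, _, ζ, hr, fun y hy => (hball y hy).2, fun y hy => ⟨?_, ?_, hζ y hy⟩⟩
  · have hne : h y / h y₀ ≠ 0 := slitPlane_ne_zero (hball y hy).1
    rw [mul_pow, hw, ← exp_nat_mul]
    rw [show ((2 : ℕ) : ℂ) * (log (h y / h y₀) / 2) = log (h y / h y₀) by push_cast; ring,
      exp_log hne, div_mul_cancel₀ _ h0]
  · exact mul_ne_zero (exp_ne_zero _) hw0

variable {M : Type*} [TopologicalSpace M] [ChartedSpace (EuclideanSpace ℝ (Fin 2)) M]
  [IsManifold (𝓡 2) ∞ M] {f n : M → E3}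

/-- Where `P` has no zeros, the coordinate `ζ` with `dζ² = P φ²` is L-isothermic. -/
theorem IsHolomorphicDiff.isLIsothermic (h : IsHolomorphicDiff f n 4 (quarticDiff f n))
    (hP : ∀ p, invP f n p ≠ 0) : IsLIsothermic f n := by
  intro p
  obtain ⟨z, hz, F, hp, hpar⟩ := h.exists_parallel_frame p
  have hz' : IsSmoothChart z := hz.1
  have hc := hz.inChart_isConformal F
  have hh : DifferentiableOn ℂ (fun y => ((F.inChart hz.1).P y : ℂ) * (F.inChart hz.1).lam y ^ 2)
      z.target := fun y hy =>
    (LocalFrame.differentiableAt_P_mul _ z.open_target hy hc (hpar y hy)).differentiableWithinAt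
  have hPy : ∀ y ∈ z.target, (F.inChart hz.1).P y ≠ 0 := fun y hy => by
    rw [← F.invP_symm hz.1 hy]
    exact hP _
  have hne : ∀ y ∈ z.target, ((F.inChart hz.1).P y : ℂ) * (F.inChart hz.1).lam y ^ 2 ≠ 0 :=
    fun y hy => mul_ne_zero (by exact_mod_cast hPy y hy)
      (pow_ne_zero _ (MovingFrame.lam_ne_zero _ hy hc))
  obtain ⟨r, s, ζ, hr, hball, hs⟩ := exists_primitive_sqrt z.open_target hh (z.map_source hp)
    (hne _ (z.map_source hp))
  have hζd : ∀ y ∈ Metric.ball (z p) r, ∀ X, fderiv ℝ ζ y X = s y * X := by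
    intro y hy X
    rw [((hs y hy).2.2.hasFDerivAt.restrictScalars ℝ).fderiv]
    simp [mul_comm]
  have hζs : ContDiffOn ℝ ∞ ζ (Metric.ball (z p) r) :=
    (DifferentiableOn.contDiffOn (n := ∞) (fun y hy =>
      (hs y hy).2.2.differentiableAt.differentiableWithinAt) Metric.isOpen_ball).restrict_scalars ℝ
  obtain ⟨z', hz's, hpz', hsub, hzD, hval⟩ := hz'.exists_comp Metric.isOpen_ball hball hζs
    (fun y hy => exists_continuousLinearEquiv rfl _ fun X hX => by
      rw [hζd y hy] at hX
      exact (mul_eq_zero.1 hX).resolve_left (hs y hy).2.1) (Metric.mem_ball_self hr)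
  rw [z.left_inv hp] at hpz'
  -- `⟨da₀, da₀⟩ = |φ|² = |P|⁻¹ |dζ|²` and `⟨da₀, da₁⟩ = Re φ² = P⁻¹ Re dζ²`.
  refine ⟨z', hpz', hz's, fun q => |invP f n q|⁻¹, fun q => (invP f n q)⁻¹,
    fun q => -(invP f n q)⁻¹, fun q hq => ⟨inv_pos.2 (abs_pos.2 (hP q)), fun X => ?_⟩⟩
  have hqD := hzD q hq
  have hqs := hsub hq
  obtain ⟨y, hy, rfl⟩ : ∃ y ∈ z.target, z.symm y = q := ⟨z q, z.map_source hqs, z.left_inv hqs⟩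
  obtain ⟨Y, rfl⟩ := hz'.dSymm_surjective hy X
  rw [z.right_inv hy] at hqD
  have hdz' : dAt z' (z.symm y) (dSymm z y Y) = s y * Y := by
    have hfun : (z' : M → ℂ) = ζ ∘ z := funext hval
    rw [← hz'.fderiv_comp_symm hy (hz's.mdifferentiableAt hq), ← hζd y hqD]
    have : (z' ∘ z.symm) =ᶠ[nhds y] ζ :=
      Filter.eventually_of_mem (z.open_target.mem_nhds hy) fun w hw => by
        rw [hfun]
        simp [z.right_inv hw]
    rw [this.fderiv_eq]
  have hgauss : ∀ w ∈ z.target, (gaussMap f n ∘ z.symm) w = (F.inChart hz.1).a₀ w := fun w hw =>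
    F.gaussMap_eq z.open_source (z.map_target hw)
  have hnormal : ∀ w ∈ z.target, (normalVec f n ∘ z.symm) w = (F.inChart hz.1).a₁ w := fun w hw =>
    F.normalVec_eq z.open_source (z.map_target hw)
  have hmg : MDifferentiableAt (𝓡 2) 𝓘(ℝ, Mink) (gaussMap f n) (z.symm y) :=
    (F.smooth_a₀.congr fun q hq => F.gaussMap_eq z.open_source hq).mdifferentiableAt_of_mem_isOpen
      z.open_source (z.map_target hy)
  have hmn : MDifferentiableAt (𝓡 2) 𝓘(ℝ, Mink) (normalVec f n) (z.symm y) :=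
    (F.smooth_a₁.congr fun q hq => F.normalVec_eq z.open_source hq).mdifferentiableAt_of_mem_isOpen
      z.open_source (z.map_target hy)
  rw [hdz', ← hz'.fderiv_comp_symm hy hmg, ← hz'.fderiv_comp_symm hy hmn,
    fderiv_eq_of_eqOn z.open_target hgauss hy, fderiv_eq_of_eqOn z.open_target hnormal hy]
  beta_reduce
  rw [F.invP_symm hz.1 hy]
  have hs2 := (hs y hqD).1
  have hPy' := hPy y hy
  have hcY := hc y hy Y
  generalize F.inChart hz.1 = G at *
  have hpr := G.products hy
  rw [G.d_a₀ y hy, G.d_a₁ y hy]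
  simp only [mink_add_left, mink_add_right, mink_sub_right, mink_smul_left, mink_smul_right,
    hpr.m21, hpr.m22, hpr.m23, hpr.m31, hpr.m32, hpr.m33]
  have hsq : (s y * Y) ^ 2 = (G.P y : ℂ) * ((G.α₂ y Y : ℂ) + I * (G.α₃ y Y : ℂ)) ^ 2 := by
    rw [mul_pow, hs2, hcY]
    ring
  generalize s y * Y = w at hsq ⊢
  have hre := congrArg Complex.re hsq
  have hnorm := congrArg Complex.normSq hsq
  rw [map_pow normSq w, map_mul, map_pow] at hnorm
  have hre' : w.re ^ 2 - w.im ^ 2 = G.P y * (G.α₂ y Y ^ 2 - G.α₃ y Y ^ 2) := by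
    simp [pow_two] at hre
    linarith
  have hn' : w.re ^ 2 + w.im ^ 2 = |G.P y| * (G.α₂ y Y ^ 2 + G.α₃ y Y ^ 2) := by
    have hA : normSq w = w.re ^ 2 + w.im ^ 2 := by rw [normSq_apply]; ring
    have hB : normSq ((G.α₂ y Y : ℂ) + I * (G.α₃ y Y : ℂ)) = G.α₂ y Y ^ 2 + G.α₃ y Y ^ 2 := by
      rw [normSq_apply]
      simp
      ring
    rw [hA, hB, normSq_ofReal, ← abs_mul_abs_self, ← pow_two, ← mul_pow] at hnorm
    exact (pow_left_inj₀ (by positivity) (by positivity) two_ne_zero).1 hnorm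
  constructor
  · rw [hn', inv_mul_cancel_left₀ (abs_ne_zero.2 hPy')]
    ring
  · have : (G.P y)⁻¹ * w.re ^ 2 + -(G.P y)⁻¹ * w.im ^ 2 =
        (G.P y)⁻¹ * (w.re ^ 2 - w.im ^ 2) := by ring
    rw [this, hre', inv_mul_cancel_left₀ hPy']
    ring

end LIsothermic

/-! ### Constructing moving frames -/

section Construction

variable {E : Type*} [NormedAddCommGroup E] [NormedSpace ℝ E]

theorem mink_fderiv_add_eq_zero {D : Set E} (hD : IsOpen D) {g h : E → Mink} {c : ℝ}
    (hg : ContDiffOn ℝ ∞ g D) (hh : ContDiffOn ℝ ∞ h D) (hc : ∀ x ∈ D, mink (g x) (h x) = c)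
    {x : E} (hx : x ∈ D) (X : E) :
    mink (fderiv ℝ g x X) (h x) = -mink (fderiv ℝ h x X) (g x) := by
  have h1 := fderiv_mink (hg.differentiableAt_of_mem_isOpen hD hx)
    (hh.differentiableAt_of_mem_isOpen hD hx) X
  rw [fderiv_eq_of_eqOn (h := fun _ => c) hD hc hx] at h1
  simp only [fderiv_fun_const, Pi.zero_apply, zero_apply] at h1
  rw [mink_comm (g x)] at h1
  linarith

/-- The first two structure equations and the orthonormality relations of a field of Laguerre
frames imply the remaining ones. -/
def MovingFrame.ofLaguerre {D : Set E} (hD : IsOpen D) (a₀ a₁ a₂ a₃ a₄ : E → Mink)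
    (α₂ α₃ τ : E → E →L[ℝ] ℝ) (s₀ : ContDiffOn ℝ ∞ a₀ D) (s₁ : ContDiffOn ℝ ∞ a₁ D)
    (s₂ : ContDiffOn ℝ ∞ a₂ D) (s₃ : ContDiffOn ℝ ∞ a₃ D) (s₄ : ContDiffOn ℝ ∞ a₄ D)
    (frame : ∀ x ∈ D, IsLaguerreFrame ![a₁ x, a₂ x, a₃ x, a₄ x])
    (coframe : ∀ x ∈ D, ∀ X, α₂ x X = 0 → α₃ x X = 0 → X = 0)
    (d₀ : ∀ x ∈ D, ∀ X, fderiv ℝ a₀ x X = α₂ x X • a₂ x + α₃ x X • a₃ x)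
    (d₁ : ∀ x ∈ D, ∀ X, fderiv ℝ a₁ x X = τ x X • a₁ x + α₂ x X • a₂ x - α₃ x X • a₃ x) :
    MovingFrame D where
  a₀ := a₀
  a₁ := a₁
  a₂ := a₂
  a₃ := a₃
  a₄ := a₄
  α₂ := α₂
  α₃ := α₃
  τ := τ
  ψ := pairingForm a₂ a₃
  β₁ := -pairingForm a₂ a₄
  β₂ := -pairingForm a₃ a₄
  smooth_a₀ := s₀
  smooth_a₁ := s₁
  smooth_a₂ := s₂
  smooth_a₃ := s₃
  smooth_a₄ := s₄
  frame := frame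
  coframe := coframe
  d_a₀ := d₀
  d_a₁ := d₁
  d_a₂ x hx X := by
    have hp := fun y hy => (frame y hy).products
    have h21 := mink_fderiv_add_eq_zero hD s₂ s₁ (fun y hy => (hp y hy).m21) hx X
    have h22 := mink_fderiv_add_eq_zero hD s₂ s₂ (fun y hy => (hp y hy).m22) hx X
    rw [d₁ x hx X] at h21
    simp only [mink_add_left, mink_sub_left, mink_smul_left, (hp x hx).m12, (hp x hx).m22,
      (hp x hx).m32] at h21
    rw [(frame x hx).expansion (fderiv ℝ a₂ x X), h21,
      show mink (fderiv ℝ a₂ x X) (a₂ x) = 0 by linarith]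
    simp only [Pi.neg_apply, neg_apply, pairingForm_apply]
    module
  d_a₃ x hx X := by
    have hp := fun y hy => (frame y hy).products
    have h31 := mink_fderiv_add_eq_zero hD s₃ s₁ (fun y hy => (hp y hy).m31) hx X
    have h32 := mink_fderiv_add_eq_zero hD s₃ s₂ (fun y hy => (hp y hy).m32) hx X
    have h33 := mink_fderiv_add_eq_zero hD s₃ s₃ (fun y hy => (hp y hy).m33) hx X
    rw [d₁ x hx X] at h31
    simp only [mink_add_left, mink_sub_left, mink_smul_left, (hp x hx).m13, (hp x hx).m23,
      (hp x hx).m33] at h31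
    rw [(frame x hx).expansion (fderiv ℝ a₃ x X), h31, h32,
      show mink (fderiv ℝ a₃ x X) (a₃ x) = 0 by linarith]
    simp only [Pi.neg_apply, neg_apply, pairingForm_apply]
    module
  d_a₄ x hx X := by
    have hp := fun y hy => (frame y hy).products
    have h41 := mink_fderiv_add_eq_zero hD s₄ s₁ (fun y hy => (hp y hy).m41) hx X
    have h42 := mink_fderiv_add_eq_zero hD s₄ s₂ (fun y hy => (hp y hy).m42) hx X
    have h43 := mink_fderiv_add_eq_zero hD s₄ s₃ (fun y hy => (hp y hy).m43) hx X
    have h44 := mink_fderiv_add_eq_zero hD s₄ s₄ (fun y hy => (hp y hy).m44) hx X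
    rw [d₁ x hx X] at h41
    simp only [mink_add_left, mink_sub_left, mink_smul_left, (hp x hx).m14, (hp x hx).m24,
      (hp x hx).m34] at h41
    rw [(frame x hx).expansion (fderiv ℝ a₄ x X), h41, h42, h43,
      show mink (fderiv ℝ a₄ x X) (a₄ x) = 0 by linarith]
    simp only [Pi.neg_apply, neg_apply, pairingForm_apply]
    module

theorem clm_eq_of_isDualFrame {D : Set E} {F : MovingFrame D} {x : E} (hx : x ∈ D) {X₂ X₃ : E}
    (h : F.IsDualFrame x X₂ X₃) (θ : E →L[ℝ] ℝ) :
    θ = θ X₂ • F.α₂ x + θ X₃ • F.α₃ x := by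
  ext X
  conv_lhs => rw [MovingFrame.eq_of_isDualFrame hx h X]
  rw [map_add, map_smul, map_smul]
  simp only [add_apply, smul_apply, smul_eq_mul]
  ring

/-- A moving frame in a conformal coordinate is a middle frame: the relations between its
connection forms follow from `d(da₀) = 0` and `d(da₁) = 0`. -/
def MovingFrame.toLocalFrame {D : Set ℂ} (hD : IsOpen D) (F : MovingFrame D)
    (hc : F.IsConformal) : LocalFrame D where
  toMovingFrame := F
  p₁ y := F.β₁ y (F.lam y)⁻¹
  p₂ y := F.β₁ y (Complex.I * (F.lam y)⁻¹)
  p₃ y := F.β₂ y (Complex.I * (F.lam y)⁻¹)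
  q₁ y := F.ψ y (F.lam y)⁻¹
  q₂ y := F.ψ y (Complex.I * (F.lam y)⁻¹)
  smooth_p₁ := (F.smooth_β₁ hD).clm_apply
    ((F.contDiffOn_lam hD).inv fun _ hy => F.lam_ne_zero hy hc)
  smooth_p₂ := (F.smooth_β₁ hD).clm_apply
    (contDiffOn_const.mul ((F.contDiffOn_lam hD).inv fun _ hy => F.lam_ne_zero hy hc))
  smooth_p₃ := (F.smooth_β₂ hD).clm_apply
    (contDiffOn_const.mul ((F.contDiffOn_lam hD).inv fun _ hy => F.lam_ne_zero hy hc))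
  smooth_q₁ := (F.smooth_ψ hD).clm_apply
    ((F.contDiffOn_lam hD).inv fun _ hy => F.lam_ne_zero hy hc)
  smooth_q₂ := (F.smooth_ψ hD).clm_apply
    (contDiffOn_const.mul ((F.contDiffOn_lam hD).inv fun _ hy => F.lam_ne_zero hy hc))
  τ_eq x hx := by
    have hd := F.isDualFrame hx hc
    obtain ⟨-, h2, h3⟩ := F.dext_τ hD hx (F.lam x)⁻¹ (Complex.I * (F.lam x)⁻¹)
    simp only [wedge, hd.h22, hd.h23, hd.h32, hd.h33] at h2 h3
    conv_lhs => rw [clm_eq_of_isDualFrame hx hd (F.τ x)]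
    congr 2 <;> linarith
  ψ_eq x hx := clm_eq_of_isDualFrame hx (F.isDualFrame hx hc) _
  β₁_eq x hx := clm_eq_of_isDualFrame hx (F.isDualFrame hx hc) _
  β₂_eq x hx := by
    have hd := F.isDualFrame hx hc
    obtain ⟨-, -, h1⟩ := F.dext_α hD hx (F.lam x)⁻¹ (Complex.I * (F.lam x)⁻¹)
    simp only [wedge, hd.h22, hd.h23, hd.h32, hd.h33] at h1
    conv_lhs => rw [clm_eq_of_isDualFrame hx hd (F.β₂ x)]
    congr 2
    linarith

/-- A null vector `w` with `⟨v, w⟩ = -1` lies in the same half of the light cone as `v`. -/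
theorem mem_posLightcone_of_mink_eq {v w : Mink} (hv : v ∈ posLightcone) (hw : mink w w = 0)
    (h : mink v w = -1) : w ∈ posLightcone := by
  obtain ⟨h1, h2⟩ := hv
  refine ⟨hw, ?_⟩
  simp [mink, stdVec] at h1 h2 hw h ⊢
  have hv0 : 0 ≤ v 0 := by nlinarith [sq_nonneg (v 1), sq_nonneg (v 2)]
  have hv3 : 0 ≤ v 3 := by nlinarith [sq_nonneg (v 1), sq_nonneg (v 2)]
  by_contra hcon
  push Not at hcon
  have hw0 : w 0 ≤ 0 := by nlinarith [sq_nonneg (w 1), sq_nonneg (w 2)]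
  have hw3 : w 3 ≤ 0 := by nlinarith [sq_nonneg (w 1), sq_nonneg (w 2)]
  have a0 := mul_nonneg hv0 (neg_nonneg.2 hw3)
  have a3 := mul_nonneg hv3 (neg_nonneg.2 hw0)
  have hL : v 0 * w 3 + v 3 * w 0 ≤ 0 := by linarith
  -- Cauchy-Schwarz for the two spacelike coordinates.
  have hM : (v 1 * w 1 + v 2 * w 2) ^ 2 ≤ (v 0 * w 3 + v 3 * w 0) ^ 2 := by
    have c1 : (v 1 * w 1 + v 2 * w 2) ^ 2 ≤
        (v 1 * v 1 + v 2 * v 2) * (w 1 * w 1 + w 2 * w 2) := by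
      nlinarith [sq_nonneg (v 1 * w 2 - v 2 * w 1)]
    have c2 : (v 1 * v 1 + v 2 * v 2) * (w 1 * w 1 + w 2 * w 2) =
        4 * (v 0 * w 3) * (v 3 * w 0) := by
      rw [show v 1 * v 1 + v 2 * v 2 = 2 * (v 0 * v 3) by linarith,
        show w 1 * w 1 + w 2 * w 2 = 2 * (w 0 * w 3) by linarith]
      ring
    nlinarith [sq_nonneg (v 0 * w 3 - v 3 * w 0)]
  nlinarith

theorem isotropicLine_add_smul (y v : Mink) (R : ℝ) {r : ℝ} (hr : r ≠ 0) :
    isotropicLine (y + R • v) (r • v) = isotropicLine y v := by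
  ext w
  constructor
  · rintro ⟨t, rfl⟩
    exact ⟨R + t * r, by module⟩
  · rintro ⟨t, rfl⟩
    refine ⟨(t - R) / r, ?_⟩
    rw [smul_smul, div_mul_cancel₀ _ hr]
    module

/-- The Laguerre frame obtained from another one by the rotation
`a₂ + i a₃ ↦ (c - i d) (a₂ + i a₃)`, a null rotation with parameters `s`, `t` and a boost with parameter `r`. -/
theorem IsLaguerreFrame.transform {a₁ a₂ a₃ a₄ : Mink} (h : IsLaguerreFrame ![a₁, a₂, a₃, a₄])
    {r c d : ℝ} (hr : 0 < r) (hcd : c ^ 2 + d ^ 2 = 1) (s t : ℝ) :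
    IsLaguerreFrame ![r • a₁, c • a₂ + d • a₃ + s • a₁, (-d) • a₂ + c • a₃ + t • a₁,
      r⁻¹ • (a₄ + s • (c • a₂ + d • a₃) + t • ((-d) • a₂ + c • a₃)
        + ((s ^ 2 + t ^ 2) / 2) • a₁)] := by
  obtain ⟨h11, h12, h13, h14, h21, h22, h23, h24, h31, h32, h33, h34, h41, h42, h43, h44⟩ :=
    h.products
  have hcd' : c * c + d * d = 1 := by linarith
  have hp : FrameProducts (r • a₁) (c • a₂ + d • a₃ + s • a₁) ((-d) • a₂ + c • a₃ + t • a₁)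
      (r⁻¹ • (a₄ + s • (c • a₂ + d • a₃) + t • ((-d) • a₂ + c • a₃)
        + ((s ^ 2 + t ^ 2) / 2) • a₁)) := by
    have hru : r * r⁻¹ = 1 := mul_inv_cancel₀ hr.ne'
    constructor <;>
      simp only [mink_add_left, mink_add_right, mink_smul_left, mink_smul_right, h11, h12, h13,
        h14, h21, h22, h23, h24, h31, h32, h33, h34, h41, h42, h43, h44]
    case m11 | m12 | m13 | m21 | m31 | m23 | m32 => ring
    case m14 | m41 => linear_combination -hru
    case m22 | m33 => linear_combination hcd
    case m24 | m42 => linear_combination (r⁻¹ * s) * hcd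
    case m34 | m43 => linear_combination (r⁻¹ * t) * hcd
    case m44 => linear_combination (r⁻¹ ^ 2 * (s ^ 2 + t ^ 2)) * hcd
  have h₁ : r • a₁ ∈ posLightcone := smul_mem_posLightcone h.2.2.1 hr
  refine hp.isLaguerreFrame ?_ h₁ (mem_posLightcone_of_mink_eq h₁ hp.m44 hp.m14)
  have hT : Matrix.of ![r • a₁, c • a₂ + d • a₃ + s • a₁, (-d) • a₂ + c • a₃ + t • a₁,
      r⁻¹ • (a₄ + s • (c • a₂ + d • a₃) + t • ((-d) • a₂ + c • a₃)
        + ((s ^ 2 + t ^ 2) / 2) • a₁)] =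
      Matrix.of ![![r, 0, 0, 0], ![s, c, d, 0], ![t, -d, c, 0],
        ![r⁻¹ * ((s ^ 2 + t ^ 2) / 2), r⁻¹ * (s * c - t * d), r⁻¹ * (s * d + t * c), r⁻¹]] *
      Matrix.of ![a₁, a₂, a₃, a₄] := by
    ext i j
    fin_cases i <;> simp [Matrix.mul_apply, Fin.sum_univ_four] <;> ring
  rw [hT, Matrix.det_mul]
  refine mul_pos ?_ h.2.1
  have hdet : (Matrix.of ![![r, 0, 0, 0], ![s, c, d, 0], ![t, -d, c, 0],
        ![r⁻¹ * ((s ^ 2 + t ^ 2) / 2), r⁻¹ * (s * c - t * d), r⁻¹ * (s * d + t * c), r⁻¹]]).det =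
      r * r⁻¹ * (c * c + d * d) := by
    simp [Matrix.det_succ_row_zero, Fin.sum_univ_succ, Fin.succAbove]
    ring
  rw [hdet, hcd', mul_inv_cancel₀ hr.ne']
  norm_num

end Construction

/-! ### The stereographic frame and local existence of middle frames -/

section StereographicFrame

/-- The section `(1, x, -y, (x² + y²) / 2)` of the positive light cone. The sign of `y` is chosen so
that `x + i y` is a complex coordinate for the orientation of the middle coframes. -/
def coneSection (w : ℂ) : Mink := ![1, w.re, -w.im, (w.re ^ 2 + w.im ^ 2) / 2]

/-- The derivative of `coneSection` in the direction `∂ₓ`. -/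
def coneTangentRe (w : ℂ) : Mink := ![0, 1, 0, w.re]

/-- Minus the derivative of `coneSection` in the direction `∂_y`. -/
def coneTangentIm (w : ℂ) : Mink := ![0, 0, 1, -w.im]

/-- The constant isotropic vector `ε₄` that completes the stereographic frame. -/
def conePole (_ : ℂ) : Mink := ![0, 0, 0, 1]

theorem contDiff_re : ContDiff ℝ ∞ fun w : ℂ => w.re := Complex.reCLM.contDiff

theorem contDiff_im : ContDiff ℝ ∞ fun w : ℂ => w.im := Complex.imCLM.contDiff

theorem contDiff_coneSection : ContDiff ℝ ∞ coneSection := by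
  refine contDiff_pi.2 fun i => ?_
  fin_cases i
  exacts [contDiff_const, contDiff_re, contDiff_im.neg,
    ((contDiff_re.pow 2).add (contDiff_im.pow 2)).div_const 2]

theorem contDiff_coneTangentRe : ContDiff ℝ ∞ coneTangentRe := by
  refine contDiff_pi.2 fun i => ?_
  fin_cases i
  exacts [contDiff_const, contDiff_const, contDiff_const, contDiff_re]

theorem contDiff_coneTangentIm : ContDiff ℝ ∞ coneTangentIm := by
  refine contDiff_pi.2 fun i => ?_
  fin_cases i
  exacts [contDiff_const, contDiff_const, contDiff_const, contDiff_im.neg]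

theorem contDiff_conePole : ContDiff ℝ ∞ conePole := contDiff_const

theorem hasFDerivAt_re (w : ℂ) : HasFDerivAt (fun w : ℂ => w.re) Complex.reCLM w :=
  Complex.reCLM.hasFDerivAt

theorem hasFDerivAt_im (w : ℂ) : HasFDerivAt (fun w : ℂ => w.im) Complex.imCLM w :=
  Complex.imCLM.hasFDerivAt

theorem hasFDerivAt_coneSection (w : ℂ) :
    HasFDerivAt coneSection (Complex.reCLM.smulRight (coneTangentRe w)
      - Complex.imCLM.smulRight (coneTangentIm w)) w := by
  refine hasFDerivAt_pi'' fun i => ?_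
  fin_cases i
  · exact (hasFDerivAt_const (1 : ℝ) w).congr_fderiv (by ext X; simp [coneTangentRe, coneTangentIm])
  · exact (hasFDerivAt_re w).congr_fderiv (by ext X; simp [coneTangentRe, coneTangentIm])
  · exact (hasFDerivAt_im w).neg.congr_fderiv (by ext X; simp [coneTangentRe, coneTangentIm])
  · exact ((((hasFDerivAt_re w).pow 2).add ((hasFDerivAt_im w).pow 2)).mul_const
      (2⁻¹ : ℝ)).congr_fderiv (by ext X; simp [coneTangentRe, coneTangentIm]; ring)

theorem fderiv_coneSection (w X : ℂ) :
    fderiv ℝ coneSection w X = X.re • coneTangentRe w - X.im • coneTangentIm w := by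
  simp [(hasFDerivAt_coneSection w).fderiv]

theorem isLaguerreFrame_stereographic (w : ℂ) :
    IsLaguerreFrame ![coneSection w, coneTangentRe w, coneTangentIm w, conePole w] := by
  have hp : FrameProducts (coneSection w) (coneTangentRe w) (coneTangentIm w) (conePole w) := by
    constructor <;> simp [mink, coneSection, coneTangentRe, coneTangentIm, conePole]
    ring
  refine hp.isLaguerreFrame ?_ ⟨hp.m11, ?_⟩ ⟨hp.m44, ?_⟩
  · simp [Matrix.det_succ_row_zero, Fin.sum_univ_succ, Fin.succAbove, coneSection, coneTangentRe,
      coneTangentIm, conePole]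
  · simp [mink, stdVec, coneSection]
    linarith [sq_nonneg w.re, sq_nonneg w.im]
  · simp [mink, stdVec, conePole]

/-- The surface `(0, x, y, (x² - y²) / 2)`, whose moving frame is the stereographic frame. -/
def saddleSurface (w : ℂ) : Mink := ![0, w.re, w.im, (w.re ^ 2 - w.im ^ 2) / 2]

theorem contDiff_saddleSurface : ContDiff ℝ ∞ saddleSurface := by
  refine contDiff_pi.2 fun i => ?_
  fin_cases i
  exacts [contDiff_const, contDiff_re, contDiff_im,
    ((contDiff_re.pow 2).sub (contDiff_im.pow 2)).div_const 2]

theorem hasFDerivAt_saddleSurface (w : ℂ) :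
    HasFDerivAt saddleSurface (Complex.reCLM.smulRight (coneTangentRe w)
      + Complex.imCLM.smulRight (coneTangentIm w)) w := by
  refine hasFDerivAt_pi'' fun i => ?_
  fin_cases i
  · exact (hasFDerivAt_const (0 : ℝ) w).congr_fderiv (by ext X; simp [coneTangentRe, coneTangentIm])
  · exact (hasFDerivAt_re w).congr_fderiv (by ext X; simp [coneTangentRe, coneTangentIm])
  · exact (hasFDerivAt_im w).congr_fderiv (by ext X; simp [coneTangentRe, coneTangentIm])
  · exact ((((hasFDerivAt_re w).pow 2).sub ((hasFDerivAt_im w).pow 2)).mul_const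
      (2⁻¹ : ℝ)).congr_fderiv (by ext X; simp [coneTangentRe, coneTangentIm]; ring)

/-- The frame of the positive light cone in stereographic coordinates. -/
def stereographicFrame : MovingFrame (Set.univ : Set ℂ) :=
  MovingFrame.ofLaguerre isOpen_univ saddleSurface coneSection coneTangentRe coneTangentIm conePole
    (fun _ => Complex.reCLM) (fun _ => Complex.imCLM) 0 contDiff_saddleSurface.contDiffOn
    contDiff_coneSection.contDiffOn contDiff_coneTangentRe.contDiffOn
    contDiff_coneTangentIm.contDiffOn contDiff_conePole.contDiffOn
    (fun w _ => isLaguerreFrame_stereographic w) (fun _ _ _ h2 h3 => Complex.ext h2 h3)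
    (fun w _ X => by simp [(hasFDerivAt_saddleSurface w).fderiv])
    (fun w _ X => by simp [fderiv_coneSection])

theorem apply_eq_re_add_im (θ : ℂ →L[ℝ] ℝ) (X : ℂ) :
    θ X = X.re * θ 1 + X.im * θ Complex.I := by
  conv_lhs => rw [show X = X.re • (1 : ℂ) + X.im • Complex.I by apply Complex.ext <;> simp]
  rw [map_add, map_smul, map_smul, smul_eq_mul, smul_eq_mul]

/-- If `⟨dY, e₁⟩ = 0` for the isotropic section `e₁`, then `Y` can be moved along the isotropic
lines `[Y, e₁]` so that the components of its derivative along the spacelike vectors of the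
stereographic frame are the real and imaginary parts of a complex linear form `B dw`. -/
theorem exists_shear {D : Set ℂ} (hD : IsOpen D) {Y : ℂ → Mink} (hY : ContDiffOn ℝ ∞ Y D)
    (hYe : ∀ w ∈ D, ∀ X, mink (fderiv ℝ Y w X) (coneSection w) = 0) :
    ∃ (R : ℂ → ℝ) (B : ℂ → ℂ) (σ : ℂ → ℂ →L[ℝ] ℝ), ContDiffOn ℝ ∞ R D ∧ ContDiffOn ℝ ∞ B D ∧
      ContDiffOn ℝ ∞ σ D ∧
      (∀ w ∈ D, ∀ X, fderiv ℝ (fun w => Y w + R w • coneSection w) w X =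
        σ w X • coneSection w + (B w * X).re • coneTangentRe w
          + (B w * X).im • coneTangentIm w) ∧
      ∀ w ∈ D, B w = 0 → ∀ X, mink (fderiv ℝ Y w X) (fderiv ℝ coneSection w X) =
        -(R w) * (X.re ^ 2 + X.im ^ 2) := by
  have h1 := contDiff_coneSection.contDiffOn (s := D)
  have h2 := contDiff_coneTangentRe.contDiffOn (s := D)
  have h3 := contDiff_coneTangentIm.contDiffOn (s := D)
  have h4 := contDiff_conePole.contDiffOn (s := D)
  set κ := -pairingForm Y conePole with hκ
  set μ₂ := pairingForm Y coneTangentRe with hμ₂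
  set μ₃ := pairingForm Y coneTangentIm with hμ₃
  have sκ : ContDiffOn ℝ ∞ κ D := (ContDiffOn.pairingForm hD hY h4).neg
  have sμ₂ : ContDiffOn ℝ ∞ μ₂ D := ContDiffOn.pairingForm hD hY h2
  have sμ₃ : ContDiffOn ℝ ∞ μ₃ D := ContDiffOn.pairingForm hD hY h3
  have hdY : ∀ w ∈ D, ∀ X, fderiv ℝ Y w X =
      κ w X • coneSection w + μ₂ w X • coneTangentRe w + μ₃ w X • coneTangentIm w := by
    intro w hw X
    rw [(isLaguerreFrame_stereographic w).expansion (fderiv ℝ Y w X), hYe w hw X]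
    simp only [hκ, hμ₂, hμ₃, Pi.neg_apply, neg_apply, pairingForm_apply]
    module
  -- The `e₄`-component of `d(dY) = 0` says that the matrix of `(μ₂, -μ₃)` is symmetric.
  have hsym : ∀ w ∈ D, μ₃ w 1 = -μ₂ w Complex.I := by
    intro w hw
    have h := (((stereographicFrame.mono (Set.subset_univ D)).structure_equations hD hw hY sκ sμ₂
      sμ₃ (contDiffOn_const (c := (0 : ℂ →L[ℝ] ℝ)))
      (fun y hy X => by
        rw [hdY y hy X]
        simp [stereographicFrame, MovingFrame.ofLaguerre, MovingFrame.mono]) 1 Complex.I).2.2).2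
    simp [stereographicFrame, MovingFrame.ofLaguerre, MovingFrame.mono, dext, wedge] at h
    linarith
  obtain ⟨R, hR⟩ : ∃ R : ℂ → ℝ, ∀ w, R w = -(1 / 2) * (μ₂ w 1 - μ₃ w Complex.I) :=
    ⟨_, fun _ => rfl⟩
  have sR : ContDiffOn ℝ ∞ R D := by
    rw [funext hR]
    exact contDiffOn_const.mul ((sμ₂.clm_apply contDiffOn_const).sub (sμ₃.clm_apply contDiffOn_const))
  refine ⟨R, fun w => ((1 / 2 * (μ₂ w 1 + μ₃ w Complex.I) : ℝ) : ℂ) - (μ₂ w Complex.I : ℝ) * Complex.I,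
    fun w => κ w + fderiv ℝ R w, sR, ?_,
    sκ.add (sR.fderiv_of_isOpen hD (by simp)), ?_, ?_⟩
  · exact (Complex.ofRealCLM.contDiff.comp_contDiffOn (contDiffOn_const.mul
      ((sμ₂.clm_apply contDiffOn_const).add (sμ₃.clm_apply contDiffOn_const)))).sub
      ((Complex.ofRealCLM.contDiff.comp_contDiffOn
        (sμ₂.clm_apply contDiffOn_const)).mul contDiffOn_const)
  · intro w hw X
    rw [fderiv_fun_add (hY.differentiableAt_of_mem_isOpen hD hw)
      (sR.differentiableAt_of_mem_isOpen hD hw |>.fun_smul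
        (h1.differentiableAt_of_mem_isOpen hD hw)),
      fderiv_fun_smul (sR.differentiableAt_of_mem_isOpen hD hw)
      (h1.differentiableAt_of_mem_isOpen hD hw)]
    simp only [add_apply, smul_apply, ContinuousLinearMap.smulRight_apply, fderiv_coneSection,
      hdY w hw X]
    rw [apply_eq_re_add_im (μ₂ w) X, apply_eq_re_add_im (μ₃ w) X, hsym w hw, hR w]
    simp only [Complex.mul_re, Complex.mul_im, Complex.sub_re, Complex.sub_im, Complex.ofReal_re,
      Complex.ofReal_im, Complex.I_re, Complex.I_im]
    module
  · intro w hw hB X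
    have hre := congrArg Complex.re hB
    have him := congrArg Complex.im hB
    simp at hre him
    rw [hdY w hw X, fderiv_coneSection, apply_eq_re_add_im (μ₂ w) X, apply_eq_re_add_im (μ₃ w) X, hsym w hw, him]
    have hp := (isLaguerreFrame_stereographic w).products
    simp only [mink_add_left, mink_sub_right, mink_smul_left, mink_smul_right, hp.m12, hp.m13,
      hp.m22, hp.m23, hp.m32, hp.m33]
    rw [hR w, show μ₃ w Complex.I = -μ₂ w 1 by linarith]
    ring

/-- A nonvanishing smooth function is locally `r c²` with `r > 0` and `|c| = 1`. -/
theorem exists_polar_sqrt {D : Set ℂ} (hD : IsOpen D) {B : ℂ → ℂ} (hB : ContDiffOn ℝ ∞ B D)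
    {w₀ : ℂ} (hw₀ : w₀ ∈ D) (h₀ : B w₀ ≠ 0) :
    ∃ D' ⊆ D, IsOpen D' ∧ w₀ ∈ D' ∧ ∃ (r : ℂ → ℝ) (c : ℂ → ℂ), ContDiffOn ℝ ∞ r D' ∧
      ContDiffOn ℝ ∞ c D' ∧ ∀ w ∈ D', 0 < r w ∧ (c w).re ^ 2 + (c w).im ^ 2 = 1 ∧
        B w = r w * c w ^ 2 := by
  have hq : ContDiffOn ℝ ∞ (fun w => B w / B w₀) D := hB.div_const _
  refine ⟨D ∩ (fun w => B w / B w₀) ⁻¹' Complex.slitPlane, Set.inter_subset_left,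
    hq.continuousOn.isOpen_inter_preimage hD Complex.isOpen_slitPlane,
    ⟨hw₀, by simp [h₀, Complex.one_mem_slitPlane]⟩, fun w => ‖B w‖,
    fun w => Complex.exp
      ((((Complex.log (B w / B w₀)).im + (B w₀).arg) / 2 : ℝ) * Complex.I), ?_, ?_, ?_⟩
  · refine (hB.mono Set.inter_subset_left).norm ℝ fun w hw hw0 => ?_
    have := Complex.slitPlane_ne_zero hw.2
    simp [hw0] at this
  · have hlog : ContDiffOn ℝ ∞ (fun w => Complex.log (B w / B w₀))
        (D ∩ (fun w => B w / B w₀) ⁻¹' Complex.slitPlane) := fun w hw =>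
      ((Complex.contDiffAt_log hw.2).restrict_scalars ℝ).comp_contDiffWithinAt
        (f := fun w => B w / B w₀) w (hq.mono Set.inter_subset_left w hw)
    exact (Complex.contDiff_exp (𝕜 := ℝ)).comp_contDiffOn
      ((Complex.ofRealCLM.contDiff.comp_contDiffOn
        (((contDiff_im.comp_contDiffOn hlog).add contDiffOn_const).div_const 2)).mul
        contDiffOn_const)
  · rintro w ⟨hw, hws⟩
    have hBw : B w ≠ 0 := by
      rintro hw0
      have := Complex.slitPlane_ne_zero hws
      simp [hw0] at this
    refine ⟨norm_pos_iff.2 hBw, ?_, ?_⟩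
    · rw [Complex.exp_ofReal_mul_I_re, Complex.exp_ofReal_mul_I_im, Real.cos_sq_add_sin_sq]
    · rw [← Complex.exp_nat_mul, Complex.log_im]
      have e : ((2 : ℕ) : ℂ) * ((((B w / B w₀).arg + (B w₀).arg) / 2 : ℝ) * Complex.I) =
          (B w / B w₀).arg * Complex.I + (B w₀).arg * Complex.I := by
        push_cast
        ring
      rw [e, Complex.exp_add]
      have n1 := Complex.norm_mul_exp_arg_mul_I (B w / B w₀)
      have n2 := Complex.norm_mul_exp_arg_mul_I (B w₀)
      have n3 : ‖B w‖ = ‖B w / B w₀‖ * ‖B w₀‖ := by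
        rw [norm_div, div_mul_cancel₀ _ (norm_ne_zero_iff.2 h₀)]
      calc B w = (B w / B w₀) * B w₀ := (div_mul_cancel₀ _ h₀).symm
        _ = (‖B w / B w₀‖ * Complex.exp ((B w / B w₀).arg * Complex.I)) *
            (‖B w₀‖ * Complex.exp ((B w₀).arg * Complex.I)) := by rw [n1, n2]
        _ = _ := by
          simp only [n3]
          push_cast
          ring

/-- Middle frames exist along a family of isotropic lines `[Y, e₁]`, where `e₁` is the isotropic
section of the stereographic frame, near points where `⟨dY, de₁⟩` is not a multiple of `|dw|²`.
With `B = r c²` as in `exists_shear` and `exists_polar_sqrt`, the rotation by `c` and the boost by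
`r` give the coframe `α₂ + i α₃ = r c dw`. -/
theorem exists_localFrame {D : Set ℂ} (hD : IsOpen D) {Y : ℂ → Mink} (hY : ContDiffOn ℝ ∞ Y D)
    (hYe : ∀ w ∈ D, ∀ X, mink (fderiv ℝ Y w X) (coneSection w) = 0) {w₀ : ℂ} (hw₀ : w₀ ∈ D)
    (hnd : ¬∃ R : ℝ, ∀ X, mink (fderiv ℝ Y w₀ X) (fderiv ℝ coneSection w₀ X) =
      R * (X.re ^ 2 + X.im ^ 2)) :
    ∃ D' ⊆ D, IsOpen D' ∧ w₀ ∈ D' ∧ ∃ F : LocalFrame D', F.IsConformal ∧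
      ∀ w ∈ D', isotropicLine (F.a₀ w) (F.a₁ w) = isotropicLine (Y w) (coneSection w) := by
  obtain ⟨R, B, σ, sR, sB, sσ, hd, hB⟩ := exists_shear hD hY hYe
  obtain ⟨D', hDD, hD', hwD', r, c, sr, sc, hrc⟩ :=
    exists_polar_sqrt hD sB hw₀ fun h0 => hnd ⟨-R w₀, hB w₀ hw₀ h0⟩
  have h1 := contDiff_coneSection.contDiffOn (s := D')
  have h2 := contDiff_coneTangentRe.contDiffOn (s := D')
  have h3 := contDiff_coneTangentIm.contDiffOn (s := D')
  have h4 := contDiff_conePole.contDiffOn (s := D')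
  replace sσ := sσ.mono hDD
  have hr0 : ∀ w ∈ D', r w ≠ 0 := fun w hw => (hrc w hw).1.ne'
  have hc0 : ∀ w ∈ D', c w ≠ 0 := by
    intro w hw h0
    have := (hrc w hw).2.1
    simp [h0] at this
  -- The null rotation `s - it` that absorbs the `e₁`-component `σ` of `da₀`.
  obtain ⟨S, hS⟩ : ∃ S : ℂ → ℂ, ∀ w, S w =
      ((σ w 1 : ℂ) - Complex.I * (σ w Complex.I : ℂ)) * (r w * c w : ℂ)⁻¹ := ⟨_, fun _ => rfl⟩
  have sS : ContDiffOn ℝ ∞ S D' := by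
    rw [funext hS]
    exact ((Complex.ofRealCLM.contDiff.comp_contDiffOn (sσ.clm_apply contDiffOn_const)).sub
      (contDiffOn_const.mul (Complex.ofRealCLM.contDiff.comp_contDiffOn
        (sσ.clm_apply contDiffOn_const)))).mul
      (((Complex.ofRealCLM.contDiff.comp_contDiffOn sr).mul sc).inv
      fun w hw => mul_ne_zero (Complex.ofReal_ne_zero.2 (hr0 w hw)) (hc0 w hw))
  have ss : ContDiffOn ℝ ∞ (fun w => (S w).re) D' := contDiff_re.comp_contDiffOn sS
  have st : ContDiffOn ℝ ∞ (fun w => -(S w).im) D' := (contDiff_im.comp_contDiffOn sS).neg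
  have scr : ContDiffOn ℝ ∞ (fun w => (c w).re) D' := contDiff_re.comp_contDiffOn sc
  have sci : ContDiffOn ℝ ∞ (fun w => (c w).im) D' := contDiff_im.comp_contDiffOn sc
  have sm2 : ContDiffOn ℝ ∞
      (fun w => (c w).re • coneTangentRe w + (c w).im • coneTangentIm w) D' :=
    (scr.smul h2).add (sci.smul h3)
  have sm3 : ContDiffOn ℝ ∞
      (fun w => (-(c w).im) • coneTangentRe w + (c w).re • coneTangentIm w) D' :=
    (sci.neg.smul h2).add (scr.smul h3)
  obtain ⟨α₂, hα₂⟩ : ∃ α : ℂ → ℂ →L[ℝ] ℝ, ∀ w X, α w X = (r w * c w * X).re :=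
    ⟨fun w => Complex.reCLM.comp (ContinuousLinearMap.mul ℝ ℂ (r w * c w)), fun _ _ => rfl⟩
  obtain ⟨α₃, hα₃⟩ : ∃ α : ℂ → ℂ →L[ℝ] ℝ, ∀ w X, α w X = (r w * c w * X).im :=
    ⟨fun w => Complex.imCLM.comp (ContinuousLinearMap.mul ℝ ℂ (r w * c w)), fun _ _ => rfl⟩
  have hα : ∀ w X, (α₂ w X : ℂ) + Complex.I * α₃ w X = r w * c w * X := by
    intro w X
    rw [hα₂, hα₃, mul_comm Complex.I]
    exact Complex.re_add_im _
  let G : MovingFrame D' := MovingFrame.ofLaguerre hD' (fun w => Y w + R w • coneSection w)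
    (fun w => r w • coneSection w)
    (fun w => (c w).re • coneTangentRe w + (c w).im • coneTangentIm w + (S w).re • coneSection w)
    (fun w => (-(c w).im) • coneTangentRe w + (c w).re • coneTangentIm w
      + (-(S w).im) • coneSection w)
    (fun w => (r w)⁻¹ • (conePole w
      + (S w).re • ((c w).re • coneTangentRe w + (c w).im • coneTangentIm w)
      + (-(S w).im) • ((-(c w).im) • coneTangentRe w + (c w).re • coneTangentIm w)
      + (((S w).re ^ 2 + (-(S w).im) ^ 2) / 2) • coneSection w))
    α₂ α₃ (fun w => (r w)⁻¹ • (fderiv ℝ r w - (S w).re • α₂ w + (-(S w).im) • α₃ w))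
    ((hY.mono hDD).add ((sR.mono hDD).smul h1)) (sr.smul h1) (sm2.add (ss.smul h1))
    (sm3.add (st.smul h1))
    ((sr.inv hr0).smul (((h4.add (ss.smul sm2)).add (st.smul sm3)).add
      ((((ss.pow 2).add (st.pow 2)).div_const 2).smul h1)))
    (fun w hw => (isLaguerreFrame_stereographic w).transform (hrc w hw).1 (hrc w hw).2.1 _ _)
    (fun w hw X h2 h3 => by
      have h := hα w X
      simpa [h2, h3, hr0 w hw, hc0 w hw] using h.symm)
    (fun w hw X => by
      rw [hd w (hDD hw) X]
      have hne : (r w * c w : ℂ) ≠ 0 :=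
        mul_ne_zero (Complex.ofReal_ne_zero.2 (hr0 w hw)) (hc0 w hw)
      have hσ : σ w X = (S w * (r w * c w * X)).re := by
        rw [hS, mul_assoc, inv_mul_cancel_left₀ hne, apply_eq_re_add_im]
        simp
        ring
      have hBX : B w * X = c w * (r w * c w * X) := by
        rw [(hrc w hw).2.2]
        ring
      rw [hσ, hBX, hα₂, hα₃, Complex.mul_re (S w), Complex.mul_re (c w), Complex.mul_im (c w)]
      module)
    (fun w hw X => by
      have hcZ : (starRingEnd ℂ) (c w) * (r w * c w * X) = r w * X := by
        have h := Complex.mul_conj (c w)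
        rw [Complex.normSq_apply, ← sq, ← sq, (hrc w hw).2.1, Complex.ofReal_one] at h
        linear_combination (r w * X : ℂ) * h
      have hre : r w * X.re = (c w).re * α₂ w X + (c w).im * α₃ w X := by
        have h := congrArg Complex.re hcZ
        rw [Complex.mul_re, ← hα₂, ← hα₃, Complex.re_ofReal_mul, Complex.conj_re,
          Complex.conj_im] at h
        linarith
      have him : r w * X.im = (c w).re * α₃ w X - (c w).im * α₂ w X := by
        have h := congrArg Complex.im hcZ
        rw [Complex.mul_im, ← hα₂, ← hα₃, Complex.im_ofReal_mul, Complex.conj_re,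
          Complex.conj_im] at h
        linarith
      rw [fderiv_fun_smul (sr.differentiableAt_of_mem_isOpen hD' hw)
        (h1.differentiableAt_of_mem_isOpen hD' hw)]
      simp only [add_apply, sub_apply, smul_apply, ContinuousLinearMap.smulRight_apply,
        fderiv_coneSection, smul_sub, smul_smul, hre, him, smul_eq_mul]
      rw [mul_right_comm (r w)⁻¹, inv_mul_cancel₀ (hr0 w hw), one_mul]
      module)
  have hG : G.IsConformal := by
    intro w hw X
    have e1 := hα w X
    have e2 := hα w 1
    rw [mul_one] at e2
    exact e1.trans (by rw [← e2]; rfl)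
  exact ⟨D', hDD, hD', hwD', G.toLocalFrame hD' hG, hG, fun w hw =>
    isotropicLine_add_smul _ _ _ (hr0 w hw)⟩

end StereographicFrame

/-! ### Existence of middle frames on the surface -/

section Existence

variable {E : Type*} [NormedAddCommGroup E] [NormedSpace ℝ E]

theorem fderiv_clm_comp {V W : Type*} [NormedAddCommGroup V] [NormedSpace ℝ V]
    [NormedAddCommGroup W] [NormedSpace ℝ W] (T : V →L[ℝ] W) {g : E → V} {x : E}
    (hg : DifferentiableAt ℝ g x) (X : E) : fderiv ℝ (T ∘ g) x X = T (fderiv ℝ g x X) := by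
  rw [fderiv_comp x T.differentiableAt hg, T.fderiv]
  rfl

/-- The image of a moving frame under an orientation and time-orientation preserving linear
isometry. -/
def MovingFrame.map {D : Set E} (hD : IsOpen D) (F : MovingFrame D) (T : Mink →L[ℝ] Mink)
    (hT : ∀ a, IsLaguerreFrame a → IsLaguerreFrame fun i => T (a i)) : MovingFrame D where
  a₀ := T ∘ F.a₀
  a₁ := T ∘ F.a₁
  a₂ := T ∘ F.a₂
  a₃ := T ∘ F.a₃
  a₄ := T ∘ F.a₄
  α₂ := F.α₂
  α₃ := F.α₃
  τ := F.τ
  ψ := F.ψ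
  β₁ := F.β₁
  β₂ := F.β₂
  smooth_a₀ := T.contDiff.comp_contDiffOn F.smooth_a₀
  smooth_a₁ := T.contDiff.comp_contDiffOn F.smooth_a₁
  smooth_a₂ := T.contDiff.comp_contDiffOn F.smooth_a₂
  smooth_a₃ := T.contDiff.comp_contDiffOn F.smooth_a₃
  smooth_a₄ := T.contDiff.comp_contDiffOn F.smooth_a₄
  frame x hx := by
    convert hT _ (F.frame x hx) using 2 with i
    fin_cases i <;> rfl
  coframe := F.coframe
  d_a₀ x hx X := by
    rw [fderiv_clm_comp T (F.smooth_a₀.differentiableAt_of_mem_isOpen hD hx), F.d_a₀ x hx]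
    simp
  d_a₁ x hx X := by
    rw [fderiv_clm_comp T (F.smooth_a₁.differentiableAt_of_mem_isOpen hD hx), F.d_a₁ x hx]
    simp
  d_a₂ x hx X := by
    rw [fderiv_clm_comp T (F.smooth_a₂.differentiableAt_of_mem_isOpen hD hx), F.d_a₂ x hx]
    simp
  d_a₃ x hx X := by
    rw [fderiv_clm_comp T (F.smooth_a₃.differentiableAt_of_mem_isOpen hD hx), F.d_a₃ x hx]
    simp
  d_a₄ x hx X := by
    rw [fderiv_clm_comp T (F.smooth_a₄.differentiableAt_of_mem_isOpen hD hx), F.d_a₄ x hx]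
    simp

/-- The image of a middle frame under an orientation and time-orientation preserving linear
isometry. -/
def LocalFrame.map {D : Set E} (hD : IsOpen D) (F : LocalFrame D) (T : Mink →L[ℝ] Mink)
    (hT : ∀ a, IsLaguerreFrame a → IsLaguerreFrame fun i => T (a i)) : LocalFrame D :=
  { F with toMovingFrame := F.toMovingFrame.map hD T hT }

/-- The linear isometry that interchanges the two ends `0` and `∞` of the stereographic
coordinate of the cone. -/
def poleSwap : Mink →L[ℝ] Mink :=
  ContinuousLinearMap.pi ![ContinuousLinearMap.proj 3, -ContinuousLinearMap.proj 1,
    ContinuousLinearMap.proj 2, ContinuousLinearMap.proj 0]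

theorem poleSwap_apply (v : Mink) : poleSwap v = ![v 3, -v 1, v 2, v 0] := by
  ext i
  fin_cases i <;> rfl

theorem poleSwap_poleSwap (v : Mink) : poleSwap (poleSwap v) = v := by
  ext i
  fin_cases i <;> simp [poleSwap_apply]

theorem mink_poleSwap (v w : Mink) : mink (poleSwap v) (poleSwap w) = mink v w := by
  simp [poleSwap_apply, mink]
  ring

theorem poleSwap_mem_posLightcone {v : Mink} (hv : v ∈ posLightcone) :
    poleSwap v ∈ posLightcone := by
  refine ⟨(mink_poleSwap v v).trans hv.1, ?_⟩
  have h := hv.2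
  simp [poleSwap_apply, mink, stdVec] at h ⊢
  linarith

theorem IsLaguerreFrame.poleSwap {a : Fin 4 → Mink} (h : IsLaguerreFrame a) :
    IsLaguerreFrame fun i => poleSwap (a i) := by
  refine ⟨fun i j => (mink_poleSwap _ _).trans (h.1 i j), ?_,
    poleSwap_mem_posLightcone h.2.2.1, poleSwap_mem_posLightcone h.2.2.2⟩
  have hM : Matrix.of (fun i => Laguerre.poleSwap (a i)) = Matrix.of a *
      Matrix.of ![![0, 0, 0, 1], ![0, -1, 0, 0], ![0, 0, 1, 0], ![1, 0, 0, 0]] := by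
    ext i j
    fin_cases j <;> simp [Matrix.mul_apply, Fin.sum_univ_four, poleSwap_apply]
  rw [hM, Matrix.det_mul]
  refine mul_pos h.2.1 ?_
  simp [Matrix.det_succ_row_zero, Fin.sum_univ_succ, Fin.succAbove]
  norm_num

theorem image_isotropicLine (T : Mink →L[ℝ] Mink) (y v : Mink) :
    T '' isotropicLine y v = isotropicLine (T y) (T v) := by
  ext w
  constructor
  · rintro ⟨-, ⟨t, rfl⟩, rfl⟩
    exact ⟨t, by simp⟩
  · rintro ⟨t, rfl⟩
    exact ⟨_, ⟨t, rfl⟩, by simp⟩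

/-- The stereographic coordinate of the isotropic vectors with nonzero first component, inverse to
`coneSection` up to scale. -/
def stereoCoord (v : Mink) : ℂ := (v 1 / v 0 : ℝ) - (v 2 / v 0 : ℝ) * Complex.I

theorem eq_smul_coneSection {v : Mink} (hv : v ∈ posLightcone) (h0 : v 0 ≠ 0) :
    v = v 0 • coneSection (stereoCoord v) := by
  have h := hv.1
  simp only [mink] at h
  ext i
  fin_cases i
  · simp [coneSection]
  · simp [coneSection, stereoCoord]
    field_simp
  · simp [coneSection, stereoCoord]
    field_simp
  · simp [coneSection, stereoCoord]
    field_simp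
    linarith

theorem _root_.ContDiffOn.stereoCoord {V : E → Mink} {D : Set E} (hV : ContDiffOn ℝ ∞ V D)
    (h0 : ∀ y ∈ D, V y 0 ≠ 0) : ContDiffOn ℝ ∞ (fun y => stereoCoord (V y)) D := by
  have h := contDiffOn_pi.1 hV
  exact (Complex.ofRealCLM.contDiff.comp_contDiffOn ((h 1).div (h 0) h0)).sub
    ((Complex.ofRealCLM.contDiff.comp_contDiffOn ((h 2).div (h 0) h0)).mul contDiffOn_const)

theorem fderiv_smul_coneSection {V : E → Mink} {r : E → ℝ} {g : E → ℂ} {D : Set E} (hD : IsOpen D)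
    (hr : ContDiffOn ℝ ∞ r D) (hg : ContDiffOn ℝ ∞ g D)
    (h : ∀ y ∈ D, V y = r y • coneSection (g y)) {y : E} (hy : y ∈ D) (X : E) :
    fderiv ℝ V y X = fderiv ℝ r y X • coneSection (g y)
      + r y • fderiv ℝ coneSection (g y) (fderiv ℝ g y X) := by
  have hgd := hg.differentiableAt_of_mem_isOpen hD hy
  have hcd : DifferentiableAt ℝ coneSection (g y) :=
    contDiff_coneSection.contDiffAt.differentiableAt (by simp)
  rw [fderiv_eq_of_eqOn hD h hy, fderiv_fun_smul (hr.differentiableAt_of_mem_isOpen hD hy)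
    (show DifferentiableAt ℝ (fun y => coneSection (g y)) y from hcd.comp y hgd),
    fderiv_fun_comp y hcd hgd]
  simp [add_comm]

theorem mink_fderiv_coneSection (w X : ℂ) :
    mink (coneSection w) (fderiv ℝ coneSection w X) = 0 ∧
    mink (fderiv ℝ coneSection w X) (coneSection w) = 0 ∧
    mink (fderiv ℝ coneSection w X) (fderiv ℝ coneSection w X) = X.re ^ 2 + X.im ^ 2 := by
  have hp := (isLaguerreFrame_stereographic w).products
  simp only [fderiv_coneSection, mink_sub_left, mink_sub_right, mink_smul_left, mink_smul_right,
    hp.m12, hp.m13, hp.m21, hp.m31, hp.m22, hp.m23, hp.m32, hp.m33]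
  refine ⟨by ring, by ring, by ring⟩

variable {M : Type*} [TopologicalSpace M] [ChartedSpace (EuclideanSpace ℝ (Fin 2)) M]

theorem dAt_comp {V W : Type*} [NormedAddCommGroup V] [NormedSpace ℝ V] [NormedAddCommGroup W]
    [NormedSpace ℝ W] {g : M → V} {φ : V → W} {φ' : V →L[ℝ] W} {p : M}
    (hφ : HasFDerivAt φ φ' (g p)) (hg : MDifferentiableAt (𝓡 2) 𝓘(ℝ, V) g p)
    (X : TangentSpace (𝓡 2) p) : dAt (fun q => φ (g q)) p X = φ' (dAt g p X) := by
  have h := (hφ.hasMFDerivAt.comp p hg.hasMFDerivAt).mfderiv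
  exact congrArg (fun T : TangentSpace (𝓡 2) p →L[ℝ] W => T X) h

/-- A nondegenerate Legendre congruence of isotropic lines `[Y, ν]`: `⟨dY, ν⟩ = 0`, the form
`⟨dν, dν⟩` is positive definite, and `⟨dY, dν⟩` is nowhere a multiple of it. -/
structure IsLegendreCongruence (Y ν : M → Mink) : Prop where
  smooth_Y : ContMDiff (𝓡 2) 𝓘(ℝ, Mink) ∞ Y
  smooth_ν : ContMDiff (𝓡 2) 𝓘(ℝ, Mink) ∞ ν
  mem_cone : ∀ p, ν p ∈ posLightcone
  legendre : ∀ p X, mink (dAt Y p X) (ν p) = 0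
  pos : ∀ p X, X ≠ 0 → 0 < mink (dAt ν p X) (dAt ν p X)
  indep : ∀ p (R : ℝ), ¬∀ X, mink (dAt Y p X) (dAt ν p X) = R * mink (dAt ν p X) (dAt ν p X)

theorem IsLegendreCongruence.poleSwap {Y ν : M → Mink} (h : IsLegendreCongruence Y ν) :
    IsLegendreCongruence (fun p => poleSwap (Y p)) (fun p => poleSwap (ν p)) := by
  have hY : ∀ p X, dAt (fun p => Laguerre.poleSwap (Y p)) p X = Laguerre.poleSwap (dAt Y p X) :=
    fun p X => dAt_comp Laguerre.poleSwap.hasFDerivAt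
      ((h.smooth_Y p).mdifferentiableAt (by simp)) X
  have hν : ∀ p X, dAt (fun p => Laguerre.poleSwap (ν p)) p X = Laguerre.poleSwap (dAt ν p X) :=
    fun p X => dAt_comp Laguerre.poleSwap.hasFDerivAt
      ((h.smooth_ν p).mdifferentiableAt (by simp)) X
  exact
  { smooth_Y := Laguerre.poleSwap.contDiff.contMDiff.comp h.smooth_Y
    smooth_ν := Laguerre.poleSwap.contDiff.contMDiff.comp h.smooth_ν
    mem_cone := fun p => poleSwap_mem_posLightcone (h.mem_cone p)
    legendre := fun p X => by rw [hY, mink_poleSwap, h.legendre]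
    pos := fun p X hX => by
      rw [hν, mink_poleSwap]
      exact h.pos p X hX
    indep := fun p R hR => h.indep p R fun X => by
      have := hR X
      rwa [hY, hν, mink_poleSwap, mink_poleSwap] at this }

/-- Around a point where the first component of `ν` does not vanish, the stereographic coordinate
of `ν` is a chart, in which `exists_localFrame` provides a middle frame. -/
theorem IsLegendreCongruence.exists_localFrame_of_ne_zero [IsManifold (𝓡 2) ∞ M] {Y ν : M → Mink}
    (h : IsLegendreCongruence Y ν) {p : M} (hp : ν p 0 ≠ 0) :
    ∃ z : OpenPartialHomeomorph M ℂ, IsSmoothChart z ∧ p ∈ z.source ∧ ∃ F : LocalFrame z.target,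
      F.IsConformal ∧ ∀ w ∈ z.target, isotropicLine (F.a₀ w) (F.a₁ w) =
        isotropicLine (Y (z.symm w)) (ν (z.symm w)) := by
  obtain ⟨e, he, hpe⟩ : ∃ e : OpenPartialHomeomorph M (EuclideanSpace ℝ (Fin 2)),
      IsSmoothChart e ∧ p ∈ e.source := ⟨_, isSmoothChart_chartAt p, mem_chart_source _ p⟩
  set U : Set M := {q | ν q 0 ≠ 0} with hU_def
  have hU : IsOpen U := isOpen_ne_fun
    ((continuous_apply 0).comp h.smooth_ν.continuous) continuous_const
  have hdν : ∀ {E' : Type} [NormedAddCommGroup E'] [NormedSpace ℝ E']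
      {e' : OpenPartialHomeomorph M E'} (he' : IsSmoothChart e') {y : E'} (hy : y ∈ e'.target)
      (X : E'), fderiv ℝ (ν ∘ e'.symm) y X = dAt ν (e'.symm y) (dSymm e' y X) :=
    fun he' _ hy X => he'.fderiv_comp_symm hy ((h.smooth_ν _).mdifferentiableAt (by simp)) X
  set D := e.target ∩ e.symm ⁻¹' U with hD_def
  have hD : IsOpen D := e.isOpen_inter_preimage_symm hU
  have sν : ContDiffOn ℝ ∞ (ν ∘ e.symm) D := he.contDiffOn_comp_symm h.smooth_ν.contMDiffOn
  have sg : ContDiffOn ℝ ∞ (fun y => stereoCoord ((ν ∘ e.symm) y)) D :=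
    sν.stereoCoord fun y hy => hy.2
  obtain ⟨z, hz, hpz, hze, hzD, hzg⟩ := he.exists_comp hD Set.inter_subset_left sg
    (fun y hy => exists_continuousLinearEquiv (by simp) _ fun X hX => by
      by_contra hX0
      have h1 := fderiv_smul_coneSection hD (contDiffOn_pi.1 sν 0) sg
        (fun y hy => eq_smul_coneSection (h.mem_cone _) hy.2) hy X
      rw [hX, map_zero, smul_zero, add_zero] at h1
      have h2 := h.pos _ _ (mt (he.dSymm_injective hy.1) hX0)
      rw [← hdν he hy.1, h1, mink_smul_left, mink_smul_right,
        (isLaguerreFrame_stereographic _).products.m11] at h2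
      simp at h2)
    (y₀ := e p) ⟨e.map_source hpe, by rwa [Set.mem_preimage, e.left_inv hpe]⟩
  rw [e.left_inv hpe] at hpz
  have hzU : ∀ w ∈ z.target, ν (z.symm w) 0 ≠ 0 := by
    intro w hw
    have h1 := (hzD _ (z.map_target hw)).2
    rwa [Set.mem_preimage, e.left_inv (hze (z.map_target hw))] at h1
  have hν : ∀ w ∈ z.target, (ν ∘ z.symm) w = ν (z.symm w) 0 • coneSection w := by
    intro w hw
    have h1 := hzg (z.symm w)
    rw [z.right_inv hw, Function.comp_apply, e.left_inv (hze (z.map_target hw))] at h1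
    have h2 := eq_smul_coneSection (h.mem_cone _) (hzU w hw)
    rwa [← h1] at h2
  have sY : ContDiffOn ℝ ∞ (Y ∘ z.symm) z.target :=
    (hz.contDiffOn_comp_symm (U := Set.univ) h.smooth_Y.contMDiffOn).mono fun w hw => ⟨hw, trivial⟩
  have sν' : ContDiffOn ℝ ∞ (ν ∘ z.symm) z.target :=
    (hz.contDiffOn_comp_symm (U := Set.univ) h.smooth_ν.contMDiffOn).mono fun w hw => ⟨hw, trivial⟩
  have hdY : ∀ w ∈ z.target, ∀ X, fderiv ℝ (Y ∘ z.symm) w X =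
      dAt Y (z.symm w) (dSymm z w X) :=
    fun w hw X => hz.fderiv_comp_symm hw ((h.smooth_Y _).mdifferentiableAt (by simp)) X
  have hYe : ∀ w ∈ z.target, ∀ X, mink (fderiv ℝ (Y ∘ z.symm) w X) (coneSection w) = 0 := by
    intro w hw X
    have h1 := h.legendre _ (dSymm z w X)
    rw [← hdY w hw, show ν (z.symm w) = ν (z.symm w) 0 • coneSection w from hν w hw,
      mink_smul_right] at h1
    exact (mul_eq_zero.1 h1).resolve_left (hzU w hw)
  have hw₀ := z.map_source hpz
  obtain ⟨D', hD'z, hD', hwD', F, hF, hline⟩ := exists_localFrame z.open_target sY hYe hw₀ (by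
    rintro ⟨R, hR⟩
    refine h.indep (z.symm (z p)) (R / ν (z.symm (z p)) 0) fun X' => ?_
    obtain ⟨X, rfl⟩ := hz.dSymm_surjective hw₀ X'
    obtain ⟨h1, h2, h3⟩ := mink_fderiv_coneSection (z p) X
    have h4 := fderiv_smul_coneSection z.open_target (contDiffOn_pi.1 sν' 0) contDiffOn_id hν hw₀ X
    rw [fderiv_id] at h4
    simp only [id, ContinuousLinearMap.coe_id'] at h4
    rw [← hdν hz hw₀, ← hdY _ hw₀, h4]
    simp only [mink_add_left, mink_add_right, mink_smul_left, mink_smul_right, h1, h2, h3, hR,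
      hYe _ hw₀, (isLaguerreFrame_stereographic _).products.m11, Function.comp_apply]
    have := hzU _ hw₀
    field_simp
    ring)
  have hO : IsOpen (z.source ∩ z ⁻¹' D') := z.isOpen_inter_preimage hD'
  have hsub : (z.restrOpen _ hO).target ⊆ D' := by
    intro w hw
    have h1 := (z.restrOpen _ hO).map_target hw
    rw [z.restrOpen_source] at h1
    have h2 : z (z.symm w) ∈ D' := h1.2.2
    rwa [z.right_inv hw.1] at h2
  refine ⟨z.restrOpen _ hO, hz.restr hO, ⟨hpz, hpz, hwD'⟩, F.mono hsub,
    fun w hw => hF w (hsub hw), fun w hw => (hline w (hsub hw)).trans ?_⟩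
  have h1 := isotropicLine_add_smul (Y (z.symm w)) (coneSection w) 0 (hzU w (hD'z (hsub hw)))
  rw [zero_smul, add_zero] at h1
  exact h1.symm.trans (congrArg (isotropicLine (Y (z.symm w))) (hν w (hD'z (hsub hw))).symm)

/-- A nondegenerate Legendre congruence has middle frames around every point. -/
theorem IsLegendreCongruence.exists_localFrame [IsManifold (𝓡 2) ∞ M] {Y ν : M → Mink}
    (h : IsLegendreCongruence Y ν) (p : M) :
    ∃ z : OpenPartialHomeomorph M ℂ, IsSmoothChart z ∧ p ∈ z.source ∧ ∃ F : LocalFrame z.target,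
      F.IsConformal ∧ ∀ w ∈ z.target, isotropicLine (F.a₀ w) (F.a₁ w) =
        isotropicLine (Y (z.symm w)) (ν (z.symm w)) := by
  by_cases hp : ν p 0 = 0
  -- A null vector with vanishing first component is a multiple of `ε₄`, which `poleSwap` moves to
  -- a multiple of `ε₁`.
  · have hp3 : Laguerre.poleSwap (ν p) 0 ≠ 0 := by
      intro h3
      have h2 := (h.mem_cone p).2
      simp [poleSwap_apply] at h3
      simp [mink, stdVec, hp, h3] at h2
    obtain ⟨z, hz, hpz, F, hF, hline⟩ := h.poleSwap.exists_localFrame_of_ne_zero hp3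
    refine ⟨z, hz, hpz, F.map z.open_target Laguerre.poleSwap fun a ha => ha.poleSwap, hF,
      fun w hw => ?_⟩
    have h1 := congrArg (Laguerre.poleSwap '' ·) (hline w hw)
    simp only [image_isotropicLine, poleSwap_poleSwap] at h1
    exact h1
  · exact h.exists_localFrame_of_ne_zero hp

end Existence

/-! ### Middle frames along Legendre immersions -/

section LegendreImmersions

variable {M : Type*} [TopologicalSpace M] [ChartedSpace (EuclideanSpace ℝ (Fin 2)) M]
  {f n : M → E3}

/-- The linear map `p ↦ spherePoint p 0`. -/
def centreMap : E3 →L[ℝ] Mink :=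
  ContinuousLinearMap.pi ![(√2)⁻¹ • EuclideanSpace.proj 0, EuclideanSpace.proj 1,
    EuclideanSpace.proj 2, -((√2)⁻¹ • EuclideanSpace.proj 0)]

/-- The linear part of `planeVec`. -/
def normalMap : E3 →L[ℝ] Mink :=
  ContinuousLinearMap.pi ![(2 : ℝ)⁻¹ • EuclideanSpace.proj 0, (√2)⁻¹ • EuclideanSpace.proj 1,
    (√2)⁻¹ • EuclideanSpace.proj 2, -((2 : ℝ)⁻¹ • EuclideanSpace.proj 0)]

theorem centreMap_apply (v : E3) :
    centreMap v = ![(√2)⁻¹ * v 0, v 1, v 2, -((√2)⁻¹ * v 0)] := by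
  ext i
  fin_cases i <;> rfl

theorem normalMap_apply (v : E3) :
    normalMap v = ![2⁻¹ * v 0, (√2)⁻¹ * v 1, (√2)⁻¹ * v 2, -(2⁻¹ * v 0)] := by
  ext i
  fin_cases i <;> rfl

theorem spherePoint_zero (v : E3) : spherePoint v 0 = centreMap v := by
  rw [centreMap_apply, spherePoint]
  congr! 1
  · ring
  · congr! 3
    ring

theorem planeVec_eq (v : E3) : planeVec v = ![1 / 2, 0, 0, 1 / 2] + normalMap v := by
  ext i
  rw [normalMap_apply]
  fin_cases i <;> simp [planeVec] <;> ring

theorem inner_E3 (v w : E3) : inner ℝ v w = v 0 * w 0 + v 1 * w 1 + v 2 * w 2 := by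
  simp [PiLp.inner_apply, Fin.sum_univ_three]
  ring

theorem mink_centreMap_normalMap (v w : E3) :
    mink (centreMap v) (normalMap w) = (√2)⁻¹ * inner ℝ v w := by
  simp [centreMap_apply, normalMap_apply, mink, inner_E3]
  ring

theorem mink_centreMap_planeVec (v w : E3) :
    mink (centreMap v) (planeVec w) = (√2)⁻¹ * inner ℝ v w := by
  simp [centreMap_apply, planeVec, mink, inner_E3]
  ring

theorem mink_normalMap (v w : E3) :
    mink (normalMap v) (normalMap w) = 2⁻¹ * inner ℝ v w := by
  have h : (√2)⁻¹ * (√2)⁻¹ = (2 : ℝ)⁻¹ := by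
    rw [← mul_inv, Real.mul_self_sqrt zero_le_two]
  simp [normalMap_apply, mink, inner_E3]
  linear_combination (v 1 * w 1 + v 2 * w 2) * h

theorem planeVec_mem_posLightcone {v : E3} (hv : ‖v‖ = 1) : planeVec v ∈ posLightcone := by
  have h : inner ℝ v v = 1 := by rw [real_inner_self_eq_norm_sq, hv, one_pow]
  rw [inner_E3] at h
  have h2 : (√2)⁻¹ * (√2)⁻¹ = (2 : ℝ)⁻¹ := by
    rw [← mul_inv, Real.mul_self_sqrt zero_le_two]
  constructor
  · simp only [planeVec, mink, Matrix.cons_val, div_eq_mul_inv]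
    linear_combination (v 1 * v 1 + v 2 * v 2) * h2 + h / 2
  · simp [planeVec, mink, stdVec]
    linarith

theorem IsNondegenerateLegendre.isLegendreCongruence (hF : IsNondegenerateLegendre f n) :
    IsLegendreCongruence (fun p => spherePoint (f p) 0) (fun p => planeVec (n p)) := by
  have hφ : ∀ v, HasFDerivAt planeVec normalMap v := by
    intro v
    rw [funext planeVec_eq]
    exact normalMap.hasFDerivAt.const_add _
  have hY : ∀ p X, dAt (fun p => spherePoint (f p) 0) p X = centreMap (dAt f p X) := by
    intro p X
    simp only [spherePoint_zero]
    exact dAt_comp centreMap.hasFDerivAt ((hF.smooth_f p).mdifferentiableAt (by simp)) X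
  have hν : ∀ p X, dAt (fun p => planeVec (n p)) p X = normalMap (dAt n p X) := fun p X =>
    dAt_comp (hφ _) ((hF.smooth_n p).mdifferentiableAt (by simp)) X
  have s2 : (√2)⁻¹ ≠ (0 : ℝ) := by positivity
  refine ⟨?_, ?_, fun p => planeVec_mem_posLightcone (hF.norm_n p), fun p X => ?_,
    fun p X hX => ?_, fun p R hR => ?_⟩
  · simp only [spherePoint_zero]
    exact centreMap.contDiff.contMDiff.comp hF.smooth_f
  · simp only [planeVec_eq]
    exact (contDiff_const.add normalMap.contDiff).contMDiff.comp hF.smooth_n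
  · rw [hY, mink_centreMap_planeVec, hF.legendre, mul_zero]
  · rw [hν, mink_normalMap]
    exact mul_pos (by norm_num) (hF.dn_pos p X hX)
  · refine s2 (hF.indep p (√2)⁻¹ (-(R * 2⁻¹)) fun X => ?_).1
    have h := hR X
    rw [hY, hν, mink_centreMap_normalMap, mink_normalMap] at h
    linear_combination h

theorem IsSmoothChart.dAt_comp_chart {z : OpenPartialHomeomorph M ℂ} (hz : IsSmoothChart z)
    {V : Type*} [NormedAddCommGroup V] [NormedSpace ℝ V] {g : ℂ → V}
    (hg : ContDiffOn ℝ ∞ g z.target) {q : M} (hq : q ∈ z.source) (X : TangentSpace (𝓡 2) q) :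
    dAt (fun q => g (z q)) q X = fderiv ℝ g (z q) (dAt z q X) :=
  dAt_comp (hg.differentiableAt_of_mem_isOpen z.open_target (z.map_source hq)).hasFDerivAt
    (hz.mdifferentiableAt hq) X

theorem IsSmoothChart.contMDiffOn_comp {z : OpenPartialHomeomorph M ℂ} (hz : IsSmoothChart z)
    {V : Type*} [NormedAddCommGroup V] [NormedSpace ℝ V] {g : ℂ → V}
    (hg : ContDiffOn ℝ ∞ g z.target) :
    ContMDiffOn (𝓡 2) 𝓘(ℝ, V) ∞ (fun q => g (z q)) z.source :=
  (contMDiffOn_iff_contDiffOn.2 hg).comp hz.1 fun _ hq => z.map_source hq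

theorem IsSmoothChart.eq_zero_of_dAt_eq_zero {z : OpenPartialHomeomorph M ℂ} (hz : IsSmoothChart z)
    {q : M} (hq : q ∈ z.source) {X : TangentSpace (𝓡 2) q} (h : dAt z q X = 0) : X = 0 := by
  obtain ⟨y, hy, rfl⟩ : ∃ y ∈ z.target, z.symm y = q := ⟨z q, z.map_source hq, z.left_inv hq⟩
  obtain ⟨Y, rfl⟩ := hz.dSymm_surjective hy X
  rw [hz.dAt_dSymm hy] at h
  rw [h, map_zero]

/-- The middle frame field on the domain of a chart that is given by a middle frame in this
chart. -/
def LocalFrame.toMiddleFrame {z : OpenPartialHomeomorph M ℂ} (hz : IsSmoothChart z)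
    (F : LocalFrame z.target)
    (hF : ∀ w ∈ z.target, isotropicLine (F.a₀ w) (F.a₁ w) =
      contactLine (f (z.symm w)) (n (z.symm w))) : MiddleFrame f n z.source where
  a₀ q := F.a₀ (z q)
  a₁ q := F.a₁ (z q)
  a₂ q := F.a₂ (z q)
  a₃ q := F.a₃ (z q)
  a₄ q := F.a₄ (z q)
  p₁ q := F.p₁ (z q)
  p₂ q := F.p₂ (z q)
  p₃ q := F.p₃ (z q)
  q₁ q := F.q₁ (z q)
  q₂ q := F.q₂ (z q)
  α₂ q := (F.α₂ (z q)).comp (dAt z q)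
  α₃ q := (F.α₃ (z q)).comp (dAt z q)
  smooth_a₀ := hz.contMDiffOn_comp F.smooth_a₀
  smooth_a₁ := hz.contMDiffOn_comp F.smooth_a₁
  smooth_a₂ := hz.contMDiffOn_comp F.smooth_a₂
  smooth_a₃ := hz.contMDiffOn_comp F.smooth_a₃
  smooth_a₄ := hz.contMDiffOn_comp F.smooth_a₄
  smooth_p₁ := hz.contMDiffOn_comp F.smooth_p₁
  smooth_p₂ := hz.contMDiffOn_comp F.smooth_p₂
  smooth_p₃ := hz.contMDiffOn_comp F.smooth_p₃
  smooth_q₁ := hz.contMDiffOn_comp F.smooth_q₁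
  smooth_q₂ := hz.contMDiffOn_comp F.smooth_q₂
  frame q hq := F.frame _ (z.map_source hq)
  along q hq := by
    rw [hF _ (z.map_source hq), z.left_inv hq]
  coframe q hq X h2 h3 := hz.eq_zero_of_dAt_eq_zero hq (F.coframe _ (z.map_source hq) _ h2 h3)
  d_a₀ q hq X := by
    rw [hz.dAt_comp_chart F.smooth_a₀ hq, F.d_a₀ _ (z.map_source hq)]
    rfl
  d_a₁ q hq X := by
    rw [hz.dAt_comp_chart F.smooth_a₁ hq, F.d_a₁ _ (z.map_source hq), F.τ_eq _ (z.map_source hq)]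
    simp only [add_apply, smul_apply, smul_eq_mul, ContinuousLinearMap.comp_apply]
    module
  d_a₂ q hq X := by
    rw [hz.dAt_comp_chart F.smooth_a₂ hq, F.d_a₂ _ (z.map_source hq), F.ψ_eq _ (z.map_source hq),
      F.β₁_eq _ (z.map_source hq)]
    simp only [add_apply, smul_apply, smul_eq_mul, ContinuousLinearMap.comp_apply]
  d_a₃ q hq X := by
    rw [hz.dAt_comp_chart F.smooth_a₃ hq, F.d_a₃ _ (z.map_source hq), F.ψ_eq _ (z.map_source hq),
      F.β₂_eq _ (z.map_source hq)]
    simp only [add_apply, smul_apply, smul_eq_mul, ContinuousLinearMap.comp_apply]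
    module
  d_a₄ q hq X := by
    rw [hz.dAt_comp_chart F.smooth_a₄ hq, F.d_a₄ _ (z.map_source hq), F.τ_eq _ (z.map_source hq),
      F.β₁_eq _ (z.map_source hq), F.β₂_eq _ (z.map_source hq)]
    simp only [add_apply, smul_apply, smul_eq_mul, ContinuousLinearMap.comp_apply]
    module

/-- A nondegenerate Legendre immersion has, around every point, a complex coordinate with a middle
frame field on its domain. -/
theorem IsNondegenerateLegendre.exists_middleFrame [IsManifold (𝓡 2) ∞ M]
    (hF : IsNondegenerateLegendre f n) (p : M) :
    ∃ (z : OpenPartialHomeomorph M ℂ) (_ : IsComplexCoord f n z) (_ : MiddleFrame f n z.source),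
      p ∈ z.source := by
  obtain ⟨z, hz, hpz, G, hG, hline⟩ := hF.isLegendreCongruence.exists_localFrame p
  let F : MiddleFrame f n z.source := G.toMiddleFrame hz hline
  refine ⟨z, hz.isComplexCoord z.open_source F (fun w hw X => ?_) subset_rfl, F, hpz⟩
  have hα : ∀ X, (hz.pullback z.open_source F).α₂ w X = G.α₂ w X ∧
      (hz.pullback z.open_source F).α₃ w X = G.α₃ w X := by
    intro X
    have h1 := hz.dAt_dSymm hw.1 X
    have h2 : z (z.symm w) = w := z.right_inv hw.1
    have h3 : (hz.pullback z.open_source F).α₂ w X =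
        G.α₂ (z (z.symm w)) (dAt z (z.symm w) (dSymm z w X)) := rfl
    have h4 : (hz.pullback z.open_source F).α₃ w X =
        G.α₃ (z (z.symm w)) (dAt z (z.symm w) (dSymm z w X)) := rfl
    rw [h3, h4, h1, h2]
    exact ⟨rfl, rfl⟩
  rw [MovingFrame.lam, (hα X).1, (hα X).2, (hα 1).1, (hα 1).2]
  exact hG w hw.1 X

end LegendreImmersions

end

end Laguerre

theorem proposition3p4 {M : Type*} [TopologicalSpace M]
    [ChartedSpace (EuclideanSpace ℝ (Fin 2)) M] [IsManifold (𝓡 2) ∞ M]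
    (f n : M → Laguerre.E3) (hF : Laguerre.IsNondegenerateLegendre f n) :
    -- (1)
    (Laguerre.IsHolomorphicDiff f n 4 (Laguerre.quarticDiff f n) ↔
      Laguerre.HasParallelMeanCurvature (Laguerre.gaussMap f n)) ∧
    -- (2)
    (Laguerre.IsHolomorphicDiff f n 4 (Laguerre.quarticDiff f n) →
      Laguerre.IsHolomorphicDiff f n 2 (Laguerre.quadraticDiff f n)) ∧
    -- (3)
    (ConnectedSpace M →
      Laguerre.IsHolomorphicDiff f n 4 (Laguerre.quarticDiff f n) →
      (∃ (p : M) (X : TangentSpace (𝓡 2) p), Laguerre.quadraticDiff f n p X ≠ 0) →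
      Laguerre.IsLIsothermic f n) ∧
    -- (4)
    (ConnectedSpace M →
      Laguerre.IsHolomorphicDiff f n 4 (Laguerre.quarticDiff f n) →
      (∃ (p : M) (X : TangentSpace (𝓡 2) p), Laguerre.quadraticDiff f n p X ≠ 0) →
      ∃ c : ℝ, ∀ p : M, Laguerre.invQ f n p = (c : ℂ) * (Laguerre.invP f n p : ℂ) ^ 2) :=
  ⟨⟨fun h => h.hasParallelMeanCurvature,
    Laguerre.isHolomorphicDiff_quarticDiff hF.exists_middleFrame⟩,
    fun h => h.quadraticDiff,
    fun _ h hne => h.isLIsothermic (h.invP_ne_zero hne),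
    fun _ h hne => h.exists_invQ_eq (h.invP_ne_zero hne)⟩
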